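/- **Setting.** A *reference operator* is a self-adjoint operator $\mathbb A_0$ on a real separable Hilbert space $H$, with dense domain $W=D(\mathbb A_0)$, such that $0\notin\sigma_{ess}(\mathbb A_0)$, i.e. $\mathbb A_0:W\to H$ is Fredholm. $W$ carries the graph norm $\|x\|_W^2=\|x\|_H^2+\|\mathbb A_0x\|_H^2$; the inclusion $W\hookrightarrow H$ need not be compact. (If $\mathbb A_0$ is a reference operator on $H_0$ with domain $W_0$ and $V=\mathbb R^n$, then $\mathbb A_0\oplus 0$ is a reference operator on $H_0\oplus V$ with domain $W_0\oplus V$, so the pairs $(W_0\oplus V,H_0\oplus V)$ are included.) An operator $W\to H$ is *admissible* if it equals $\mathbb A_0+K$ with $K:W\to H$ compact and symmetric ($\langle Kx,y\rangle_H=\langle x,Ky\rangle_H$ for $x,y\in W$). Let $\mathscr A(\mathbb A_0)$ be the set of all continuous (in the operator norm of $W\to H$) paths $\mathbb A:\mathbb R\to\{\text{admissible operators}\}$ whose limits $\mathbb A^\pm=\lim_{t\to\pm\infty}\mathbb A(t):W\to H$ exist and are invertible, with the distance $\sup_t\|\mathbb A_1(t)-\mathbb A_2(t)\|_{W\to H}$.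 For an integer $k\ge0$ let $\mathscr A^k(\mathbb A_0)\subset\mathscr A(\mathbb A_0)$ be the set of paths of class $C^k$ that have finite distance from some constant admissible path in the metric $\sup_t\sum_{j\le k}\|\frac{d^j}{dt^j}(\mathbb A_1-\mathbb A_2)(t)\|_{W\to H}$. **Spectral flow.** There is exactly one family of maps $\mu:\mathscr A(\mathbb A_0)\to\mathbb Z$, one for each reference operator $\mathbb A_0$, such that: - (Homotopy) $\mu$ is constant on the connected components of $\mathscr A(\mathbb A_0)$; - (Constant) $\mu(\mathbb A)=0$ if $\mathbb A$ is a constant path; - (Direct sum) $\mu(\mathbb A_1\oplus\mathbb A_2)=\mu(\mathbb A_1)+\mu(\mathbb A_2)$ for $\mathbb A_i\in\mathscr A(\mathbb A_{0i})$, where $\mathbb A_1\oplus\mathbb A_2\in\mathscr A(\mathbb A_{01}\oplus\mathbb A_{02})$; - (Catenation) $\mu(\mathbb A)=\mu(\mathbb A_l)+\mu(\mathbb A_r)$ whenever $\mathbb A,\mathbb A_l,\mathbb A_r\in\mathscr A(\mathbb A_0)$ satisfy $\mathbb A_l(t)=\mathbb A(0)=\mathbb A_r(-t)$ for $t\ge0$,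 $\mathbb A=\mathbb A_l$ on $(-\infty,0]$ and $\mathbb A=\mathbb A_r$ on $[0,\infty)$; - (Normalization) if $\dim H=1$ and $\mathbb A(t)=\arctan(t)\cdot\mathrm{id}$, then $\mu(\mathbb A)=1$. The integer $\mu(\mathbb A)$ is called the spectral flow of $\mathbb A$. **Theorem 16.2.** Let $L^2_k(\mathbb R,E)$ be the space of $L^2$ functions $\mathbb R\to E$ whose weak derivatives up to order $k$ lie in $L^2$, with $\|f\|^2=\sum_{j\le k}\|f^{(j)}\|_{L^2}^2$, and let $\mathcal W_k=L^2_k(\mathbb R,W)\cap L^2_{k+1}(\mathbb R,H)$ with $$\|\xi\|_{\mathcal W_k}^2=\int_{\mathbb R}\Big(\sum_{0\le j\le k+1}\big\|\tfrac{d^j}{dt^j}\xi\big\|_H^2+\sum_{0\le j\le k}\big\|\tfrac{d^j}{dt^j}\xi\big\|_W^2\Big)dt.$$ For every reference operator $\mathbb A_0$, every integer $k\ge0$ and every $\mathbb A\in\mathscr A^k(\mathbb A_0)$ such that $\mathbb A(t+\cdot)\to\mathbb A^\pm$ in the $C^k_{loc}$ topology as $t\to\pm\infty$, the formula $$(D_{\mathbb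 A}\xi)(t)=\tfrac{d}{dt}\xi(t)+\mathbb A(t)\xi(t)$$ defines a bounded linear operator $D_{\mathbb A}:\mathcal W_k\to L^2_k(\mathbb R,H)$, which is Fredholm, and its index $\dim\ker D_{\mathbb A}-\dim\operatorname{coker}D_{\mathbb A}$ is $\mu(\mathbb A)$. -/

import Mathlib

open MeasureTheory Filter Topology
open scoped ContDiff InnerProductSpace

universe u v

noncomputable section

namespace SpectralFlow

/-! ## Unbounded operators: graph norm, essential spectrum -/

section Graph

variable {H : Type u} [NormedAddCommGroup H] [InnerProductSpace ℝ H]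

/-- The domain `W` of an unbounded operator `A` on `H`, with the graph norm
`‖x‖_W ^ 2 = ‖x‖ ^ 2 + ‖A x‖ ^ 2`. It is realized as the graph `{(x, A x)}` of `A` inside the
Hilbert sum `H ⊕ H`, so that the norm (and inner product) is the induced one. -/
def graphSpace (A : H →ₗ.[ℝ] H) : Submodule ℝ (WithLp 2 (H × H)) :=
  A.graph.comap (WithLp.linearEquiv 2 ℝ (H × H)).toLinearMap

/-- The inclusion `W → H`. -/
def graphIncl (A : H →ₗ.[ℝ] H) : graphSpace A →L[ℝ] H :=
  (WithLp.fstL 2 ℝ H H).comp (graphSpace A).subtypeL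

/-- The operator `A` as a bounded operator `W → H`. -/
def graphMap (A : H →ₗ.[ℝ] H) : graphSpace A →L[ℝ] H :=
  (WithLp.sndL 2 ℝ H H).comp (graphSpace A).subtypeL

/-- The (real part of the) essential spectrum: the set of those `c` for which `A - c : W → H` is
not a Fredholm operator. For a self-adjoint operator the whole spectrum is real. -/
def essentialSpectrum (A : H →ₗ.[ℝ] H) : Set ℝ :=
  {c | ¬ (graphMap A - c • graphIncl A).IsFredholm}

theorem mem_graphSpace_iff (A : H →ₗ.[ℝ] H) (w : WithLp 2 (H × H)) :
    w ∈ graphSpace A ↔ ∃ h : w.fst ∈ A.domain, A ⟨w.fst, h⟩ = w.snd := by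
  change (w.fst, w.snd) ∈ A.graph ↔ _
  rw [LinearPMap.mem_graph_iff]
  constructor
  · rintro ⟨y, hy, hy'⟩
    simp only at hy hy'
    have h : w.fst ∈ A.domain := hy ▸ y.2
    refine ⟨h, ?_⟩
    rw [← hy']
    congr 1
    exact Subtype.ext hy.symm
  · rintro ⟨h, h'⟩
    exact ⟨⟨w.fst, h⟩, rfl, h'⟩

/-- A criterion for self-adjointness. -/
theorem isSelfAdjoint_of_symmetric_of_maximal [CompleteSpace H] (A : H →ₗ.[ℝ] H)
    (hd : Dense (A.domain : Set H)) (hs : A.IsFormalAdjoint A)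
    (hm : ∀ y w : H, (∀ x : A.domain, ⟪w, (x : H)⟫_ℝ = ⟪y, A x⟫_ℝ) → y ∈ A.domain) :
    IsSelfAdjoint A := by
  rw [LinearPMap.isSelfAdjoint_def]
  have hle : A ≤ A.adjoint := LinearPMap.IsFormalAdjoint.le_adjoint hd hs
  refine (LinearPMap.eq_of_le_of_domain_eq hle (le_antisymm hle.1 fun y hy => ?_)).symm
  exact hm y (A.adjoint ⟨y, hy⟩) fun x => LinearPMap.adjoint_isFormalAdjoint hd ⟨y, hy⟩ x

theorem graphSpace_isClosed [CompleteSpace H] {A : H →ₗ.[ℝ] H} (hA : IsSelfAdjoint A) :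
    IsClosed (graphSpace A : Set (WithLp 2 (H × H))) :=
  hA.isClosed.preimage (WithLp.prodContinuousLinearEquiv 2 ℝ H H).continuous

end Graph

/-- A reference operator: a self-adjoint operator, defined on a dense domain in a real separable
Hilbert space `H`, whose essential spectrum does not contain `0`. -/
structure ReferenceOperator : Type (u + 1) where
  H : Type u
  [instNormed : NormedAddCommGroup H]
  [instInner : InnerProductSpace ℝ H]
  [instComplete : CompleteSpace H]
  [instSeparable : TopologicalSpace.SeparableSpace H]
  op : H →ₗ.[ℝ] H
  dense_domain : Dense (op.domain : Set H)
  isSelfAdjoint : IsSelfAdjoint op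
  zero_notMem : (0 : ℝ) ∉ essentialSpectrum op

attribute [instance] ReferenceOperator.instNormed ReferenceOperator.instInner
  ReferenceOperator.instComplete ReferenceOperator.instSeparable

/-! ## Direct sums of unbounded operators -/

section Prod

variable {H₁ : Type u} [NormedAddCommGroup H₁] [InnerProductSpace ℝ H₁]
  {H₂ : Type v} [NormedAddCommGroup H₂] [InnerProductSpace ℝ H₂]

/-- The direct sum `A ⊕ B` on the Hilbert sum `H₁ ⊕ H₂`, with domain `D(A) ⊕ D(B)`. -/
def prodOp (A : H₁ →ₗ.[ℝ] H₁) (B : H₂ →ₗ.[ℝ] H₂) :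
    WithLp 2 (H₁ × H₂) →ₗ.[ℝ] WithLp 2 (H₁ × H₂) where
  domain := (A.domain.prod B.domain).comap (WithLp.linearEquiv 2 ℝ (H₁ × H₂)).toLinearMap
  toFun :=
    { toFun := fun x => WithLp.toLp 2 (A ⟨x.1.fst, x.2.1⟩, B ⟨x.1.snd, x.2.2⟩)
      map_add' := fun x y => by
        have h1 := A.map_add ⟨x.1.fst, x.2.1⟩ ⟨y.1.fst, y.2.1⟩
        have h2 := B.map_add ⟨x.1.snd, x.2.2⟩ ⟨y.1.snd, y.2.2⟩
        rw [← WithLp.toLp_add, Prod.mk_add_mk, ← h1, ← h2]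
        rfl
      map_smul' := fun c x => by
        have h1 := A.map_smul c ⟨x.1.fst, x.2.1⟩
        have h2 := B.map_smul c ⟨x.1.snd, x.2.2⟩
        rw [RingHom.id_apply, ← WithLp.toLp_smul, Prod.smul_mk, ← h1, ← h2]
        rfl }

theorem prodOp_apply (A : H₁ →ₗ.[ℝ] H₁) (B : H₂ →ₗ.[ℝ] H₂) (x : (prodOp A B).domain) :
    prodOp A B x = WithLp.toLp 2 (A ⟨x.1.fst, x.2.1⟩, B ⟨x.1.snd, x.2.2⟩) := rfl

theorem prodOp_dense {A : H₁ →ₗ.[ℝ] H₁} {B : H₂ →ₗ.[ℝ] H₂}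
    (hA : Dense (A.domain : Set H₁)) (hB : Dense (B.domain : Set H₂)) :
    Dense ((prodOp A B).domain : Set (WithLp 2 (H₁ × H₂))) :=
  (hA.prod hB).preimage (WithLp.prodContinuousLinearEquiv 2 ℝ H₁ H₂).toHomeomorph.isOpenMap

theorem prodOp_isSelfAdjoint [CompleteSpace H₁] [CompleteSpace H₂]
    {A : H₁ →ₗ.[ℝ] H₁} {B : H₂ →ₗ.[ℝ] H₂}
    (hA : IsSelfAdjoint A) (hB : IsSelfAdjoint B) : IsSelfAdjoint (prodOp A B) := by
  have hA' : A.adjoint.IsFormalAdjoint A := LinearPMap.adjoint_isFormalAdjoint hA.dense_domain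
  have hB' : B.adjoint.IsFormalAdjoint B := LinearPMap.adjoint_isFormalAdjoint hB.dense_domain
  rw [LinearPMap.isSelfAdjoint_def.mp hA] at hA'
  rw [LinearPMap.isSelfAdjoint_def.mp hB] at hB'
  refine isSelfAdjoint_of_symmetric_of_maximal _
    (prodOp_dense hA.dense_domain hB.dense_domain) ?_ ?_
  · intro x y
    rw [prodOp_apply, prodOp_apply, WithLp.prod_inner_apply, WithLp.prod_inner_apply]
    exact congrArg₂ (· + ·) (hA' ⟨x.1.fst, x.2.1⟩ ⟨y.1.fst, y.2.1⟩)
      (hB' ⟨x.1.snd, x.2.2⟩ ⟨y.1.snd, y.2.2⟩)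
  · intro y w h
    have e1 : y.fst ∈ A.domain := by
      rw [← LinearPMap.isSelfAdjoint_def.mp hA]
      refine LinearPMap.mem_adjoint_domain_of_exists _ ⟨w.fst, fun x => ?_⟩
      have := h ⟨WithLp.toLp 2 ((x : H₁), (0 : H₂)), x.2, B.domain.zero_mem⟩
      rw [prodOp_apply, WithLp.prod_inner_apply, WithLp.prod_inner_apply] at this
      have hz : B ⟨0, B.domain.zero_mem⟩ = 0 := B.map_zero
      simpa [hz] using this
    have e2 : y.snd ∈ B.domain := by
      rw [← LinearPMap.isSelfAdjoint_def.mp hB]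
      refine LinearPMap.mem_adjoint_domain_of_exists _ ⟨w.snd, fun x => ?_⟩
      have := h ⟨WithLp.toLp 2 ((0 : H₁), (x : H₂)), A.domain.zero_mem, x.2⟩
      rw [prodOp_apply, WithLp.prod_inner_apply, WithLp.prod_inner_apply] at this
      have hz : A ⟨0, A.domain.zero_mem⟩ = 0 := A.map_zero
      simpa [hz] using this
    exact ⟨e1, e2⟩

/-- The first component `(x₁, x₂) ↦ x₁` from the domain of `A ⊕ B` to the domain of `A`. -/
def prodFst (A : H₁ →ₗ.[ℝ] H₁) (B : H₂ →ₗ.[ℝ] H₂) :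
    graphSpace (prodOp A B) →L[ℝ] graphSpace A :=
  (((WithLp.prodContinuousLinearEquiv 2 ℝ H₁ H₁).symm.toContinuousLinearMap.comp
    (((WithLp.fstL 2 ℝ H₁ H₂).comp (graphIncl (prodOp A B))).prod
      ((WithLp.fstL 2 ℝ H₁ H₂).comp (graphMap (prodOp A B)))))).codRestrict (graphSpace A) (by
    rintro ⟨w, hw⟩
    obtain ⟨h, h'⟩ := (mem_graphSpace_iff _ _).1 hw
    refine (mem_graphSpace_iff _ _).2 ⟨h.1, ?_⟩
    exact congrArg WithLp.fst h')

/-- The second component `(x₁, x₂) ↦ x₂` from the domain of `A ⊕ B` to the domain of `B`. -/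
def prodSnd (A : H₁ →ₗ.[ℝ] H₁) (B : H₂ →ₗ.[ℝ] H₂) :
    graphSpace (prodOp A B) →L[ℝ] graphSpace B :=
  (((WithLp.prodContinuousLinearEquiv 2 ℝ H₂ H₂).symm.toContinuousLinearMap.comp
    (((WithLp.sndL 2 ℝ H₁ H₂).comp (graphIncl (prodOp A B))).prod
      ((WithLp.sndL 2 ℝ H₁ H₂).comp (graphMap (prodOp A B)))))).codRestrict (graphSpace B) (by
    rintro ⟨w, hw⟩
    obtain ⟨h, h'⟩ := (mem_graphSpace_iff _ _).1 hw
    refine (mem_graphSpace_iff _ _).2 ⟨h.2, ?_⟩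
    exact congrArg WithLp.snd h')


/-- The inclusion `x ↦ (x, 0)` of the domain of `A` into the domain of `A ⊕ B`. -/
def prodInl (A : H₁ →ₗ.[ℝ] H₁) (B : H₂ →ₗ.[ℝ] H₂) :
    graphSpace A →L[ℝ] graphSpace (prodOp A B) :=
  ((WithLp.prodContinuousLinearEquiv 2 ℝ _ _).symm.toContinuousLinearMap.comp
    (((WithLp.prodContinuousLinearEquiv 2 ℝ H₁ H₂).symm.toContinuousLinearMap.comp
        ((graphIncl A).prod 0)).prod
      ((WithLp.prodContinuousLinearEquiv 2 ℝ H₁ H₂).symm.toContinuousLinearMap.comp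
        ((graphMap A).prod 0)))).codRestrict _ (by
    rintro ⟨w, hw⟩
    obtain ⟨h, h'⟩ := (mem_graphSpace_iff _ _).1 hw
    refine (mem_graphSpace_iff _ _).2 ⟨⟨h, B.domain.zero_mem⟩, ?_⟩
    rw [prodOp_apply]
    exact congrArg (WithLp.toLp 2) (Prod.ext h' B.map_zero))

/-- The inclusion `x ↦ (0, x)` of the domain of `B` into the domain of `A ⊕ B`. -/
def prodInr (A : H₁ →ₗ.[ℝ] H₁) (B : H₂ →ₗ.[ℝ] H₂) :
    graphSpace B →L[ℝ] graphSpace (prodOp A B) :=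
  ((WithLp.prodContinuousLinearEquiv 2 ℝ _ _).symm.toContinuousLinearMap.comp
    (((WithLp.prodContinuousLinearEquiv 2 ℝ H₁ H₂).symm.toContinuousLinearMap.comp
        ((0 : graphSpace B →L[ℝ] H₁).prod (graphIncl B))).prod
      ((WithLp.prodContinuousLinearEquiv 2 ℝ H₁ H₂).symm.toContinuousLinearMap.comp
        ((0 : graphSpace B →L[ℝ] H₁).prod (graphMap B))))).codRestrict _ (by
    rintro ⟨w, hw⟩
    obtain ⟨h, h'⟩ := (mem_graphSpace_iff _ _).1 hw
    refine (mem_graphSpace_iff _ _).2 ⟨⟨A.domain.zero_mem, h⟩, ?_⟩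
    rw [prodOp_apply]
    exact congrArg (WithLp.toLp 2) (Prod.ext A.map_zero h'))

theorem prodOp_isFredholm {A : H₁ →ₗ.[ℝ] H₁} {B : H₂ →ₗ.[ℝ] H₂}
    (hA : (graphMap A).IsFredholm) (hB : (graphMap B).IsFredholm) :
    (graphMap (prodOp A B)).IsFredholm := by
  obtain ⟨a, ha1, ha2⟩ := hA.exists_isQuasiInverse
  obtain ⟨b, hb1, hb2⟩ := hB.exists_isQuasiInverse
  have ha1 := LinearMap.FiniteRangeSetoid.equiv_iff_hasNoetherianRange.1 ha1
  have ha2 := LinearMap.FiniteRangeSetoid.equiv_iff_hasNoetherianRange.1 ha2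
  have hb1 := LinearMap.FiniteRangeSetoid.equiv_iff_hasNoetherianRange.1 hb1
  have hb2 := LinearMap.FiniteRangeSetoid.equiv_iff_hasNoetherianRange.1 hb2
  let q₁ := WithLp.fstL 2 ℝ H₁ H₂
  let q₂ := WithLp.sndL 2 ℝ H₁ H₂
  let j : H₁ × H₂ →L[ℝ] WithLp 2 (H₁ × H₂) :=
    (WithLp.prodContinuousLinearEquiv 2 ℝ H₁ H₂).symm.toContinuousLinearMap
  let j₁ := j.comp (ContinuousLinearMap.inl ℝ H₁ H₂)
  let j₂ := j.comp (ContinuousLinearMap.inr ℝ H₁ H₂)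
  refine ContinuousLinearMap.IsFredholm.of_isQuasiInverse
    (v := (prodInl A B).comp (a.comp q₁) + (prodInr A B).comp (b.comp q₂)) ⟨?_, ?_⟩
  · refine LinearMap.FiniteRangeSetoid.equiv_iff_hasNoetherianRange.2 ?_
    have := ((ha1.comp_right (prodFst A B).toLinearMap).comp_left (prodInl A B).toLinearMap).add
      ((hb1.comp_right (prodSnd A B).toLinearMap).comp_left (prodInr A B).toLinearMap)
    refine cast (congrArg LinearMap.HasNoetherianRange (LinearMap.ext fun w => Eq.symm ?_)) this
    have hw : w = prodInl A B (prodFst A B w) + prodInr A B (prodSnd A B w) := by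
      apply Subtype.ext
      refine WithLp.ofLp_injective 2 (Prod.ext ?_ ?_) <;>
      refine WithLp.ofLp_injective 2 (Prod.ext ?_ ?_)
      · exact (add_zero _).symm
      · exact (zero_add _).symm
      · exact (add_zero _).symm
      · exact (zero_add _).symm
    have h1 : q₁ (graphMap (prodOp A B) w) = graphMap A (prodFst A B w) := rfl
    have h2 : q₂ (graphMap (prodOp A B) w) = graphMap B (prodSnd A B w) := rfl
    simp only [LinearMap.sub_apply, LinearMap.comp_apply, LinearMap.add_apply, LinearMap.id_apply,
      ContinuousLinearMap.coe_coe, add_apply, ContinuousLinearMap.comp_apply,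
      h1, h2, map_sub]
    nth_rw 3 [hw]
    abel
  · refine LinearMap.FiniteRangeSetoid.equiv_iff_hasNoetherianRange.2 ?_
    have := ((ha2.comp_right q₁.toLinearMap).comp_left j₁.toLinearMap).add
      ((hb2.comp_right q₂.toLinearMap).comp_left j₂.toLinearMap)
    refine cast (congrArg LinearMap.HasNoetherianRange (LinearMap.ext fun x => Eq.symm ?_)) this
    have hx : x = j₁ (q₁ x) + j₂ (q₂ x) := by
      refine WithLp.ofLp_injective 2 (Prod.ext ?_ ?_)
      · exact (add_zero _).symm
      · exact (zero_add _).symm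
    have h1 : ∀ w, graphMap (prodOp A B) (prodInl A B w) = j₁ (graphMap A w) := fun _ => rfl
    have h2 : ∀ w, graphMap (prodOp A B) (prodInr A B w) = j₂ (graphMap B w) := fun _ => rfl
    simp only [LinearMap.sub_apply, LinearMap.comp_apply, LinearMap.add_apply, LinearMap.id_apply,
      ContinuousLinearMap.coe_coe, add_apply, ContinuousLinearMap.comp_apply,
      map_add, h1, h2, map_sub]
    nth_rw 3 [hx]
    abel

end Prod

/-! ## Reference operators -/

theorem isFredholm_of_finiteDimensional {H : Type u} [NormedAddCommGroup H]
    [InnerProductSpace ℝ H] [FiniteDimensional ℝ H] (A : H →ₗ.[ℝ] H) :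
    (graphMap A).IsFredholm := by
  have : FiniteDimensional ℝ (WithLp 2 (H × H)) := inferInstance
  have : FiniteDimensional ℝ (graphSpace A) := inferInstance
  refine ContinuousLinearMap.IsFredholm.of_isQuasiInverse (v := 0) ⟨?_, ?_⟩
  · exact LinearMap.FiniteRangeSetoid.equiv_iff_hasNoetherianRange.2
      LinearMap.HasNoetherianRange.of_isNoetherian_dom
  · exact LinearMap.FiniteRangeSetoid.equiv_iff_hasNoetherianRange.2
      LinearMap.HasNoetherianRange.of_isNoetherian_dom

theorem zero_notMem_essentialSpectrum_iff {H : Type u} [NormedAddCommGroup H]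
    [InnerProductSpace ℝ H] (A : H →ₗ.[ℝ] H) :
    (0 : ℝ) ∉ essentialSpectrum A ↔ (graphMap A).IsFredholm := by
  simp [essentialSpectrum]

namespace ReferenceOperator

/-- The Hilbert space `W`: the domain of the reference operator with the graph norm. -/
abbrev W (T : ReferenceOperator.{u}) : Type u := graphSpace T.op

/-- The inclusion `W → H`. -/
abbrev incl (T : ReferenceOperator.{u}) : T.W →L[ℝ] T.H := graphIncl T.op

/-- The reference operator as a bounded operator `W → H`. -/
abbrev base (T : ReferenceOperator.{u}) : T.W →L[ℝ] T.H := graphMap T.op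

instance (T : ReferenceOperator.{u}) : CompleteSpace T.W :=
  (graphSpace_isClosed T.isSelfAdjoint).completeSpace_coe

/-- The direct sum of two reference operators. -/
def prod (T₁ : ReferenceOperator.{u}) (T₂ : ReferenceOperator.{v}) :
    ReferenceOperator.{max u v} where
  H := WithLp 2 (T₁.H × T₂.H)
  instSeparable :=
    (WithLp.prodContinuousLinearEquiv 2 ℝ T₁.H T₂.H).symm.surjective.denseRange.separableSpace
      (WithLp.prodContinuousLinearEquiv 2 ℝ T₁.H T₂.H).symm.continuous
  op := prodOp T₁.op T₂.op
  dense_domain := prodOp_dense T₁.dense_domain T₂.dense_domain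
  isSelfAdjoint := prodOp_isSelfAdjoint T₁.isSelfAdjoint T₂.isSelfAdjoint
  zero_notMem := (zero_notMem_essentialSpectrum_iff _).2 <| prodOp_isFredholm
    ((zero_notMem_essentialSpectrum_iff _).1 T₁.zero_notMem)
    ((zero_notMem_essentialSpectrum_iff _).1 T₂.zero_notMem)

/-- The zero operator on `V = ℝ ^ n`. -/
def zeroFin (n : ℕ) : ReferenceOperator.{0} where
  H := EuclideanSpace ℝ (Fin n)
  op := (0 : EuclideanSpace ℝ (Fin n) →ₗ[ℝ] EuclideanSpace ℝ (Fin n)).toPMap ⊤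
  dense_domain := dense_univ
  isSelfAdjoint := isSelfAdjoint_of_symmetric_of_maximal _ dense_univ
    (fun _ _ => (inner_zero_left _).trans (inner_zero_right _).symm) (fun _ _ _ => trivial)
  zero_notMem := (zero_notMem_essentialSpectrum_iff _).2 (isFredholm_of_finiteDimensional _)

/-- The reference operator `A₀ ⊕ 0` of the pair `(W₀ ⊕ ℝ ^ n, H₀ ⊕ ℝ ^ n)`. Its graph norm is the
Hilbert sum norm of `W₀ ⊕ ℝ ^ n`. Since it is a reference operator again, a statement about all
reference operators includes all pairs obtained by adding a finite-dimensional space. -/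
def stabilize (T : ReferenceOperator.{u}) (n : ℕ) : ReferenceOperator.{u} :=
  T.prod (zeroFin n)

/-! ## Admissible operators and paths -/

/-- `B : W → H` is admissible if it is the reference operator plus a compact symmetric
operator `K : W → H`. -/
def IsAdmissible (T : ReferenceOperator.{u}) (B : T.W →L[ℝ] T.H) : Prop :=
  ∃ K : T.W →L[ℝ] T.H, IsCompactOperator K ∧
    (∀ x y : T.W, ⟪K x, T.incl y⟫_ℝ = ⟪T.incl x, K y⟫_ℝ) ∧ B = T.base + K

/-- Continuous paths of admissible operators having invertible limits at `-∞` and at `+∞`.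
Such a path is automatically bounded, so these are the elements of a subset of the bounded
continuous functions, and the topology is that of the supremum distance. -/
def admissiblePaths (T : ReferenceOperator.{u}) :
    Set (BoundedContinuousFunction ℝ (T.W →L[ℝ] T.H)) :=
  {A | (∀ t, T.IsAdmissible (A t)) ∧
    (∃ B : T.W →L[ℝ] T.H, B.IsInvertible ∧ Tendsto A atBot (𝓝 B)) ∧
    (∃ B : T.W →L[ℝ] T.H, B.IsInvertible ∧ Tendsto A atTop (𝓝 B))}

end ReferenceOperator

open ReferenceOperator

/-- The axioms of spectral flow, for a family of maps `μ`, one on each of the spaces of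
admissible paths. -/
structure IsSpectralFlow (μ : ∀ T : ReferenceOperator.{u}, T.admissiblePaths → ℤ) : Prop where
  homotopy : ∀ (T : ReferenceOperator.{u}) (A B : T.admissiblePaths),
    B ∈ connectedComponent A → μ T A = μ T B
  constant : ∀ (T : ReferenceOperator.{u}) (A : T.admissiblePaths),
    (∀ t, A.1 t = A.1 0) → μ T A = 0
  directSum : ∀ (T₁ T₂ : ReferenceOperator.{u}) (A₁ : T₁.admissiblePaths)
    (A₂ : T₂.admissiblePaths) (A : (T₁.prod T₂).admissiblePaths),
    (∀ (t : ℝ) (w : (T₁.prod T₂).W), A.1 t w =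
      WithLp.toLp 2 (A₁.1 t (prodFst T₁.op T₂.op w), A₂.1 t (prodSnd T₁.op T₂.op w))) →
    μ (T₁.prod T₂) A = μ T₁ A₁ + μ T₂ A₂
  catenation : ∀ (T : ReferenceOperator.{u}) (A Al Ar : T.admissiblePaths),
    (∀ t, 0 ≤ t → Al.1 t = A.1 0 ∧ Ar.1 (-t) = A.1 0) →
    (∀ t, t ≤ 0 → A.1 t = Al.1 t) → (∀ t, 0 ≤ t → A.1 t = Ar.1 t) →
    μ T A = μ T Al + μ T Ar
  /-- On a line, the path `t ↦ arctan t` has spectral flow `1`. -/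
  normalization : ∀ (T : ReferenceOperator.{u}) (A : T.admissiblePaths),
    Module.finrank ℝ T.H = 1 → (∀ t w, A.1 t w = Real.arctan t • T.incl w) → μ T A = 1

/-! ## Regularity of paths -/

/-- The path `A` is of class `C ^ k` and has finite `C ^ k`-distance from a constant path of
admissible operators. -/
def IsCkPath (T : ReferenceOperator.{u}) (k : ℕ) (A : ℝ → T.W →L[ℝ] T.H) : Prop :=
  ContDiff ℝ k A ∧ ∃ B : T.W →L[ℝ] T.H, T.IsAdmissible B ∧
    BddAbove (Set.range fun t =>
      ∑ j ∈ Finset.range (k + 1), ‖iteratedDeriv j (fun s => A s - B) t‖)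

/-- Convergence of the translates `A (t + ·)` to the constant path `B` along `l` (that is, as
`t → ±∞`) in the `C ^ k_loc` topology. -/
def TendstoCkLoc {E : Type u} [NormedAddCommGroup E] [NormedSpace ℝ E] (k : ℕ) (A : ℝ → E)
    (l : Filter ℝ) (B : E) : Prop :=
  ∀ j ≤ k, TendstoLocallyUniformly (fun t s : ℝ => iteratedDeriv j (fun r => A (t + r)) s)
    (iteratedDeriv j (fun _ => B)) l

/-! ## Sobolev spaces on the line -/

section Sobolev

variable {E : Type u} [NormedAddCommGroup E] [InnerProductSpace ℝ E]

/-- `g` is the weak derivative of `f` on the real line. -/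
def IsWeakDeriv (f g : Lp E 2 (volume : Measure ℝ)) : Prop :=
  ∀ φ : ℝ → ℝ, ContDiff ℝ ∞ φ → HasCompactSupport φ →
    ∫ t, deriv φ t • f t = - ∫ t, φ t • g t

theorem integrable_smul_of_test {φ : ℝ → ℝ} (hφ : Continuous φ) (hc : HasCompactSupport φ)
    (f : Lp E 2 (volume : Measure ℝ)) : Integrable fun t => φ t • f t := by
  have h1 : MemLp φ 2 (volume : Measure ℝ) := hφ.memLp_of_hasCompactSupport hc
  exact memLp_one_iff_integrable.1 ((Lp.memLp f).smul h1)

theorem IsWeakDeriv.add {f g f' g' : Lp E 2 (volume : Measure ℝ)} (h : IsWeakDeriv f g)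
    (h' : IsWeakDeriv f' g') : IsWeakDeriv (f + f') (g + g') := by
  intro φ hφ hc
  have hd : Continuous (deriv φ) := hφ.continuous_deriv (by simp)
  have e1 : ∫ t, deriv φ t • (f + f') t = ∫ t, (deriv φ t • f t + deriv φ t • f' t) :=
    integral_congr_ae ((Lp.coeFn_add f f').mono fun t ht => by
      simp only [ht, Pi.add_apply, smul_add])
  have e2 : ∫ t, φ t • (g + g') t = ∫ t, (φ t • g t + φ t • g' t) :=
    integral_congr_ae ((Lp.coeFn_add g g').mono fun t ht => by
      simp only [ht, Pi.add_apply, smul_add])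
  rw [e1, e2, integral_add (integrable_smul_of_test hd hc.deriv f)
    (integrable_smul_of_test hd hc.deriv f'), integral_add
    (integrable_smul_of_test hφ.continuous hc g) (integrable_smul_of_test hφ.continuous hc g'),
    h φ hφ hc, h' φ hφ hc, neg_add]

theorem IsWeakDeriv.smul {f g : Lp E 2 (volume : Measure ℝ)} (c : ℝ) (h : IsWeakDeriv f g) :
    IsWeakDeriv (c • f) (c • g) := by
  intro φ hφ hc
  have e1 : ∫ t, deriv φ t • (c • f) t = ∫ t, c • (deriv φ t • f t) :=
    integral_congr_ae ((Lp.coeFn_smul c f).mono fun t ht => by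
      simp only [ht, Pi.smul_apply, smul_comm c])
  have e2 : ∫ t, φ t • (c • g) t = ∫ t, c • (φ t • g t) :=
    integral_congr_ae ((Lp.coeFn_smul c g).mono fun t ht => by
      simp only [ht, Pi.smul_apply, smul_comm c])
  rw [e1, e2, integral_smul, integral_smul, h φ hφ hc, smul_neg]

theorem isWeakDeriv_zero : IsWeakDeriv (0 : Lp E 2 (volume : Measure ℝ)) 0 := by
  have h : ∀ ψ : ℝ → ℝ, ∫ t, ψ t • (0 : Lp E 2 (volume : Measure ℝ)) t = 0 := fun ψ => by
    rw [integral_congr_ae (g := fun _ => (0 : E)) ((Lp.coeFn_zero E 2 volume).mono fun t ht => by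
      simp only [ht, Pi.zero_apply, smul_zero]), integral_zero]
  intro φ _ _
  rw [h, h, neg_zero]

variable (E) in
/-- The tuples `(f₀, f₁, …, f_k)` of elements of `L²(ℝ, E)` such that each `f_{j+1}` is the weak
derivative of `f_j`. -/
def sobolevTuples (k : ℕ) :
    Submodule ℝ (PiLp 2 fun _ : Fin (k + 1) => Lp E 2 (volume : Measure ℝ)) where
  carrier := {f | ∀ j : Fin k, IsWeakDeriv (f j.castSucc) (f j.succ)}
  add_mem' hf hg j := (hf j).add (hg j)
  zero_mem' _ := isWeakDeriv_zero
  smul_mem' c _ hf j := (hf j).smul c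

variable (E) in
/-- The Sobolev space `L²_k(ℝ, E)`. A function `f` is recorded together with its weak derivatives,
as the tuple `(f, f', …, f^(k))` of elements of `L²(ℝ, E)`; the (Hilbert) norm is therefore
`‖f‖ ^ 2 = ∑ j ≤ k, ‖f^(j)‖ ^ 2`. Weak derivatives are unique, so a tuple is determined by `f`. -/
def Sobolev (k : ℕ) : Type u := sobolevTuples E k

namespace Sobolev

instance (k : ℕ) : NormedAddCommGroup (Sobolev E k) :=
  inferInstanceAs (NormedAddCommGroup (sobolevTuples E k))

instance (k : ℕ) : InnerProductSpace ℝ (Sobolev E k) :=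
  inferInstanceAs (InnerProductSpace ℝ (sobolevTuples E k))

/-- The `j`-th weak derivative of an element of `L²_k(ℝ, E)`, for `j ≤ k`. -/
def deriv {k : ℕ} (f : Sobolev E k) (j : Fin (k + 1)) : Lp E 2 (volume : Measure ℝ) := f.1 j

theorem deriv_add {k : ℕ} (f g : Sobolev E k) (j : Fin (k + 1)) :
    (f + g).deriv j = f.deriv j + g.deriv j := rfl

theorem deriv_smul {k : ℕ} (c : ℝ) (f : Sobolev E k) (j : Fin (k + 1)) :
    (c • f).deriv j = c • f.deriv j := rfl

theorem deriv_zero {k : ℕ} (j : Fin (k + 1)) : (0 : Sobolev E k).deriv j = 0 := rfl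

end Sobolev

end Sobolev

section PathDomain

variable (T : ReferenceOperator.{u}) (k : ℕ)

/-- Pairs of an element of `L²_k(ℝ, W)` and an element of `L²_{k+1}(ℝ, H)` that are the same
function `ℝ → W ⊂ H`. -/
def pathPairs : Submodule ℝ (WithLp 2 (Sobolev T.W k × Sobolev T.H (k + 1))) where
  carrier := {ξ | T.incl.compLpL 2 volume (ξ.fst.deriv 0) = ξ.snd.deriv 0}
  add_mem' {ξ η} hξ hη := by
    rw [Set.mem_ofPred_eq] at *
    rw [WithLp.add_fst, WithLp.add_snd, Sobolev.deriv_add, Sobolev.deriv_add, map_add, hξ, hη]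
  zero_mem' := by
    rw [Set.mem_ofPred_eq, WithLp.zero_fst, WithLp.zero_snd, Sobolev.deriv_zero,
      Sobolev.deriv_zero, map_zero]
  smul_mem' c ξ hξ := by
    rw [Set.mem_ofPred_eq] at *
    rw [WithLp.smul_fst, WithLp.smul_snd, Sobolev.deriv_smul, Sobolev.deriv_smul, map_smul, hξ]

/-- The space `𝒲_k = L²_k(ℝ, W) ∩ L²_{k+1}(ℝ, H)`. The norm is
`‖ξ‖ ^ 2 = ∑ j ≤ k, ‖ξ^(j)‖_W ^ 2 + ∑ j ≤ k + 1, ‖ξ^(j)‖_H ^ 2`. -/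
def PathDomain : Type u := pathPairs T k

instance : NormedAddCommGroup (PathDomain T k) :=
  inferInstanceAs (NormedAddCommGroup (pathPairs T k))

instance : InnerProductSpace ℝ (PathDomain T k) :=
  inferInstanceAs (InnerProductSpace ℝ (pathPairs T k))

variable {T k}

/-- An element of `𝒲_k` as an element of `L²_k(ℝ, W)`. -/
def PathDomain.toW (ξ : PathDomain T k) : Sobolev T.W k := ξ.1.fst

/-- An element of `𝒲_k` as an element of `L²_{k+1}(ℝ, H)`. -/
def PathDomain.toH (ξ : PathDomain T k) : Sobolev T.H (k + 1) := ξ.1.snd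

/-- The bounded operator `D : 𝒲_k → L²_k(ℝ, H)` is `ξ ↦ dξ/dt + A(t) ξ`. -/
def IsPathOperator (A : ℝ → T.W →L[ℝ] T.H) (D : PathDomain T k →L[ℝ] Sobolev T.H k) : Prop :=
  ∀ ξ : PathDomain T k,
    ((D ξ).deriv 0 : ℝ → T.H) =ᵐ[volume] fun t => ξ.toH.deriv 1 t + A t (ξ.toW.deriv 0 t)

end PathDomain

/-- The Fredholm index `dim ker D - dim coker D`. -/
def fredholmIndex {X Y : Type u} [NormedAddCommGroup X] [NormedSpace ℝ X] [NormedAddCommGroup Y]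
    [NormedSpace ℝ Y] (D : X →L[ℝ] Y) : ℤ :=
  (Module.finrank ℝ D.ker : ℤ) - (Module.finrank ℝ (Y ⧸ D.range) : ℤ)

end SpectralFlow

end

open SpectralFlow

open scoped BoundedContinuousFunction

noncomputable section

namespace SpectralFlow

/-! ## The index of a linear map -/

section LinearIndex

variable {X Y Z : Type*} [AddCommGroup X] [Module ℝ X] [AddCommGroup Y] [Module ℝ Y]
  [AddCommGroup Z] [Module ℝ Z]

/-! The spectral flow is constructed as an index: `pathIndex` is the index of D_A = d/dt + A on the
lowest-order space `PathSpace`, whose elements are paths w in L²(ℝ, W) together with the L² weak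
derivative of ιw, where ι : W → H is the inclusion. Once this index is known to satisfy the axioms
and the axioms are known to determine the map, the index formula for k = 0 is a definition, and only
the passage to higher k remains.

Fredholm property. For a constant symmetric invertible C the cross term in ‖ξ' + Cξ‖² is the
integral of a total derivative, so ‖ξ' + Cξ‖² = ‖ξ'‖² + ‖Cξ‖², and d/dt + C is bijective
(`bijective_pathOp_const`). For a general path the inverses belonging to the two limits are glued
with a slowly varying partition of unity. The commutators with the partition are small. The
remaining errors are multiplications by functions with compact operator values that vanish at both
ends, and these are compact (`isCompactOperator_mulOp_comp_pathFst`). Compactness of W → H is never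
needed: compact operators are approximated by finite rank ones, which reduces the claim to Rellich's
theorem for scalar functions on the line.

Axioms. Homotopy is local constancy of the index, the constant axiom is bijectivity for constant
paths, and the direct sum axiom is additivity. For catenation, a rotation of H ⊕ H deforms A_l ⊕ A_r
into the sum of A and a constant path (`pathIndex_catenation`). Normalization is an explicit
computation: with G a primitive of arctan, exp(-G) spans the kernel, while exp(G) is not in L² and
so the cokernel vanishes.

Uniqueness. The difference δ of two spectral flows satisfies the same axioms with the value 0 in the
normalization. By convexity δ depends only on the limits of a path, so "joined by a path on which δ
vanishes" is an equivalence relation on invertible admissible operators. It is shown to have one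
class. Operators joined by a curve of invertible ones are related. On a line all nonzero multiples
of the inclusion are related, by normalization. A rank one perturbation can be rotated into an
auxiliary line without losing invertibility (`IsNullFlow.nullRel_add_rankOne`). Finite rank
symmetric perturbations follow one rank at a time. Finally every admissible operator becomes
invertible after such a perturbation, and the set of admissible operators is convex, hence
connected.

Higher k. Difference quotients of a solution converge because D_A, having finite index, is proper
relative to any injective operator; hence solutions are as regular as the right-hand side permits
(`weakDiff_of_pathOp`). Together with density of the smoother target this shows that kernel and
cokernel have the same dimensions for every k. -/

/-- A linear map has finite index if its kernel and its cokernel are finite-dimensional. -/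
structure HasFiniteIndex (f : X →ₗ[ℝ] Y) : Prop where
  ker : FiniteDimensional ℝ (LinearMap.ker f)
  coker : FiniteDimensional ℝ (Y ⧸ LinearMap.range f)

/-- The index `dim ker f - dim coker f` of a linear map. -/
def linearIndex (f : X →ₗ[ℝ] Y) : ℤ :=
  (Module.finrank ℝ (LinearMap.ker f) : ℤ) - (Module.finrank ℝ (Y ⧸ LinearMap.range f) : ℤ)

theorem hasFiniteIndex_of_bijective {f : X →ₗ[ℝ] Y} (hf : Function.Bijective f) :
    HasFiniteIndex f := by
  constructor
  · rw [LinearMap.ker_eq_bot.2 hf.1]; infer_instance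
  · rw [LinearMap.range_eq_top.2 hf.2]; infer_instance

theorem linearIndex_of_bijective {f : X →ₗ[ℝ] Y} (hf : Function.Bijective f) :
    linearIndex f = 0 := by
  have h : Module.finrank ℝ (Y ⧸ (⊤ : Submodule ℝ Y)) = 0 := Module.finrank_zero_of_subsingleton
  rw [linearIndex, LinearMap.ker_eq_bot.2 hf.1, LinearMap.range_eq_top.2 hf.2, finrank_bot, h]
  simp

/-- The reason is the exact sequence 0 → ker f → ker gf → ker g → coker f → coker gf → coker g → 0.
The maps `r`, `c` and `q` are its three middle arrows, and the alternating sum of the dimensions is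
zero. -/
theorem HasFiniteIndex.comp_and_linearIndex_comp {g : Y →ₗ[ℝ] Z} {f : X →ₗ[ℝ] Y}
    (hg : HasFiniteIndex g) (hf : HasFiniteIndex f) :
    HasFiniteIndex (g ∘ₗ f) ∧ linearIndex (g ∘ₗ f) = linearIndex g + linearIndex f := by
  have := hg.ker; have := hg.coker; have := hf.ker; have := hf.coker
  let r : LinearMap.ker (g ∘ₗ f) →ₗ[ℝ] LinearMap.ker g := f.restrict (fun x hx => hx)
  let c : LinearMap.ker g →ₗ[ℝ] Y ⧸ LinearMap.range f :=
    (LinearMap.range f).mkQ ∘ₗ (LinearMap.ker g).subtype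
  let q : (Y ⧸ LinearMap.range f) →ₗ[ℝ] (Z ⧸ LinearMap.range (g ∘ₗ f)) :=
    Submodule.mapQ _ _ g (by rintro _ ⟨x, rfl⟩; exact ⟨x, rfl⟩)
  let e₁ : LinearMap.ker r ≃ₗ[ℝ] LinearMap.ker f :=
    { toFun := fun x => ⟨x.1.1, congrArg Subtype.val x.2⟩
      invFun := fun x => ⟨⟨x.1, by simp [LinearMap.mem_ker.1 x.2]⟩, Subtype.ext x.2⟩
      left_inv := fun x => rfl
      right_inv := fun x => rfl
      map_add' := fun x y => rfl
      map_smul' := fun a x => rfl }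
  have h₂ : LinearMap.ker c = LinearMap.range r := by
    ext y
    rw [LinearMap.mem_ker]
    change (LinearMap.range f).mkQ y.1 = 0 ↔ _
    rw [Submodule.mkQ_apply, Submodule.Quotient.mk_eq_zero]
    constructor
    · rintro ⟨x, hx⟩
      refine ⟨⟨x, ?_⟩, Subtype.ext hx⟩
      rw [LinearMap.mem_ker, LinearMap.comp_apply, hx]; exact y.2
    · rintro ⟨x, hx⟩
      exact ⟨x.1, congrArg Subtype.val hx⟩
  have h₃ : LinearMap.ker q = LinearMap.range c := by
    ext y
    obtain ⟨y, rfl⟩ := Submodule.mkQ_surjective _ y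
    rw [LinearMap.mem_ker]
    change (LinearMap.range (g ∘ₗ f)).mkQ (g y) = 0 ↔ _
    rw [Submodule.mkQ_apply, Submodule.Quotient.mk_eq_zero]
    constructor
    · rintro ⟨x, hx⟩
      refine ⟨⟨y - f x, ?_⟩, ?_⟩
      · rw [LinearMap.mem_ker, map_sub, sub_eq_zero]; exact hx.symm
      · change (LinearMap.range f).mkQ (y - f x) = _
        rw [map_sub, sub_eq_self, Submodule.mkQ_apply, Submodule.Quotient.mk_eq_zero]
        exact ⟨x, rfl⟩
    · rintro ⟨⟨z, hz⟩, hx⟩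
      have hx : (LinearMap.range f).mkQ z = (LinearMap.range f).mkQ y := hx
      rw [← sub_eq_zero, ← map_sub, Submodule.mkQ_apply, Submodule.Quotient.mk_eq_zero] at hx
      obtain ⟨x, hx⟩ := hx
      refine ⟨-x, ?_⟩
      rw [LinearMap.comp_apply, map_neg, hx, map_neg, map_sub, LinearMap.mem_ker.1 hz]
      simp
  have hq : LinearMap.range q = (LinearMap.range g).map (LinearMap.range (g ∘ₗ f)).mkQ := by
    apply le_antisymm
    · rintro _ ⟨x, rfl⟩
      obtain ⟨y, rfl⟩ := Submodule.mkQ_surjective _ x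
      exact ⟨g y, ⟨y, rfl⟩, rfl⟩
    · rintro _ ⟨_, ⟨y, rfl⟩, rfl⟩
      exact ⟨Submodule.Quotient.mk y, rfl⟩
  let e₄ : ((Z ⧸ LinearMap.range (g ∘ₗ f)) ⧸ LinearMap.range q) ≃ₗ[ℝ] Z ⧸ LinearMap.range g :=
    (Submodule.quotEquivOfEq _ _ hq).trans
      (Submodule.quotientQuotientEquivQuotient _ _ (LinearMap.range_comp_le_range f g))
  have i₁ : FiniteDimensional ℝ (LinearMap.ker r) := Module.Finite.equiv e₁.symm
  have i₂ : FiniteDimensional ℝ (LinearMap.ker (g ∘ₗ f)) := by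
    have : Module.Finite ℝ (LinearMap.ker (g ∘ₗ f) ⧸ LinearMap.ker r) :=
      Module.Finite.equiv r.quotKerEquivRange.symm
    exact Module.Finite.of_submodule_quotient (LinearMap.ker r)
  have i₃ : FiniteDimensional ℝ (Z ⧸ LinearMap.range (g ∘ₗ f)) := by
    have := Module.Finite.equiv e₄.symm
    exact Module.Finite.of_submodule_quotient (LinearMap.range q)
  refine ⟨⟨i₂, i₃⟩, ?_⟩
  have n₁ := r.finrank_range_add_finrank_ker
  have n₂ := c.finrank_range_add_finrank_ker
  have n₃ := q.finrank_range_add_finrank_ker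
  have n₄ := Submodule.finrank_quotient_add_finrank (LinearMap.range q)
  rw [e₁.finrank_eq] at n₁
  rw [h₂] at n₂
  rw [h₃] at n₃
  rw [e₄.finrank_eq] at n₄
  unfold linearIndex
  omega

theorem HasFiniteIndex.linearIndex_comp {g : Y →ₗ[ℝ] Z} {f : X →ₗ[ℝ] Y} (hg : HasFiniteIndex g)
    (hf : HasFiniteIndex f) : linearIndex (g ∘ₗ f) = linearIndex g + linearIndex f :=
  (hg.comp_and_linearIndex_comp hf).2

variable {X' Y' : Type*} [AddCommGroup X'] [Module ℝ X'] [AddCommGroup Y'] [Module ℝ Y']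

/-- The index is invariant under composition with isomorphisms. -/
theorem linearIndex_conj {f : X →ₗ[ℝ] Y} {f' : X' →ₗ[ℝ] Y'} (hf : HasFiniteIndex f)
    (hf' : HasFiniteIndex f') (e : X →ₗ[ℝ] X') (e' : Y →ₗ[ℝ] Y')
    (he : Function.Bijective e) (he' : Function.Bijective e') (h : e' ∘ₗ f = f' ∘ₗ e) :
    linearIndex f = linearIndex f' := by
  have h1 := (hasFiniteIndex_of_bijective he').linearIndex_comp hf
  have h2 := hf'.linearIndex_comp (hasFiniteIndex_of_bijective he)
  rw [h, h2, linearIndex_of_bijective he, linearIndex_of_bijective he'] at h1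
  omega

/-- Adding an identity changes neither kernel nor cokernel. Additivity under direct sums then
follows from the composition formula, since f ⊕ f' is (f ⊕ id) ∘ (id ⊕ f'). -/
theorem HasFiniteIndex.prodMap_id {f : X →ₗ[ℝ] Y} (hf : HasFiniteIndex f) :
    HasFiniteIndex (f.prodMap (LinearMap.id : Z →ₗ[ℝ] Z)) ∧
      linearIndex (f.prodMap (LinearMap.id : Z →ₗ[ℝ] Z)) = linearIndex f := by
  have := hf.ker; have := hf.coker
  let e₁ : LinearMap.ker (f.prodMap (LinearMap.id : Z →ₗ[ℝ] Z)) ≃ₗ[ℝ] LinearMap.ker f :=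
    { toFun := fun x => ⟨x.1.1, (Prod.ext_iff.1 (LinearMap.mem_ker.1 x.2)).1⟩
      invFun := fun x => ⟨(x.1, 0), Prod.ext x.2 rfl⟩
      left_inv := fun x => Subtype.ext
        (Prod.ext rfl (Prod.ext_iff.1 (LinearMap.mem_ker.1 x.2)).2.symm)
      right_inv := fun x => rfl
      map_add' := fun x y => rfl
      map_smul' := fun a x => rfl }
  let q : (Y × Z) →ₗ[ℝ] Y ⧸ LinearMap.range f := (LinearMap.range f).mkQ ∘ₗ LinearMap.fst ℝ Y Z
  have hq : LinearMap.ker q = LinearMap.range (f.prodMap (LinearMap.id : Z →ₗ[ℝ] Z)) := by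
    ext ⟨y, z⟩
    rw [LinearMap.mem_ker]
    change (LinearMap.range f).mkQ y = 0 ↔ _
    rw [Submodule.mkQ_apply, Submodule.Quotient.mk_eq_zero]
    constructor
    · rintro ⟨x, rfl⟩; exact ⟨(x, z), rfl⟩
    · rintro ⟨x, hx⟩; exact ⟨x.1, (Prod.ext_iff.1 hx).1⟩
  let e₂ : ((Y × Z) ⧸ LinearMap.range (f.prodMap (LinearMap.id : Z →ₗ[ℝ] Z))) ≃ₗ[ℝ]
      Y ⧸ LinearMap.range f := (Submodule.quotEquivOfEq _ _ hq.symm).trans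
    (q.quotKerEquivOfSurjective ((Submodule.mkQ_surjective _).comp LinearMap.fst_surjective))
  refine ⟨⟨Module.Finite.equiv e₁.symm, Module.Finite.equiv e₂.symm⟩, ?_⟩
  rw [linearIndex, linearIndex, e₁.finrank_eq, e₂.finrank_eq]

/-- The index is additive under direct sums. -/
theorem linearIndex_prodMap {f : X →ₗ[ℝ] Y} {f' : X' →ₗ[ℝ] Y'} (hf : HasFiniteIndex f)
    (hf' : HasFiniteIndex f') : HasFiniteIndex (f.prodMap f') ∧
      linearIndex (f.prodMap f') = linearIndex f + linearIndex f' := by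
  have h1 := hf.prodMap_id (Z := Y')
  have h2 := hf'.prodMap_id (Z := X)
  have b1 : Function.Bijective (LinearEquiv.prodComm ℝ X X').toLinearMap :=
    (LinearEquiv.prodComm ℝ X X').bijective
  have b2 : Function.Bijective (LinearEquiv.prodComm ℝ Y' X).toLinearMap :=
    (LinearEquiv.prodComm ℝ Y' X).bijective
  have e : f.prodMap f' = (f.prodMap (LinearMap.id : Y' →ₗ[ℝ] Y')) ∘ₗ
      (LinearEquiv.prodComm ℝ Y' X).toLinearMap ∘ₗ
      (f'.prodMap (LinearMap.id : X →ₗ[ℝ] X)) ∘ₗ (LinearEquiv.prodComm ℝ X X').toLinearMap := by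
    ext <;> simp
  have c1 := h2.1.comp_and_linearIndex_comp (hasFiniteIndex_of_bijective b1)
  have c2 := (hasFiniteIndex_of_bijective b2).comp_and_linearIndex_comp c1.1
  have c3 := h1.1.comp_and_linearIndex_comp c2.1
  rw [e]
  refine ⟨c3.1, ?_⟩
  rw [c3.2, c2.2, c1.2, h1.2, h2.2, linearIndex_of_bijective b1, linearIndex_of_bijective b2]
  omega

/-- If `f'` is the restriction of `f` to subspaces, every preimage under `f` of an element of the
smaller target lies in the smaller source, and the smaller target is a supplement of the range
of `f`, then the indices agree. -/
theorem linearIndex_of_regularity {f : X →ₗ[ℝ] Y} {f' : X' →ₗ[ℝ] Y'} (hf : HasFiniteIndex f)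
    (i : X' →ₗ[ℝ] X) (j : Y' →ₗ[ℝ] Y) (hi : Function.Injective i) (hj : Function.Injective j)
    (h : ∀ x, f (i x) = j (f' x)) (hreg : ∀ x y, f x = j y → x ∈ LinearMap.range i)
    (hsup : LinearMap.range f ⊔ LinearMap.range j = ⊤) :
    HasFiniteIndex f' ∧ linearIndex f' = linearIndex f := by
  have := hf.ker; have := hf.coker
  let k : LinearMap.ker f' →ₗ[ℝ] LinearMap.ker f := i.restrict (fun x hx => by
    rw [LinearMap.mem_ker, h, LinearMap.mem_ker.1 hx, map_zero])
  have hk : Function.Bijective k := by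
    constructor
    · intro a b hab
      exact Subtype.ext (hi (congrArg Subtype.val hab))
    · rintro ⟨x, hx⟩
      obtain ⟨z, rfl⟩ := hreg x 0 (by rw [map_zero]; exact hx)
      refine ⟨⟨z, hj ?_⟩, rfl⟩
      rw [← h, map_zero]; exact hx
  let q : Y' →ₗ[ℝ] Y ⧸ LinearMap.range f := (LinearMap.range f).mkQ ∘ₗ j
  -- The smaller target maps to the cokernel of f. Regularity of preimages says that the kernel of
  -- this map is no larger than the range of f'; the supplement hypothesis makes it surjective.
  have hq : LinearMap.ker q = LinearMap.range f' := by
    ext y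
    rw [LinearMap.mem_ker]
    change (LinearMap.range f).mkQ (j y) = 0 ↔ _
    rw [Submodule.mkQ_apply, Submodule.Quotient.mk_eq_zero]
    constructor
    · rintro ⟨x, hx⟩
      obtain ⟨z, rfl⟩ := hreg x y hx
      exact ⟨z, hj (by rw [← h, hx])⟩
    · rintro ⟨x, rfl⟩; exact ⟨i x, h x⟩
  have hs : Function.Surjective q := by
    intro y
    obtain ⟨y, rfl⟩ := Submodule.mkQ_surjective _ y
    obtain ⟨a, ⟨x, rfl⟩, b, ⟨z, rfl⟩, hab⟩ := Submodule.mem_sup.1 (hsup ▸ Submodule.mem_top (x := y))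
    refine ⟨z, ?_⟩
    change (LinearMap.range f).mkQ (j z) = _
    rw [← hab, map_add, right_eq_add, Submodule.mkQ_apply, Submodule.Quotient.mk_eq_zero]
    exact ⟨x, rfl⟩
  let e₁ := LinearEquiv.ofBijective k hk
  let e₂ : (Y' ⧸ LinearMap.range f') ≃ₗ[ℝ] Y ⧸ LinearMap.range f :=
    (Submodule.quotEquivOfEq _ _ hq.symm).trans (q.quotKerEquivOfSurjective hs)
  refine ⟨⟨Module.Finite.equiv e₁.symm, Module.Finite.equiv e₂.symm⟩, ?_⟩
  rw [linearIndex, linearIndex, e₁.finrank_eq, e₂.finrank_eq]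

end LinearIndex

/-! ## Operators of finite index between Banach spaces -/

section Banach

variable {X Y Z : Type*} [NormedAddCommGroup X] [NormedSpace ℝ X] [NormedAddCommGroup Y]
  [NormedSpace ℝ Y] [NormedAddCommGroup Z] [NormedSpace ℝ Z]

/-- Restricted to a closed complement of its finite-dimensional kernel, D is injective with the same
range. This range has an algebraic complement of finite dimension, hence a closed one, and the open
mapping theorem applies. -/
theorem HasFiniteIndex.isClosed_range [CompleteSpace X] [CompleteSpace Y] {D : X →L[ℝ] Y}
    (hD : HasFiniteIndex (D : X →ₗ[ℝ] Y)) : IsClosed (D.range : Set Y) := by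
  have := hD.ker
  have := hD.coker
  obtain ⟨E, hE⟩ := (Submodule.ClosedComplemented.of_finiteDimensional
    (LinearMap.ker (D : X →ₗ[ℝ] Y))).exists_isTopCompl
  have hEc : IsClosed (E : Set X) := hE.symm.isClosed
  have := hEc.completeSpace_coe
  obtain ⟨G, hG⟩ := (LinearMap.range (D : X →ₗ[ℝ] Y)).exists_isCompl
  have hGf : FiniteDimensional ℝ G := .of_fg (Submodule.CoFG.fg_of_isCompl hG hD.coker)
  let f : E →L[ℝ] Y := D.comp E.subtypeL
  have hr : f.range = D.range := by
    apply le_antisymm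
    · rintro _ ⟨x, rfl⟩; exact ⟨x, rfl⟩
    · rintro _ ⟨x, rfl⟩
      obtain ⟨a, ha, b, hb, rfl⟩ := Submodule.mem_sup.1
        (hE.isCompl.sup_eq_top ▸ Submodule.mem_top (x := x))
      refine ⟨⟨b, hb⟩, ?_⟩
      have ha' : D a = 0 := ha
      change D b = D (a + b)
      rw [map_add, ha', zero_add]
  have hk : f.ker = ⊥ := by
    rw [LinearMap.ker_eq_bot']
    rintro ⟨x, hx⟩ h
    have h0 : x ∈ (⊥ : Submodule ℝ X) := hE.isCompl.inf_eq_bot ▸ ⟨h, hx⟩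
    exact Subtype.ext h0
  rw [← hr]
  exact f.closed_complemented_range_of_isCompl_of_ker_eq_bot G (hr ▸ hG)
    G.closed_of_finiteDimensional hk

/-- Between Banach spaces, an operator of finite index is Fredholm. -/
theorem HasFiniteIndex.isFredholm [CompleteSpace X] [CompleteSpace Y] {D : X →L[ℝ] Y}
    (hD : HasFiniteIndex (D : X →ₗ[ℝ] Y)) : D.IsFredholm := by
  have hc := hD.isClosed_range
  have := hD.ker
  refine ⟨?_, hc, hD.ker, hD.coker, .of_finiteDimensional _⟩
  have := hc.completeSpace_coe
  rw [Topology.isStrictMap_iff_isQuotientMap_rangeFactorization]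
  exact D.rangeRestrict.isQuotientMap (LinearMap.surjective_rangeRestrict _)

/-- The index is locally constant in the norm topology. -/
theorem HasFiniteIndex.eventually_nhds [CompleteSpace X] [CompleteSpace Y] {D : X →L[ℝ] Y}
    (hD : HasFiniteIndex (D : X →ₗ[ℝ] Y)) :
    ∀ᶠ S : X →L[ℝ] Y in 𝓝 D, HasFiniteIndex (S : X →ₗ[ℝ] Y) ∧
      linearIndex (S : X →ₗ[ℝ] Y) = linearIndex (D : X →ₗ[ℝ] Y) := by
  obtain ⟨pkg⟩ := hD.isFredholm.nonempty_fredholmPackage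
  have hX₀ := pkg.decDom.finite_X₀
  have hY₀ := pkg.decCodom.finite_X₀
  have hXc := pkg.decDom.isTopCompl
  have hYc := pkg.decCodom.isTopCompl
  have : CompleteSpace pkg.decDom.X₁ := hXc.isClosed.completeSpace_coe
  set p : Y →L[ℝ] pkg.decCodom.X₁ := pkg.decCodom.proj with hp
  set i : pkg.decDom.X₁ →L[ℝ] X := pkg.decDom.X₁.subtypeL with hi
  -- The compression p S i to the complements of the kernel and of the cokernel of D is an
  -- isomorphism for S = D, hence for all S near D.
  have hpD : p.comp (D.comp i) = pkg.equiv := by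
    ext x
    have := congrArg (fun u : X →L[ℝ] Y => u x) pkg.eq_equiv
    simp only [ContinuousLinearMap.comp_apply] at this
    change ((p (D x) : pkg.decCodom.X₁) : Y) = pkg.equiv x
    rw [this]
    simp [p, FredholmDecomposition.proj]
  have hcont : Continuous fun S : X →L[ℝ] Y => p.comp (S.comp i) := by fun_prop
  have hev := hcont.continuousAt.preimage_mem_nhds (x := D)
    (by rw [hpD]; exact pkg.equiv.nhds)
  have hi_inj : Function.Injective i := Subtype.val_injective
  have hir : LinearMap.range (i : pkg.decDom.X₁ →ₗ[ℝ] X) = pkg.decDom.X₁ :=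
    Submodule.range_subtype _
  have hif : HasFiniteIndex (i : pkg.decDom.X₁ →ₗ[ℝ] X) := by
    constructor
    · rw [LinearMap.ker_eq_bot.2 hi_inj]; infer_instance
    · rw [hir]
      exact Submodule.FG.cofg_of_isCompl hXc.isCompl.symm (Module.Finite.iff_fg.1 hX₀)
  have hp_surj : Function.Surjective p := fun y => ⟨y, by simp [p, FredholmDecomposition.proj]⟩
  have hpk : LinearMap.ker (p : Y →ₗ[ℝ] pkg.decCodom.X₁) = pkg.decCodom.X₀ := by
    simp [p, FredholmDecomposition.proj]
  have hpf : HasFiniteIndex (p : Y →ₗ[ℝ] pkg.decCodom.X₁) := by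
    constructor
    · rw [hpk]; exact hY₀
    · rw [LinearMap.range_eq_top.2 hp_surj]; infer_instance
  -- Whenever the compression is bijective, 0 = ind p + ind S + ind i, and the two outer terms do
  -- not depend on S.
  have key : ∀ S : X →L[ℝ] Y, HasFiniteIndex (S : X →ₗ[ℝ] Y) →
      Function.Bijective (p.comp (S.comp i)) → linearIndex (S : X →ₗ[ℝ] Y) =
      - linearIndex (p : Y →ₗ[ℝ] pkg.decCodom.X₁) -
        linearIndex (i : pkg.decDom.X₁ →ₗ[ℝ] X) := by
    intro S hS hb
    have h1 := hS.comp_and_linearIndex_comp hif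
    have h2 := hpf.linearIndex_comp h1.1
    have h3 := linearIndex_of_bijective (f := (p : Y →ₗ[ℝ] pkg.decCodom.X₁) ∘ₗ
      ((S : X →ₗ[ℝ] Y) ∘ₗ (i : pkg.decDom.X₁ →ₗ[ℝ] X))) hb
    rw [h3, h1.2] at h2
    omega
  filter_upwards [hev] with S hS
  obtain ⟨e, he⟩ := hS
  have hb : Function.Bijective (p.comp (S.comp i)) := by
    simp only at he
    rw [← he]; exact e.bijective
  have hSf : HasFiniteIndex (S : X →ₗ[ℝ] Y) := by
    constructor
    · refine Module.Finite.iff_fg.2 (Submodule.CoFG.fg_of_disjoint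
        (T := pkg.decDom.X₁) ?_ (hir ▸ hif.coker))
      rw [Submodule.disjoint_def]
      intro x hx hx'
      have : (⟨x, hx'⟩ : pkg.decDom.X₁) = 0 := hb.1 (by
        rw [map_zero]
        change p (S x) = 0
        rw [show S x = 0 from hx, map_zero])
      exact congrArg Subtype.val this
    · refine Submodule.FG.cofg_of_codisjoint (S := pkg.decCodom.X₀) ?_
        (Module.Finite.iff_fg.1 hY₀)
      rw [codisjoint_iff, eq_top_iff]
      intro y _
      obtain ⟨x, hx⟩ := hb.2 (p y)
      rw [← sub_add_cancel y (S x)]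
      refine Submodule.add_mem_sup ?_ ⟨x, rfl⟩
      rw [← hpk, LinearMap.mem_ker]
      change p (y - S x) = 0
      rw [map_sub, sub_eq_zero]
      exact hx.symm
  refine ⟨hSf, ?_⟩
  rw [key S hSf hb, key D hD (by rw [hpD]; exact pkg.equiv.bijective)]

/-- Lifting an operator through an injective operator (by the closed graph theorem). -/
theorem exists_lift_of_injective [CompleteSpace X] [CompleteSpace Y] (T : X →L[ℝ] Z)
    (j : Y →L[ℝ] Z) (hj : Function.Injective j) (h : ∀ x, ∃ y, j y = T x) :
    ∃ S : X →L[ℝ] Y, ∀ x, j (S x) = T x := by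
  choose g hg using h
  let S : X →ₗ[ℝ] Y :=
    { toFun := g
      map_add' := fun x y => hj (by rw [map_add, hg, hg, hg, map_add])
      map_smul' := fun c x => hj (by rw [map_smul, hg, hg, map_smul, RingHom.id_apply]) }
  refine ⟨ContinuousLinearMap.ofSeqClosedGraph (g := S) fun u x y hu hy => ?_, fun x => hg x⟩
  apply hj
  have h1 : Tendsto (fun n => j (g (u n))) atTop (𝓝 (j y)) := (j.continuous.tendsto y).comp hy
  simp_rw [hg] at h1
  exact (tendsto_nhds_unique h1 ((T.continuous.tendsto x).comp hu)).trans (hg x).symm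

/-- A subspace that contains a closed subspace of finite codimension is closed. The sum of the two
ranges is therefore both closed and dense. -/
theorem HasFiniteIndex.sup_range_eq_top [CompleteSpace X] [CompleteSpace Y] {D : X →L[ℝ] Y}
    (hD : HasFiniteIndex (D : X →ₗ[ℝ] Y)) {j : Z →ₗ[ℝ] Y} (hj : DenseRange j) :
    LinearMap.range (D : X →ₗ[ℝ] Y) ⊔ LinearMap.range j = ⊤ := by
  have := hD.coker
  have hc : IsClosed ((LinearMap.range (D : X →ₗ[ℝ] Y) ⊔ LinearMap.range j : Submodule ℝ Y) :
      Set Y) := Submodule.isClosed_mono_of_finiteDimensional_quotient hD.isClosed_range le_sup_left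
  rw [eq_top_iff]
  intro y _
  have : closure (Set.range j) ⊆
      ((LinearMap.range (D : X →ₗ[ℝ] Y) ⊔ LinearMap.range j : Submodule ℝ Y) : Set Y) :=
    closure_minimal (by rintro _ ⟨x, rfl⟩; exact Submodule.mem_sup_right ⟨x, rfl⟩) hc
  exact this (hj y)

/-- A compact operator into a Hilbert space is approximated by its projections to
finite-dimensional subspaces. -/
theorem exists_finiteDimensional_norm_sub_le {H : Type*} [NormedAddCommGroup H]
    [InnerProductSpace ℝ H] {K : X →L[ℝ] H} (hK : IsCompactOperator K) {ε : ℝ} (hε : 0 < ε) :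
    ∃ V : Submodule ℝ H, ∃ _ : FiniteDimensional ℝ V,
      ‖K - V.starProjection.comp K‖ ≤ ε := by
  have hc := hK.isCompact_closure_image_closedBall 1
  obtain ⟨t, -, htf, ht⟩ := hc.finite_cover_balls hε
  have hfd : FiniteDimensional ℝ (Submodule.span ℝ t) := FiniteDimensional.span_of_finite ℝ htf
  refine ⟨Submodule.span ℝ t, hfd, ?_⟩
  refine ContinuousLinearMap.opNorm_le_of_unit_norm hε.le fun x hx => ?_
  have hx' : K x ∈ closure (K '' Metric.closedBall 0 1) :=
    subset_closure ⟨x, by simp [hx], rfl⟩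
  obtain ⟨y, hy⟩ := Set.mem_iUnion.1 (ht hx')
  obtain ⟨hy, hxy⟩ := Set.mem_iUnion.1 hy
  rw [Metric.mem_ball, dist_eq_norm] at hxy
  -- The projection is the nearest point of V, and V contains a finite ε-net of the image of the
  -- unit ball.
  rw [sub_apply, ContinuousLinearMap.comp_apply, Submodule.starProjection_minimal]
  refine (ciInf_le ⟨0, ?_⟩ (⟨y, Submodule.subset_span hy⟩ : Submodule.span ℝ t)).trans hxy.le
  rintro _ ⟨_, rfl⟩
  exact norm_nonneg _

/-- On ker D the identity 0 = x + Kx + Ex holds, so x = -(1 + E)⁻¹Kx. The identity of the kernel is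
then compact, and Riesz's theorem applies. -/
theorem finiteDimensional_ker_of_parametrix [CompleteSpace X] {D : X →L[ℝ] Y} {P : Y →L[ℝ] X}
    {K E : X →L[ℝ] X} (h : P.comp D = ContinuousLinearMap.id ℝ X + K + E)
    (hK : IsCompactOperator K) (hE : ‖E‖ < 1) :
    FiniteDimensional ℝ (LinearMap.ker (D : X →ₗ[ℝ] Y)) := by
  have hu : IsUnit (1 + E) := by
    have := isUnit_one_sub_of_norm_lt_one (x := -E) (by rwa [norm_neg])
    rwa [sub_neg_eq_add] at this
  obtain ⟨u, hu⟩ := hu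
  have hker : IsClosed ((LinearMap.ker (D : X →ₗ[ℝ] Y)) : Set X) := D.isClosed_ker
  set N : X →L[ℝ] X := -((↑u⁻¹ : X →L[ℝ] X).comp K)
  have hN : IsCompactOperator N := (hK.clm_comp _).neg
  have hx : ∀ x ∈ LinearMap.ker (D : X →ₗ[ℝ] Y), N x = x := by
    intro x hx
    have h1 := congrArg (fun S : X →L[ℝ] X => S x) h
    have hx : D x = 0 := hx
    simp only [ContinuousLinearMap.comp_apply, hx, map_zero, add_apply,
      ContinuousLinearMap.id_apply] at h1
    have h2 : (u : X →L[ℝ] X) x = - K x := by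
      rw [hu]
      change x + E x = _
      rw [add_right_comm] at h1
      exact eq_neg_of_add_eq_zero_left h1.symm
    have h3 : ((↑u⁻¹ : X →L[ℝ] X) * (u : X →L[ℝ] X)) x = x := by rw [u.inv_mul]; rfl
    change -((↑u⁻¹ : X →L[ℝ] X) (K x)) = x
    rw [← map_neg, ← h2]
    exact h3
  have hr := hN.restrict' (V := LinearMap.ker (D : X →ₗ[ℝ] Y))
    (f := (N : X →ₗ[ℝ] X)) (fun x hx' => by
      change N x ∈ _
      rw [hx x hx']; exact hx')
  refine FiniteDimensional.of_isCompactOperator_id (𝕜 := ℝ) ?_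
  have he : ((N : X →ₗ[ℝ] X).restrict (fun x hx' => by
      change N x ∈ _
      rw [hx x hx']; exact hx') : LinearMap.ker (D : X →ₗ[ℝ] Y) → LinearMap.ker (D : X →ₗ[ℝ] Y)) =
      id := funext fun x => Subtype.ext (hx x.1 x.2)
  rwa [← he]

/-- Write K = F + (K - F), with F of finite rank and the rest so small that 1 + E + (K - F) is still
invertible. Since this operator equals DP - F, every vector lies in the sum of the range of D and
the finite-dimensional V. -/
theorem finiteDimensional_coker_of_parametrix {H : Type*} [NormedAddCommGroup H]
    [InnerProductSpace ℝ H] [CompleteSpace H] {D : X →L[ℝ] H} {P : H →L[ℝ] X}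
    {K E : H →L[ℝ] H} (h : D.comp P = ContinuousLinearMap.id ℝ H + K + E)
    (hK : IsCompactOperator K) (hE : ‖E‖ < 1) :
    FiniteDimensional ℝ (H ⧸ LinearMap.range (D : X →ₗ[ℝ] H)) := by
  obtain ⟨V, hV, hVK⟩ := exists_finiteDimensional_norm_sub_le hK (ε := (1 - ‖E‖) / 2)
    (by linarith)
  set F := V.starProjection.comp K
  have hu : IsUnit (1 + (E + (K - F))) := by
    have := isUnit_one_sub_of_norm_lt_one (x := -(E + (K - F)))
      (by rw [norm_neg]; exact (norm_add_le _ _).trans_lt (by linarith))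
    rwa [sub_neg_eq_add] at this
  have hs : Function.Surjective ((1 + (E + (K - F)) : H →L[ℝ] H)) :=
    (ContinuousLinearMap.isUnit_iff_bijective.1 hu).2
  refine Submodule.FG.cofg_of_codisjoint (S := V) ?_ (Module.Finite.iff_fg.1 hV)
  rw [codisjoint_iff, eq_top_iff]
  intro y _
  obtain ⟨x, rfl⟩ := hs y
  have h1 := congrArg (fun S : H →L[ℝ] H => S x) h
  simp only [ContinuousLinearMap.comp_apply, add_apply, ContinuousLinearMap.id_apply] at h1
  have h2 : (1 + (E + (K - F)) : H →L[ℝ] H) x = - F x + D (P x) := by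
    rw [h1]
    change x + (E x + (K x - F x)) = _
    abel
  rw [h2]
  exact Submodule.add_mem_sup (V.neg_mem (Submodule.starProjection_apply_mem _ _)) ⟨P x, rfl⟩

end Banach

/-! ## Translations and weak derivatives -/

section Translation

variable {E : Type*} [NormedAddCommGroup E] [InnerProductSpace ℝ E]
  {F : Type*} [NormedAddCommGroup F] [InnerProductSpace ℝ F]

theorem locallyIntegrable_Lp {G : Type*} [NormedAddCommGroup G] (f : Lp G 2 (volume : Measure ℝ)) :
    LocallyIntegrable f volume := (Lp.memLp f).locallyIntegrable (by norm_num)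

/-- Translation of functions on the line: `(translate h f) t = f (t + h)`. -/
def translate (h : ℝ) : Lp E 2 (volume : Measure ℝ) →ₗᵢ[ℝ] Lp E 2 (volume : Measure ℝ) :=
  Lp.compMeasurePreservingₗᵢ ℝ (fun t => t + h) (measurePreserving_add_right volume h)

theorem coeFn_translate (h : ℝ) (f : Lp E 2 (volume : Measure ℝ)) :
    translate h f =ᵐ[volume] fun t => f (t + h) :=
  Lp.coeFn_compMeasurePreserving f (measurePreserving_add_right volume h)

theorem ae_comp_add {p : ℝ → Prop} (h : ∀ᵐ t, p t) (a : ℝ) : ∀ᵐ t, p (t + a) :=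
  (measurePreserving_add_right volume a).quasiMeasurePreserving.ae h

theorem translate_zero (f : Lp E 2 (volume : Measure ℝ)) : translate 0 f = f := by
  refine Lp.ext ((coeFn_translate 0 f).trans (Eventually.of_forall fun t => ?_))
  simp

theorem translate_add (a b : ℝ) (f : Lp E 2 (volume : Measure ℝ)) :
    translate (a + b) f = translate a (translate b f) := by
  refine Lp.ext ?_
  filter_upwards [coeFn_translate (a + b) f, coeFn_translate a (translate b f),
    ae_comp_add (coeFn_translate b f) a] with t h1 h2 h3
  rw [h1, h2, h3, add_assoc]

theorem continuous_translate (f : Lp E 2 (volume : Measure ℝ)) :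
    Continuous fun h => translate h f := by
  have hg : Continuous fun h : ℝ => (⟨fun t => t + h, by fun_prop⟩ : C(ℝ, ℝ)) :=
    ContinuousMap.continuous_of_continuous_uncurry _ (by
      change Continuous fun p : ℝ × ℝ => p.2 + p.1
      fun_prop)
  exact Continuous.compMeasurePreservingLp continuous_const hg
    (fun h => measurePreserving_add_right volume h) (by simp)

theorem translate_compLpL (L : E →L[ℝ] F) (h : ℝ) (f : Lp E 2 (volume : Measure ℝ)) :
    translate h (L.compLpL 2 volume f) = L.compLpL 2 volume (translate h f) := by
  refine Lp.ext ?_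
  filter_upwards [coeFn_translate h (L.compLpL 2 volume f), coeFn_translate h f,
    ae_comp_add (L.coeFn_compLpL (p := 2) f) h, L.coeFn_compLpL (p := 2) (translate h f)]
    with t h1 h2 h3 h4
  rw [h1, h4, h3, h2]

theorem inner_translate (h : ℝ) (f g : Lp E 2 (volume : Measure ℝ)) :
    ⟪translate h f, g⟫_ℝ = ⟪f, translate (-h) g⟫_ℝ := by
  rw [← (translate h).inner_map_map f, ← translate_add, add_neg_cancel, translate_zero]

/-- A test function as an element of `L²`. -/
def testLp {φ : ℝ → ℝ} (hφ : Continuous φ) (hc : HasCompactSupport φ) :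
    Lp ℝ 2 (volume : Measure ℝ) :=
  (hφ.memLp_of_hasCompactSupport hc).toLp φ

theorem coeFn_testLp {φ : ℝ → ℝ} (hφ : Continuous φ) (hc : HasCompactSupport φ) :
    testLp hφ hc =ᵐ[volume] φ := MemLp.coeFn_toLp _

variable [CompleteSpace E] [CompleteSpace F]

/-- Pairing with a test function, `f ↦ ∫ φ f`. -/
def testPairing {φ : ℝ → ℝ} (hφ : Continuous φ) (hc : HasCompactSupport φ) :
    Lp E 2 (volume : Measure ℝ) →L[ℝ] E :=
  (ContinuousLinearMap.lsmul ℝ ℝ).lpPairing volume 2 2 (testLp hφ hc)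

theorem testPairing_apply {φ : ℝ → ℝ} (hφ : Continuous φ) (hc : HasCompactSupport φ)
    (f : Lp E 2 (volume : Measure ℝ)) : testPairing hφ hc f = ∫ t, φ t • f t := by
  rw [testPairing, ContinuousLinearMap.lpPairing_eq_integral]
  exact integral_congr_ae ((coeFn_testLp hφ hc).mono fun t ht => by simp [ht])

/-- As a function of h, the pairing is the convolution of f with the reflected test function, so it
can be differentiated by moving the derivative to φ. -/
theorem hasDerivAt_testPairing_translate {φ : ℝ → ℝ} (hφ : ContDiff ℝ ∞ φ)
    (hc : HasCompactSupport φ) (f : Lp E 2 (volume : Measure ℝ)) (h : ℝ) :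
    HasDerivAt (fun h => testPairing hφ.continuous hc (translate h f))
      (-testPairing (hφ.continuous_deriv (by simp)) hc.deriv (translate h f)) h := by
  have conv : ∀ (ψ : ℝ → ℝ) (hψ : Continuous ψ) (hψc : HasCompactSupport ψ) (h : ℝ),
      testPairing hψ hψc (translate h f) =
        (convolution (fun s => ψ (-s)) f (ContinuousLinearMap.lsmul ℝ ℝ) volume) h := by
    intro ψ hψ hψc h
    rw [testPairing_apply, convolution_def, ← integral_neg_eq_self]
    refine integral_congr_ae ?_
    have := (Measure.measurePreserving_neg (volume : Measure ℝ)).quasiMeasurePreserving.ae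
      (coeFn_translate h f)
    filter_upwards [this] with t ht
    rw [ht, ContinuousLinearMap.lsmul_apply]
    congr 2; ring
  have h1 : (fun h => testPairing hφ.continuous hc (translate h f)) =
      convolution (fun s => φ (-s)) f (ContinuousLinearMap.lsmul ℝ ℝ) volume :=
    funext fun h => conv φ _ _ h
  rw [h1]
  have hd : deriv (fun s => φ (-s)) = fun s => - deriv φ (-s) := by
    ext s; rw [deriv_comp_neg]
  have h2 : HasDerivAt (convolution (fun s => φ (-s)) f (ContinuousLinearMap.lsmul ℝ ℝ) volume)
      (convolution (deriv fun s => φ (-s)) f (ContinuousLinearMap.lsmul ℝ ℝ) volume h) h :=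
    HasCompactSupport.hasDerivAt_convolution_left (μ := (volume : Measure ℝ))
    (ContinuousLinearMap.lsmul ℝ ℝ) (hc.comp_homeomorph (Homeomorph.neg ℝ))
    ((hφ.of_le (by simp)).comp contDiff_neg) (locallyIntegrable_Lp f) h
  convert h2 using 1
  rw [conv (deriv φ) (hφ.continuous_deriv (by simp)) hc.deriv h]
  rw [hd, convolution_def, convolution_def, ← integral_neg]
  refine integral_congr_ae (Eventually.of_forall fun t => ?_)
  simp

theorem isWeakDeriv_iff {f g : Lp E 2 (volume : Measure ℝ)} : IsWeakDeriv f g ↔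
    ∀ (φ : ℝ → ℝ) (hφ : ContDiff ℝ ∞ φ) (hc : HasCompactSupport φ),
      testPairing (hφ.continuous_deriv (by simp)) hc.deriv f =
        - testPairing hφ.continuous hc g := by
  simp only [testPairing_apply]; rfl

theorem eq_zero_of_testPairing {f : Lp E 2 (volume : Measure ℝ)}
    (h : ∀ (φ : ℝ → ℝ) (hφ : ContDiff ℝ ∞ φ) (hc : HasCompactSupport φ),
      testPairing hφ.continuous hc f = 0) : f = 0 := by
  rw [Lp.eq_zero_iff_ae_eq_zero]
  refine ae_eq_zero_of_integral_contDiff_smul_eq_zero (locallyIntegrable_Lp f) fun φ hφ hc => ?_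
  rw [← testPairing_apply hφ.continuous hc, h φ hφ hc]

/-- Weak derivatives are derivatives of the translation group. -/
theorem isWeakDeriv_iff_hasDerivAt {f g : Lp E 2 (volume : Measure ℝ)} :
    IsWeakDeriv f g ↔ HasDerivAt (fun h => translate h f) g 0 := by
  constructor
  · intro hfg
    -- The fundamental theorem of calculus for the L²-valued curve of translates. It is checked
    -- after pairing with test functions, where both sides are scalar-differentiable curves with
    -- known derivative.
    have key : ∀ h, translate h f = f + ∫ s in (0 : ℝ)..h, translate s g := by
      intro h
      rw [← sub_eq_zero]
      refine eq_zero_of_testPairing fun φ hφ hc => ?_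
      rw [map_sub, map_add, sub_eq_zero,
        ← ContinuousLinearMap.intervalIntegral_comp_comm _
          ((continuous_translate g).intervalIntegrable _ _),
        intervalIntegral.integral_eq_sub_of_hasDerivAt
          (f := fun h => testPairing hφ.continuous hc (translate h f)), translate_zero]
      · abel
      · intro s _
        have h1 := hasDerivAt_testPairing_translate hφ hc f s
        convert h1 using 1
        have e : ∀ (ψ : ℝ → ℝ) (hψ : Continuous ψ) (hψc : HasCompactSupport ψ)
            (k : Lp E 2 (volume : Measure ℝ)), testPairing hψ hψc (translate s k) =
            ∫ t, ψ (t - s) • k t := by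
          intro ψ hψ hψc k
          rw [testPairing_apply, ← integral_add_right_eq_self (fun t => ψ (t - s) • k t) s]
          refine integral_congr_ae ((coeFn_translate s k).mono fun t ht => ?_)
          simp [ht]
        rw [e, e]
        have := hfg (fun t => φ (t - s)) (hφ.comp (contDiff_id.sub contDiff_const))
          (hc.comp_homeomorph (Homeomorph.subRight s))
        rw [← neg_eq_iff_eq_neg] at this
        rw [← this]
        congr 1
        refine integral_congr_ae (Eventually.of_forall fun t => ?_)
        simp only [deriv_comp_sub_const]
      · exact ((testPairing hφ.continuous hc).continuous.comp
          (continuous_translate g)).intervalIntegrable _ _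
    have h0 : HasDerivAt (fun h => f + ∫ s in (0 : ℝ)..h, translate s g) (translate 0 g) 0 :=
      (intervalIntegral.integral_hasDerivAt_right
        ((continuous_translate g).intervalIntegrable _ _)
        ((continuous_translate g).stronglyMeasurableAtFilter _ _)
        (continuous_translate g).continuousAt).const_add f
    rw [translate_zero] at h0
    exact (funext key : (fun h => translate h f) = _) ▸ h0
  · intro hd
    rw [isWeakDeriv_iff]
    intro φ hφ hc
    have h1 := hasDerivAt_testPairing_translate hφ hc f 0
    have h2 := (testPairing hφ.continuous hc).hasFDerivAt.comp_hasDerivAt 0 hd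
    have := h2.unique h1
    rw [translate_zero] at this
    rw [this, neg_neg]

theorem IsWeakDeriv.unique {f g g' : Lp E 2 (volume : Measure ℝ)}
    (h : IsWeakDeriv f g) (h' : IsWeakDeriv f g') : g = g' :=
  (isWeakDeriv_iff_hasDerivAt.1 h).unique (isWeakDeriv_iff_hasDerivAt.1 h')

theorem isWeakDeriv_of_tendsto {ι : Type*} {l : Filter ι} [l.NeBot]
    {f g : ι → Lp E 2 (volume : Measure ℝ)} {f₀ g₀ : Lp E 2 (volume : Measure ℝ)}
    (h : ∀ i, IsWeakDeriv (f i) (g i)) (hf : Tendsto f l (𝓝 f₀)) (hg : Tendsto g l (𝓝 g₀)) :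
    IsWeakDeriv f₀ g₀ := by
  rw [isWeakDeriv_iff]
  intro φ hφ hc
  have h1 := ((testPairing (E := E) (hφ.continuous_deriv (by simp)) hc.deriv).continuous.tendsto
    f₀).comp hf
  have h2 := ((testPairing (E := E) hφ.continuous hc).continuous.tendsto g₀).comp hg
  refine tendsto_nhds_unique h1 (h2.neg.congr fun i => ?_)
  exact (isWeakDeriv_iff.1 (h i) φ hφ hc).symm

theorem IsWeakDeriv.compLpL (L : E →L[ℝ] F)
    {f g : Lp E 2 (volume : Measure ℝ)} (h : IsWeakDeriv f g) :
    IsWeakDeriv (L.compLpL 2 volume f) (L.compLpL 2 volume g) := by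
  rw [isWeakDeriv_iff_hasDerivAt] at h ⊢
  have := (L.compLpL 2 (volume : Measure ℝ)).hasFDerivAt.comp_hasDerivAt 0 h
  refine this.congr_of_eventuallyEq (Eventually.of_forall fun s => ?_)
  exact translate_compLpL L s f

theorem IsWeakDeriv.translate {f g : Lp E 2 (volume : Measure ℝ)}
    (h : IsWeakDeriv f g) (a : ℝ) :
    IsWeakDeriv (SpectralFlow.translate a f) (SpectralFlow.translate a g) := by
  rw [isWeakDeriv_iff_hasDerivAt] at h ⊢
  have := (SpectralFlow.translate (E := E) a).toContinuousLinearMap.hasFDerivAt.comp_hasDerivAt 0 h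
  refine this.congr_of_eventuallyEq (Eventually.of_forall fun s => ?_)
  change SpectralFlow.translate s (SpectralFlow.translate a f) =
    SpectralFlow.translate a (SpectralFlow.translate s f)
  rw [← translate_add, ← translate_add, add_comm]

end Translation

/-! ## Classical and weak derivatives of scalar functions -/

section Scalar

theorem isWeakDeriv_toLp {f f' : ℝ → ℝ} (hf : MemLp f 2 volume) (hf' : MemLp f' 2 volume)
    (hd : ∀ t, HasDerivAt f (f' t) t) : IsWeakDeriv (hf.toLp f) (hf'.toLp f') := by
  intro φ hφ hc
  have hdφ : Continuous (deriv φ) := hφ.continuous_deriv (by simp)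
  have h1 : ∫ t, deriv φ t • hf.toLp f t = ∫ t, f t * deriv φ t :=
    integral_congr_ae (hf.coeFn_toLp.mono fun t ht => by simp [ht, mul_comm])
  have h2 : ∫ t, φ t • hf'.toLp f' t = ∫ t, f' t * φ t :=
    integral_congr_ae (hf'.coeFn_toLp.mono fun t ht => by simp [ht, mul_comm])
  have hi : ∀ {ψ : ℝ → ℝ} {k : ℝ → ℝ}, Continuous ψ → HasCompactSupport ψ → MemLp k 2 volume →
      Integrable (fun t => k t * ψ t) := fun hψ hψc hk => by
    have := (integrable_smul_of_test hψ hψc (hk.toLp _)).congr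
      (hk.coeFn_toLp.mono fun t ht => by simp only [ht]; rfl)
    refine this.congr (Eventually.of_forall fun t => ?_)
    simp [mul_comm]
  rw [h1, h2]
  exact integral_mul_deriv_eq_deriv_mul_of_integrable (fun t _ => hd t)
    (fun t _ => (hφ.differentiable (by simp) t).hasDerivAt) (hi hdφ hc.deriv hf)
    (hi hφ.continuous hc hf') (hi hφ.continuous hc hf)

theorem isWeakDeriv_testLp {φ : ℝ → ℝ} (hφ : ContDiff ℝ ∞ φ) (hc : HasCompactSupport φ) :
    IsWeakDeriv (testLp hφ.continuous hc)
      (testLp (hφ.continuous_deriv (by simp)) hc.deriv) :=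
  isWeakDeriv_toLp _ _ fun t => (hφ.differentiable (by simp) t).hasDerivAt

/-- A test function of zero mean is the derivative of a test function. -/
theorem exists_test_primitive {χ : ℝ → ℝ} (hχ : ContDiff ℝ ∞ χ) (hc : HasCompactSupport χ)
    (h0 : ∫ t, χ t = 0) :
    ∃ ψ : ℝ → ℝ, ContDiff ℝ ∞ ψ ∧ HasCompactSupport ψ ∧ deriv ψ = χ := by
  obtain ⟨R, hR⟩ := hc.isBounded.subset_closedBall 0
  have hz : ∀ t, t ∉ Metric.closedBall (0 : ℝ) R → χ t = 0 := fun t ht =>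
    image_eq_zero_of_notMem_tsupport fun h => ht (hR h)
  have hz1 : ∀ t, t < -R → χ t = 0 := fun t ht => hz t (by
    rw [mem_closedBall_zero_iff, Real.norm_eq_abs, not_le]
    exact lt_of_lt_of_le (by linarith) (neg_le_abs t))
  have hz2 : ∀ t, R < t → χ t = 0 := fun t ht => hz t (by
    rw [mem_closedBall_zero_iff, Real.norm_eq_abs, not_le]
    exact lt_of_lt_of_le ht (le_abs_self t))
  let ψ : ℝ → ℝ := fun t => ∫ s in (-R)..t, χ s
  have hd : ∀ t, HasDerivAt ψ (χ t) t := fun t =>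
    intervalIntegral.integral_hasDerivAt_right (hχ.continuous.intervalIntegrable _ _)
      (hχ.continuous.stronglyMeasurableAtFilter _ _) hχ.continuous.continuousAt
  have hdψ : deriv ψ = χ := funext fun t => (hd t).deriv
  refine ⟨ψ, ?_, ?_, hdψ⟩
  · rw [contDiff_infty_iff_deriv]
    exact ⟨fun t => (hd t).differentiableAt, hdψ ▸ hχ⟩
  · refine HasCompactSupport.of_support_subset_isCompact (isCompact_Icc (a := -|R|) (b := |R|)) ?_
    intro t ht
    by_contra hn
    apply ht
    rw [Set.mem_Icc, not_and_or, not_le, not_le] at hn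
    rcases hn with hn | hn
    · have hn' : t < -R := hn.trans_le (neg_le_neg (le_abs_self R))
      change ∫ s in (-R)..t, χ s = 0
      rw [intervalIntegral.integral_symm, intervalIntegral.integral_of_le hn'.le,
        integral_Ioc_eq_integral_Ioo, neg_eq_zero]
      exact setIntegral_eq_zero_of_forall_eq_zero fun s hs => hz1 s hs.2
    · have hn1 : R < t := (le_abs_self R).trans_lt hn
      have hn2 : -R ≤ t := (neg_le_abs R).trans hn.le
      change ∫ s in (-R)..t, χ s = 0
      rw [intervalIntegral.integral_of_le hn2, ← integral_Icc_eq_integral_Ioc]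
      rw [← h0]
      refine setIntegral_eq_integral_of_forall_compl_eq_zero fun s hs => ?_
      rw [Set.mem_Icc, not_and_or, not_le, not_le] at hs
      rcases hs with hs | hs
      · exact hz1 s hs
      · exact hz2 s (hn1.trans hs)

/-- The lemma of du Bois-Reymond. -/
theorem exists_ae_eq_const {f : ℝ → ℝ} (hf : LocallyIntegrable f volume)
    (h : ∀ ψ : ℝ → ℝ, ContDiff ℝ ∞ ψ → HasCompactSupport ψ → ∫ t, deriv ψ t * f t = 0) :
    ∃ c : ℝ, f =ᵐ[volume] fun _ => c := by
  let b : ContDiffBump (0 : ℝ) := default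
  let ρ : ℝ → ℝ := b.normed volume
  have hρ : ContDiff ℝ ∞ ρ := b.contDiff_normed
  have hρc : HasCompactSupport ρ := b.hasCompactSupport_normed
  have hρ1 : ∫ t, ρ t = 1 := b.integral_normed
  have hmul : ∀ {φ : ℝ → ℝ}, Continuous φ → HasCompactSupport φ →
      Integrable (fun t => φ t * f t) := fun hφ hc => by
    simpa using hf.integrable_smul_left_of_hasCompactSupport hφ hc
  refine ⟨∫ t, ρ t * f t, ?_⟩
  refine ae_eq_of_integral_contDiff_smul_eq hf (locallyIntegrable_const _) fun φ hφ hc => ?_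
  -- Subtracting (∫φ)ρ, where ρ has integral one, makes the mean zero, so the difference is a
  -- derivative ψ'. The hypothesis for ψ reads ∫φf = (∫φ)(∫ρf), which identifies the constant as
  -- ∫ρf.
  obtain ⟨ψ, hψ, hψc, hψd⟩ := exists_test_primitive (χ := fun t => φ t - (∫ s, φ s) * ρ t)
    (hφ.sub (contDiff_const.mul hρ)) (hc.sub hρc.mul_left) (by
      rw [integral_sub (hφ.continuous.integrable_of_hasCompactSupport hc)
        ((hρ.continuous.integrable_of_hasCompactSupport hρc).const_mul _),
        integral_const_mul, hρ1, mul_one, sub_self])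
  have h1 := h ψ hψ hψc
  rw [hψd] at h1
  have h2 : ∫ t, (φ t - (∫ s, φ s) * ρ t) * f t =
      (∫ t, φ t * f t) - (∫ s, φ s) * ∫ t, ρ t * f t := by
    rw [← integral_const_mul, ← integral_sub (hmul hφ.continuous hc)
      ((hmul hρ.continuous hρc).const_mul _)]
    congr 1; ext t; ring
  rw [h2, sub_eq_zero] at h1
  simp only [smul_eq_mul]
  rw [h1, integral_mul_const]

theorem intervalIntegrable_Lp (g : Lp ℝ 2 (volume : Measure ℝ)) (a b : ℝ) :
    IntervalIntegrable g volume a b :=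
  ((locallyIntegrable_Lp g).integrableOn_isCompact isCompact_uIcc).intervalIntegrable

/-- An `L²` function with an `L²` weak derivative has an absolutely continuous representative. -/
theorem IsWeakDeriv.exists_ae_eq_integral {f g : Lp ℝ 2 (volume : Measure ℝ)}
    (h : IsWeakDeriv f g) : ∃ c : ℝ, f =ᵐ[volume] fun t => c + ∫ s in (0 : ℝ)..t, g s := by
  let G : ℝ → ℝ := fun t => ∫ s in (0 : ℝ)..t, g s
  have hGc : Continuous G :=
    intervalIntegral.continuous_primitive (fun a b => intervalIntegrable_Lp g a b) 0
  -- The primitive G of g has weak derivative g: it is absolutely continuous, and integration by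
  -- parts on an interval with the support of φ in its interior has no boundary terms. Consequently
  -- f - G has weak derivative zero.
  have hG : ∀ φ : ℝ → ℝ, ContDiff ℝ ∞ φ → HasCompactSupport φ →
      ∫ t, deriv φ t * G t = - ∫ t, φ t * g t := by
    intro φ hφ hc
    obtain ⟨R, hR⟩ := hc.isBounded.subset_closedBall 0
    have hRz : ∀ t, t ∉ Set.Ioc (-(|R| + 1)) (|R| + 1) → t ∉ tsupport φ := by
      intro t ht h'
      apply ht
      have := hR h'
      rw [mem_closedBall_zero_iff, Real.norm_eq_abs] at this
      have h3 := abs_le.1 (this.trans (le_abs_self R))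
      exact ⟨by linarith [h3.1], by linarith [h3.2]⟩
    have hle : -(|R| + 1) ≤ |R| + 1 := by linarith [abs_nonneg R]
    have e1 : ∫ t, deriv φ t * G t = ∫ t in (-(|R| + 1))..(|R| + 1), deriv φ t * G t := by
      rw [intervalIntegral.integral_of_le hle]
      refine (setIntegral_eq_integral_of_forall_compl_eq_zero fun t ht => ?_).symm
      rw [image_eq_zero_of_notMem_tsupport
        (fun h' => hRz t ht (tsupport_deriv_subset h')), zero_mul]
    have e2 : ∫ t, φ t * g t = ∫ t in (-(|R| + 1))..(|R| + 1), φ t * g t := by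
      rw [intervalIntegral.integral_of_le hle]
      refine (setIntegral_eq_integral_of_forall_compl_eq_zero fun t ht => ?_).symm
      rw [image_eq_zero_of_notMem_tsupport (hRz t ht), zero_mul]
    have hac : AbsolutelyContinuousOnInterval G (-(|R| + 1)) (|R| + 1) :=
      (intervalIntegrable_Lp g _ _).absolutelyContinuousOnInterval_intervalIntegral
        (c := 0) (by
          rw [Set.uIcc_of_le hle]; constructor <;> linarith [abs_nonneg R])
    have hφa : AbsolutelyContinuousOnInterval φ (-(|R| + 1)) (|R| + 1) :=
      ((hφ.of_le (by simp)).contDiffOn).absolutelyContinuousOnInterval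
    have h3 := hφa.integral_mul_deriv_eq_deriv_mul hac
    have hb : φ (|R| + 1) = 0 := by
      by_contra hne
      have := hR (subset_tsupport _ hne)
      rw [mem_closedBall_zero_iff, Real.norm_eq_abs] at this
      linarith [le_abs_self (|R| + 1), le_abs_self R]
    have ha : φ (-(|R| + 1)) = 0 := by
      by_contra hne
      have := hR (subset_tsupport _ hne)
      rw [mem_closedBall_zero_iff, Real.norm_eq_abs, abs_neg] at this
      linarith [le_abs_self (|R| + 1), le_abs_self R]
    rw [ha, hb, zero_mul, zero_mul, sub_zero, zero_sub] at h3
    rw [e1, e2]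
    have h4 : ∫ t in (-(|R| + 1))..(|R| + 1), φ t * deriv G t =
        ∫ t in (-(|R| + 1))..(|R| + 1), φ t * g t := by
      refine intervalIntegral.integral_congr_ae ?_
      filter_upwards [(intervalIntegrable_Lp g (-(|R| + 1)) (|R| + 1)).ae_hasDerivAt_integral]
        with t ht ht'
      rw [(ht (Set.uIoc_subset_uIcc ht') 0 (by
        rw [Set.uIcc_of_le hle]; constructor <;> linarith [abs_nonneg R])).deriv]
    rw [← h4, h3, neg_neg]
  obtain ⟨c, hc⟩ := exists_ae_eq_const (f := fun t => f t - G t)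
    ((locallyIntegrable_Lp f).sub hGc.locallyIntegrable) (fun ψ hψ hψc => by
      have hdψ : Continuous (deriv ψ) := hψ.continuous_deriv (by simp)
      have h1 := h ψ hψ hψc
      have h2 := hG ψ hψ hψc
      simp only [smul_eq_mul] at h1
      have h3 : ∫ t, deriv ψ t * (f t - G t) =
          (∫ t, deriv ψ t * f t) - ∫ t, deriv ψ t * G t := by
        rw [← integral_sub]
        · congr 1; ext t; ring
        · exact integrable_smul_of_test hdψ hψc.deriv f
        · exact (hdψ.mul hGc).integrable_of_hasCompactSupport hψc.deriv.mul_right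
      rw [h3, h1, h2, sub_self])
  refine ⟨c, hc.mono fun t ht => ?_⟩
  simp only at ht
  rw [← ht]; simp [G]

end Scalar

/-! ## Multiplication operators -/

section Multiplication

open scoped BoundedContinuousFunction

variable {E : Type*} [NormedAddCommGroup E] [InnerProductSpace ℝ E]
  {F : Type*} [NormedAddCommGroup F] [InnerProductSpace ℝ F]
  {G : Type*} [NormedAddCommGroup G] [InnerProductSpace ℝ G]

theorem memLp_top_of_bcf {V : Type*} [NormedAddCommGroup V] (B : ℝ →ᵇ V) :
    MemLp B ⊤ (volume : Measure ℝ) :=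
  memLp_top_of_bound B.continuous.aestronglyMeasurable ‖B‖
    (Eventually.of_forall fun t => B.norm_coe_le_norm t)

/-- Multiplication by a bounded continuous operator-valued function, as an operator on `L²`. -/
def mulOp (B : ℝ →ᵇ (E →L[ℝ] F)) :
    Lp E 2 (volume : Measure ℝ) →L[ℝ] Lp F 2 (volume : Measure ℝ) :=
  (ContinuousLinearMap.id ℝ (E →L[ℝ] F)).holderL volume ⊤ 2 2 ((memLp_top_of_bcf B).toLp B)

theorem coeFn_mulOp (B : ℝ →ᵇ (E →L[ℝ] F)) (f : Lp E 2 (volume : Measure ℝ)) :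
    mulOp B f =ᵐ[volume] fun t => B t (f t) := by
  have h1 := (ContinuousLinearMap.id ℝ (E →L[ℝ] F)).coeFn_holder (r := 2)
    ((memLp_top_of_bcf B).toLp B) f
  filter_upwards [h1, (memLp_top_of_bcf B).coeFn_toLp] with t h1 h2
  rw [h2] at h1
  exact h1

theorem norm_mulOp_apply_le (B : ℝ →ᵇ (E →L[ℝ] F)) (f : Lp E 2 (volume : Measure ℝ)) :
    ‖mulOp B f‖ ≤ ‖B‖ * ‖f‖ := by
  refine Lp.norm_le_mul_norm_of_ae_le_mul ((coeFn_mulOp B f).mono fun t ht => ?_)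
  rw [ht]
  exact (B t).le_of_opNorm_le (B.norm_coe_le_norm t) _

theorem norm_mulOp_le (B : ℝ →ᵇ (E →L[ℝ] F)) : ‖mulOp B‖ ≤ ‖B‖ :=
  ContinuousLinearMap.opNorm_le_bound _ (norm_nonneg B) (norm_mulOp_apply_le B)

theorem mulOp_add (B C : ℝ →ᵇ (E →L[ℝ] F)) : mulOp (B + C) = mulOp B + mulOp C := by
  ext1 f
  refine Lp.ext ?_
  rw [add_apply]
  filter_upwards [coeFn_mulOp (B + C) f, coeFn_mulOp B f, coeFn_mulOp C f,
    Lp.coeFn_add (mulOp B f) (mulOp C f)] with t h1 h2 h3 h4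
  rw [h1, h4, Pi.add_apply, h2, h3]; rfl

theorem mulOp_sub (B C : ℝ →ᵇ (E →L[ℝ] F)) : mulOp (B - C) = mulOp B - mulOp C := by
  rw [eq_sub_iff_add_eq, ← mulOp_add]
  exact congrArg mulOp (sub_add_cancel B C)

theorem mulOp_const (L : E →L[ℝ] F) :
    mulOp (BoundedContinuousFunction.const ℝ L) = L.compLpL 2 volume := by
  ext1 f
  refine Lp.ext ?_
  filter_upwards [coeFn_mulOp (BoundedContinuousFunction.const ℝ L) f, L.coeFn_compLpL (p := 2) f]
    with t h1 h2
  rw [h1, h2]; rfl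

theorem mulOp_mulOp (B : ℝ →ᵇ (F →L[ℝ] G)) (C : ℝ →ᵇ (E →L[ℝ] F)) (D : ℝ →ᵇ (E →L[ℝ] G))
    (h : ∀ t, D t = (B t).comp (C t)) (f : Lp E 2 (volume : Measure ℝ)) :
    mulOp B (mulOp C f) = mulOp D f := by
  refine Lp.ext ?_
  filter_upwards [coeFn_mulOp B (mulOp C f), coeFn_mulOp C f, coeFn_mulOp D f] with t h1 h2 h3
  rw [h1, h2, h3, h]; rfl

/-- The translate of a bounded continuous function. -/
def shift {V : Type*} [NormedAddCommGroup V] (h : ℝ) (B : ℝ →ᵇ V) : ℝ →ᵇ V :=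
  B.compContinuous ⟨fun t => t + h, by fun_prop⟩

theorem shift_apply {V : Type*} [NormedAddCommGroup V] (h : ℝ) (B : ℝ →ᵇ V) (t : ℝ) :
    shift h B t = B (t + h) := rfl

theorem translate_mulOp (h : ℝ) (B : ℝ →ᵇ (E →L[ℝ] F)) (f : Lp E 2 (volume : Measure ℝ)) :
    translate h (mulOp B f) = mulOp (shift h B) (translate h f) := by
  refine Lp.ext ?_
  filter_upwards [coeFn_translate h (mulOp B f), coeFn_mulOp (shift h B) (translate h f),
    ae_comp_add (coeFn_mulOp B f) h, coeFn_translate h f] with t h1 h2 h3 h4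
  rw [h1, h2, h3, h4]; rfl

/-- Strong continuity of multiplication operators, by dominated convergence. -/
theorem tendsto_mulOp {ι : Type*} {l : Filter ι} [l.IsCountablyGenerated]
    {q : ι → ℝ →ᵇ (E →L[ℝ] F)} {B : ℝ →ᵇ (E →L[ℝ] F)} {M : ℝ} (hM : ∀ᶠ i in l, ‖q i‖ ≤ M)
    (h : ∀ t, Tendsto (fun i => q i t) l (𝓝 (B t))) (f : Lp E 2 (volume : Measure ℝ)) :
    Tendsto (fun i => mulOp (q i) f) l (𝓝 (mulOp B f)) := by
  rw [tendsto_iff_norm_sub_tendsto_zero]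
  have hsq : ∀ i, ‖mulOp (q i) f - mulOp B f‖ ^ 2 = ∫ t, ‖(q i t - B t) (f t)‖ ^ 2 := by
    intro i
    rw [← sub_apply, ← mulOp_sub, ← real_inner_self_eq_norm_sq, L2.inner_def]
    refine integral_congr_ae ((coeFn_mulOp (q i - B) f).mono fun t ht => ?_)
    simp only [ht, real_inner_self_eq_norm_sq]; rfl
  have hint : Integrable (fun t => (M + ‖B‖) ^ 2 * ‖f t‖ ^ 2) volume :=
    ((Lp.memLp f).integrable_norm_pow (by norm_num)).const_mul _
  have h2 : Tendsto (fun i => ‖mulOp (q i) f - mulOp B f‖ ^ 2) l (𝓝 0) := by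
    simp_rw [hsq]
    rw [← integral_zero ℝ ℝ (μ := volume)]
    refine tendsto_integral_filter_of_dominated_convergence
      (fun t => (M + ‖B‖) ^ 2 * ‖f t‖ ^ 2) (Eventually.of_forall fun i => ?_) ?_ hint ?_
    · have := (((q i).continuous.sub B.continuous).aestronglyMeasurable
        (μ := volume)).apply_continuousLinearMap
      have h3 : AEStronglyMeasurable (fun t => (q i t - B t) (f t)) volume :=
        (ContinuousLinearMap.id ℝ (E →L[ℝ] F)).aestronglyMeasurable_comp₂
          ((q i).continuous.sub B.continuous).aestronglyMeasurable
          (Lp.aestronglyMeasurable f)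
      exact (h3.norm.pow 2)
    · filter_upwards [hM] with i hi
      refine Eventually.of_forall fun t => ?_
      rw [Real.norm_of_nonneg (by positivity), ← mul_pow]
      refine pow_le_pow_left₀ (norm_nonneg _) ?_ 2
      refine (ContinuousLinearMap.le_opNorm _ _).trans ?_
      gcongr
      exact (norm_sub_le _ _).trans (add_le_add (((q i).norm_coe_le_norm t).trans hi)
        (B.norm_coe_le_norm t))
    · refine Eventually.of_forall fun t => ?_
      have h4 : Tendsto (fun i => (q i t - B t) (f t)) l (𝓝 ((B t - B t) (f t))) :=
        ((ContinuousLinearMap.apply ℝ F (f t)).continuous.tendsto _).comp ((h t).sub_const _)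
      have h5 := (h4.norm.pow 2)
      simpa using h5
  have h3 := h2.sqrt
  simpa [Real.sqrt_sq] using h3

variable {V : Type*} [NormedAddCommGroup V] [NormedSpace ℝ V]

/-- The difference quotient of a bounded continuous function. -/
def diffQuot (s : ℝ) (B : ℝ →ᵇ V) : ℝ →ᵇ V := s⁻¹ • (shift s B - B)

theorem diffQuot_apply (s : ℝ) (B : ℝ →ᵇ V) (t : ℝ) :
    diffQuot s B t = s⁻¹ • (B (t + s) - B t) := rfl

theorem norm_diffQuot_le {B B' : ℝ →ᵇ V} (hd : ∀ t, HasDerivAt B (B' t) t) (s : ℝ) :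
    ‖diffQuot s B‖ ≤ ‖B'‖ := by
  refine (BoundedContinuousFunction.norm_le (norm_nonneg _)).2 fun t => ?_
  rcases eq_or_ne s 0 with rfl | hs
  · simp [diffQuot_apply]
  rw [diffQuot_apply, norm_smul, norm_inv]
  have := Convex.norm_image_sub_le_of_norm_hasDerivWithin_le (s := Set.univ) (f := B) (x := t)
    (y := t + s) (fun x _ => (hd x).hasDerivWithinAt) (fun x _ => B'.norm_coe_le_norm x)
    convex_univ trivial trivial
  rw [add_sub_cancel_left] at this
  rw [inv_mul_le_iff₀ (norm_pos_iff.2 hs), mul_comm]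
  exact this

theorem tendsto_diffQuot {B B' : ℝ →ᵇ V} (hd : ∀ t, HasDerivAt B (B' t) t) (t : ℝ) :
    Tendsto (fun s => diffQuot s B t) (𝓝[≠] 0) (𝓝 (B' t)) := by
  simp_rw [diffQuot_apply]
  exact (hd t).tendsto_slope_zero

/-- The difference quotients of B converge only pointwise in t, so dominated convergence gives the
limit for a fixed f. Replacing f by its translate costs at most the uniform bound on the quotients
times ‖translate s f - f‖. -/
theorem tendsto_mulOp_diffQuot {B B' : ℝ →ᵇ (E →L[ℝ] F)} (hd : ∀ t, HasDerivAt B (B' t) t)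
    (f : Lp E 2 (volume : Measure ℝ)) :
    Tendsto (fun s => mulOp (diffQuot s B) (translate s f)) (𝓝[≠] 0) (𝓝 (mulOp B' f)) := by
  have h1 := tendsto_mulOp (M := ‖B'‖) (l := 𝓝[≠] (0 : ℝ))
    (Eventually.of_forall fun s => norm_diffQuot_le hd s) (tendsto_diffQuot hd) f
  have h2 : Tendsto (fun s => ‖B'‖ * ‖translate s f - f‖) (𝓝[≠] 0) (𝓝 0) := by
    have h3 := ((continuous_translate f).tendsto 0).mono_left (nhdsWithin_le_nhds (s := {0}ᶜ))
    rw [translate_zero] at h3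
    simpa using (tendsto_iff_norm_sub_tendsto_zero.1 h3).const_mul ‖B'‖
  have h3 : Tendsto (fun s => mulOp (diffQuot s B) (translate s f - f)) (𝓝[≠] 0) (𝓝 0) := by
    refine squeeze_zero_norm (fun s => (norm_mulOp_apply_le _ _).trans ?_) h2
    gcongr
    exact norm_diffQuot_le hd s
  have h4 := h1.add h3
  rw [add_zero] at h4
  refine h4.congr fun s => ?_
  rw [← map_add, add_sub_cancel]

/-- The discrete Leibniz rule. It yields the product rule as s → 0, and later the equation satisfied
by the difference quotients of a solution. -/
theorem diffQuot_translate_mulOp {B : ℝ →ᵇ (E →L[ℝ] F)} (f : Lp E 2 (volume : Measure ℝ))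
    (s : ℝ) : s⁻¹ • (translate s (mulOp B f) - mulOp B f) =
      mulOp B (s⁻¹ • (translate s f - f)) + mulOp (diffQuot s B) (translate s f) := by
  rw [translate_mulOp]
  refine Lp.ext ?_
  filter_upwards [Lp.coeFn_smul s⁻¹ (mulOp (shift s B) (translate s f) - mulOp B f),
    Lp.coeFn_sub (mulOp (shift s B) (translate s f)) (mulOp B f),
    coeFn_mulOp (shift s B) (translate s f), coeFn_mulOp B f,
    coeFn_mulOp B (s⁻¹ • (translate s f - f)), coeFn_mulOp (diffQuot s B) (translate s f),
    Lp.coeFn_smul s⁻¹ (translate s f - f), Lp.coeFn_sub (translate s f) f,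
    Lp.coeFn_add (mulOp B (s⁻¹ • (translate s f - f))) (mulOp (diffQuot s B) (translate s f))]
    with t h1 h2 h3 h4 h5 h6 h7 h8 h9
  rw [h1, h9, Pi.smul_apply, h2, Pi.sub_apply, h3, h4, Pi.add_apply, h5, h6, h7, Pi.smul_apply,
    h8, Pi.sub_apply, shift_apply, diffQuot_apply, smul_apply, sub_apply, map_smul, map_sub,
    ← smul_add]
  congr 1
  abel

/-- The product rule. -/
theorem IsWeakDeriv.mulOp [CompleteSpace E] [CompleteSpace F] {B B' : ℝ →ᵇ (E →L[ℝ] F)}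
    (hd : ∀ t, HasDerivAt B (B' t) t) {f f' : Lp E 2 (volume : Measure ℝ)}
    (h : IsWeakDeriv f f') :
    IsWeakDeriv (SpectralFlow.mulOp B f) (SpectralFlow.mulOp B f' + SpectralFlow.mulOp B' f) := by
  rw [isWeakDeriv_iff_hasDerivAt, hasDerivAt_iff_tendsto_slope_zero] at h ⊢
  simp only [zero_add, SpectralFlow.translate_zero] at h ⊢
  refine Tendsto.congr (fun s => (diffQuot_translate_mulOp f s).symm) ?_
  exact (((SpectralFlow.mulOp B).continuous.tendsto _).comp h).add (tendsto_mulOp_diffQuot hd f)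

end Multiplication

/-! ## Compactness of multiplication operators -/

section Approximation

theorem isCompactOperator_of_forall_approx {X Y : Type*} [NormedAddCommGroup X] [NormedSpace ℝ X]
    [NormedAddCommGroup Y] [NormedSpace ℝ Y] [CompleteSpace Y] {T : X →L[ℝ] Y}
    (h : ∀ ε > 0, ∃ S : X →L[ℝ] Y, IsCompactOperator S ∧ ‖T - S‖ ≤ ε) : IsCompactOperator T := by
  have hc := isClosed_setOfPred_isCompactOperator (𝕜₁ := ℝ) (𝕜₂ := ℝ) (M₁ := X) (M₂ := Y)
    (σ₁₂ := RingHom.id ℝ)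
  change T ∈ {f : X →L[ℝ] Y | IsCompactOperator f}
  rw [← hc.closure_eq, Metric.mem_closure_iff]
  intro ε hε
  obtain ⟨S, hS, hTS⟩ := h (ε / 2) (by positivity)
  exact ⟨S, hS, by rw [dist_eq_norm]; linarith⟩

theorem isCompactOperator_smulRight {X Y : Type*} [NormedAddCommGroup X] [NormedSpace ℝ X]
    [NormedAddCommGroup Y] [NormedSpace ℝ Y] (l : X →L[ℝ] ℝ) (y : Y) :
    IsCompactOperator (l.smulRight y) := by
  have h : IsCompactOperator l := isCompactOperator_of_locallyCompactSpace_dom l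
  exact h.clm_comp (ContinuousLinearMap.toSpanSingleton ℝ y)

theorem isCompactOperator_finset_sum {X Y ι : Type*} [NormedAddCommGroup X] [NormedSpace ℝ X]
    [NormedAddCommGroup Y] [NormedSpace ℝ Y] (s : Finset ι) (f : ι → X →L[ℝ] Y)
    (h : ∀ i ∈ s, IsCompactOperator (f i)) : IsCompactOperator (∑ i ∈ s, f i : X →L[ℝ] Y) :=
  Submodule.sum_mem (compactOperator (RingHom.id ℝ) X Y)
    (t := s) (f := f) h

/-- A continuous function with totally bounded image is uniformly approximated by finite sums
`∑ φ_x • x`, with continuous scalar functions `φ_x`. -/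
theorem exists_partition_approx {V : Type*} [NormedAddCommGroup V] [NormedSpace ℝ V] {N : ℝ → V}
    (hN : Continuous N) {K : Set ℝ} (hK : TotallyBounded (N '' K)) {ε : ℝ} (hε : 0 < ε) :
    ∃ (s : Finset V) (φ : V → ℝ →ᵇ ℝ), (∀ x ∈ s, x ∈ N '' K) ∧
      ∀ t ∈ K, ‖N t - ∑ x ∈ s, φ x t • x‖ ≤ ε := by
  obtain ⟨s, hsN, hsf, hs⟩ := totallyBounded_iff_subset.1 hK _
    (Metric.dist_mem_uniformity (half_pos hε))
  lift s to Finset V using hsf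
  -- Hat functions of height and radius ε around the points of a finite ε/2-net. Their sum is at
  -- least ε/2 on K, and each vanishes where N is at distance ε or more from its centre.
  let g : V → ℝ → ℝ := fun x t => max 0 (ε - ‖N t - x‖)
  have hg0 : ∀ x t, 0 ≤ g x t := fun x t => le_max_left _ _
  have hgc : ∀ x, Continuous (g x) := fun x => by fun_prop
  let G : ℝ → ℝ := fun t => ∑ x ∈ s, g x t
  have hGc : Continuous G := continuous_finsetSum _ fun x _ => hgc x
  have hmax : ∀ t, 0 < max (G t) (ε / 2) := fun t => lt_max_of_lt_right (half_pos hε)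
  have hG : ∀ t ∈ K, ε / 2 ≤ G t := by
    intro t ht
    obtain ⟨x, hx⟩ := Set.mem_iUnion.1 (hs ⟨t, ht, rfl⟩)
    obtain ⟨hxs, hx⟩ := Set.mem_iUnion.1 hx
    have hx : dist (N t) x < ε / 2 := hx
    rw [dist_eq_norm] at hx
    calc ε / 2 ≤ g x t := le_max_of_le_right (by linarith)
      _ ≤ G t := Finset.single_le_sum (f := fun x => g x t) (fun y _ => hg0 y t) hxs
  -- The maximum with ε/2 keeps the quotient continuous and bounded off K, where the sum of the hats
  -- may vanish; on K it has no effect.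
  let φ : V → ℝ →ᵇ ℝ := fun x => BoundedContinuousFunction.ofNormedAddCommGroup
    (fun t => g x t / max (G t) (ε / 2))
    ((hgc x).div (hGc.max continuous_const) fun t => (hmax t).ne') (ε / (ε / 2)) (fun t => by
      rw [Real.norm_of_nonneg (div_nonneg (hg0 x t) (hmax t).le)]
      exact div_le_div₀ hε.le (max_le hε.le (sub_le_self _ (norm_nonneg _))) (half_pos hε)
        (le_max_right _ _))
  refine ⟨s, φ, fun x hx => hsN hx, fun t ht => ?_⟩
  have hm : max (G t) (ε / 2) = G t := max_eq_left (hG t ht)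
  have hGp : 0 < G t := (half_pos hε).trans_le (hG t ht)
  have hφ : ∀ x, φ x t = g x t / G t := fun x => by
    change g x t / max (G t) (ε / 2) = _
    rw [hm]
  have hsum : ∑ x ∈ s, φ x t = 1 := by
    simp_rw [hφ]
    rw [← Finset.sum_div, div_self hGp.ne']
  have h1 : N t - ∑ x ∈ s, φ x t • x = ∑ x ∈ s, φ x t • (N t - x) := by
    simp_rw [smul_sub]
    rw [Finset.sum_sub_distrib, ← Finset.sum_smul, hsum, one_smul]
  rw [h1]
  calc ‖∑ x ∈ s, φ x t • (N t - x)‖ ≤ ∑ x ∈ s, φ x t * ε := by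
        refine norm_sum_le_of_le _ fun x _ => ?_
        have h0 : 0 ≤ φ x t := by rw [hφ]; exact div_nonneg (hg0 x t) hGp.le
        rw [norm_smul, Real.norm_of_nonneg h0]
        rcases le_or_gt ‖N t - x‖ ε with h | h
        · gcongr
        · have : φ x t = 0 := by
            rw [hφ]
            have : g x t = 0 := max_eq_left (by linarith)
            rw [this, zero_div]
          rw [this, zero_mul, zero_mul]
    _ = ε := by rw [← Finset.sum_mul, hsum, one_mul]

end Approximation

/-! ### Point evaluations of Sobolev functions and Rellich's theorem on the line -/

section Rellich

/-- Pairs `(f, f')` of a scalar `L²` function and its weak derivative. -/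
def weakPairs : Submodule ℝ (Lp ℝ 2 (volume : Measure ℝ) × Lp ℝ 2 (volume : Measure ℝ)) where
  carrier := {p | IsWeakDeriv p.1 p.2}
  add_mem' h h' := h.add h'
  zero_mem' := isWeakDeriv_zero
  smul_mem' c _ h := h.smul c

theorem memLp_indicator_unit {r : ℝ → ℝ} (hr : Continuous r) :
    MemLp ((Set.Icc (0 : ℝ) 1).indicator r) 2 (volume : Measure ℝ) :=
  (memLp_indicator_iff_restrict measurableSet_Icc).2
    (by
      obtain ⟨C, hC⟩ := isCompact_Icc.exists_bound_of_continuousOn (hr.continuousOn (s := Set.Icc 0 1))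
      exact MemLp.of_bound hr.aestronglyMeasurable C (ae_restrict_of_forall_mem measurableSet_Icc hC))

theorem inner_translate_unit {r : ℝ → ℝ} (hr : Continuous r) (t : ℝ)
    (f : Lp ℝ 2 (volume : Measure ℝ)) :
    ⟪translate (-t) ((memLp_indicator_unit hr).toLp _), f⟫_ℝ =
      ∫ x in t..(t + 1), r (x - t) * f x := by
  rw [inner_translate, neg_neg, L2.inner_def]
  have h1 : ∫ a, ⟪(memLp_indicator_unit hr).toLp _ a, translate t f a⟫_ℝ =
      ∫ a, (Set.Icc (0 : ℝ) 1).indicator (fun s => r s * f (s + t)) a := by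
    refine integral_congr_ae ?_
    filter_upwards [(memLp_indicator_unit hr).coeFn_toLp, coeFn_translate t f] with a h1 h2
    rw [h1, h2]
    by_cases ha : a ∈ Set.Icc (0 : ℝ) 1
    · simp [ha, mul_comm]
    · simp [ha]
  rw [h1, integral_indicator measurableSet_Icc, integral_Icc_eq_integral_Ioc,
    ← intervalIntegral.integral_of_le zero_le_one]
  have h2 := intervalIntegral.integral_comp_add_right (a := 0) (b := 1)
    (fun x => r (x - t) * f x) t
  simp only [add_sub_cancel_right, zero_add] at h2
  rw [h2, add_comm]

/-- The value at `t` of a function with a weak derivative, as a functional. -/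
def evalFunctional (t : ℝ) : weakPairs →L[ℝ] ℝ :=
  (innerSL ℝ (translate (-t) ((memLp_indicator_unit (r := fun _ => 1) continuous_const).toLp
    _))).comp ((ContinuousLinearMap.fst ℝ _ _).comp weakPairs.subtypeL) -
  (innerSL ℝ (translate (-t) ((memLp_indicator_unit (r := fun s => 1 - s)
    (by fun_prop)).toLp _))).comp ((ContinuousLinearMap.snd ℝ _ _).comp weakPairs.subtypeL)

/-- The evaluations depend on t through translates of two fixed L² functions, so they vary
continuously in norm. Hence the evaluations at the points of a compact set form a compact set of
functionals, which is what drives Rellich's theorem. -/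
theorem continuous_evalFunctional : Continuous evalFunctional := by
  have h : ∀ f : Lp ℝ 2 (volume : Measure ℝ), Continuous fun t : ℝ => translate (-t) f :=
    fun f => (continuous_translate f).comp continuous_neg
  have h1 := ((innerSL ℝ).continuous.comp (h ((memLp_indicator_unit (r := fun _ => 1)
      continuous_const).toLp _))).clm_comp
    (continuous_const (y := (ContinuousLinearMap.fst ℝ _ _).comp weakPairs.subtypeL))
  have h2 := ((innerSL ℝ).continuous.comp (h ((memLp_indicator_unit (r := fun s => 1 - s)
      (by fun_prop)).toLp _))).clm_comp
    (continuous_const (y := (ContinuousLinearMap.snd ℝ _ _).comp weakPairs.subtypeL))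
  exact h1.sub h2

/-- Integrating (t + 1 - x) against the derivative of the absolutely continuous representative over
[t, t + 1] gives f(t) = ∫ f(x) dx - ∫ (t + 1 - x) f'(x) dx, with both integrals over that interval.
-/
theorem evalFunctional_ae_eq (p : weakPairs) :
    p.1.1 =ᵐ[volume] fun t => evalFunctional t p := by
  obtain ⟨c, hc⟩ := IsWeakDeriv.exists_ae_eq_integral p.2
  refine hc.trans (Eventually.of_forall fun t => ?_)
  change _ = evalFunctional t p
  have e1 : evalFunctional t p = (∫ x in t..(t + 1), p.1.1 x) -
      ∫ x in t..(t + 1), (t + 1 - x) * p.1.2 x := by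
    change ⟪_, p.1.1⟫_ℝ - ⟪_, p.1.2⟫_ℝ = _
    rw [inner_translate_unit (r := fun _ => 1) continuous_const,
      inner_translate_unit (r := fun s => 1 - s) (by fun_prop)]
    simp only [one_mul]
    congr 2
    ext x; ring
  let F : ℝ → ℝ := fun t => c + ∫ s in (0 : ℝ)..t, p.1.2 s
  have e2 : ∫ x in t..(t + 1), p.1.1 x = ∫ x in t..(t + 1), F x :=
    intervalIntegral.integral_congr_ae (hc.mono fun x hx _ => hx)
  have hii := intervalIntegrable_Lp p.1.2
  have hle : min 0 t ≤ max 0 (t + 1) := (min_le_left _ _).trans (le_max_left _ _)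
  have hF0 : AbsolutelyContinuousOnInterval (fun t => ∫ s in (0 : ℝ)..t, p.1.2 s)
      (min 0 t) (max 0 (t + 1)) :=
    (hii _ _).absolutelyContinuousOnInterval_intervalIntegral
      (c := 0) (by rw [Set.uIcc_of_le hle]; exact ⟨min_le_left _ _, le_max_left _ _⟩)
  have hsub : Set.uIcc t (t + 1) ⊆ Set.uIcc (min 0 t) (max 0 (t + 1)) := by
    rw [Set.uIcc_of_le hle, Set.uIcc_of_le (by linarith)]
    exact Set.Icc_subset_Icc (min_le_right _ _) (le_max_right _ _)
  have hF1 : AbsolutelyContinuousOnInterval (fun t => ∫ s in (0 : ℝ)..t, p.1.2 s) t (t + 1) :=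
    hF0.mono hsub
  have hF : AbsolutelyContinuousOnInterval F t (t + 1) :=
    (((contDiff_const (c := c)).contDiffOn).absolutelyContinuousOnInterval).add hF1
  have hu : AbsolutelyContinuousOnInterval (fun x : ℝ => t + 1 - x) t (t + 1) :=
    ((contDiff_const.sub contDiff_id).contDiffOn).absolutelyContinuousOnInterval
  have h3 := hu.integral_mul_deriv_eq_deriv_mul hF
  have h4 : ∫ x in t..(t + 1), (t + 1 - x) * deriv F x =
      ∫ x in t..(t + 1), (t + 1 - x) * p.1.2 x := by
    refine intervalIntegral.integral_congr_ae ?_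
    filter_upwards [(hii (min 0 t) (max 0 (t + 1))).ae_hasDerivAt_integral] with x hx hx'
    rw [((hx (hsub (Set.uIoc_subset_uIcc hx')) 0 (by
      rw [Set.uIcc_of_le hle]; exact ⟨min_le_left _ _, le_max_left _ _⟩)).const_add c).deriv]
  have h5 : ∀ x, deriv (fun x : ℝ => t + 1 - x) x = -1 := fun x => by
    rw [deriv_const_sub, deriv_id'']
  simp only [h5, neg_mul, one_mul, intervalIntegral.integral_neg] at h3
  rw [e1, e2, ← h4, h3]
  change F t = _
  ring_nf

variable {E F : Type*} [NormedAddCommGroup E] [InnerProductSpace ℝ E] [NormedAddCommGroup F]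
  [InnerProductSpace ℝ F]

/-- The operator-valued function `t ↦ c t • L`. -/
def scalarMul (c : ℝ →ᵇ ℝ) (L : E →L[ℝ] F) : ℝ →ᵇ (E →L[ℝ] F) :=
  BoundedContinuousFunction.ofNormedAddCommGroup (fun t => c t • L)
    (c.continuous.smul continuous_const) (‖c‖ * ‖L‖) (fun t => by
      rw [norm_smul]; gcongr; exact c.norm_coe_le_norm t)

theorem scalarMul_apply (c : ℝ →ᵇ ℝ) (L : E →L[ℝ] F) (t : ℝ) : scalarMul c L t = c t • L := rfl

/-- Rellich's theorem on the line. -/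
theorem isCompactOperator_scalarMul_fst {c : ℝ →ᵇ ℝ} (hc : HasCompactSupport c) :
    IsCompactOperator ((mulOp (scalarMul c (ContinuousLinearMap.id ℝ ℝ))).comp
      ((ContinuousLinearMap.fst ℝ _ _).comp weakPairs.subtypeL)) := by
  refine isCompactOperator_of_forall_approx fun ε hε => ?_
  set γ : Lp ℝ 2 (volume : Measure ℝ) := testLp c.continuous hc
  have hK : IsCompact (evalFunctional '' tsupport c) :=
    IsCompact.image hc continuous_evalFunctional
  -- On the support of c the evaluation at t is close to a finite sum of φ_x(t) x with fixed
  -- functionals x, so f ↦ cf is close to a finite rank operator. The pointwise error gets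
  -- multiplied by the L² norm of c, which explains the denominator.
  obtain ⟨s, φ, -, hφ⟩ := exists_partition_approx (V := weakPairs →L[ℝ] ℝ)
    continuous_evalFunctional (K := tsupport c) (by exact hK.totallyBounded)
    (div_pos hε (by positivity : 0 < ‖γ‖ + 1))
  have hcφ : ∀ x, HasCompactSupport (fun t => c t * φ x t) := fun x => hc.mul_right
  let S : weakPairs →L[ℝ] Lp ℝ 2 (volume : Measure ℝ) :=
    ∑ x ∈ s, x.smulRight (testLp (c.continuous.mul (φ x).continuous) (hcφ x))
  refine ⟨S, isCompactOperator_finset_sum _ _ fun x _ => isCompactOperator_smulRight _ _, ?_⟩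
  refine ContinuousLinearMap.opNorm_le_bound _ hε.le fun p => ?_
  have key : ‖((mulOp (scalarMul c (ContinuousLinearMap.id ℝ ℝ))).comp
      ((ContinuousLinearMap.fst ℝ _ _).comp weakPairs.subtypeL) - S) p‖ ≤
      ((ε / (‖γ‖ + 1)) * ‖p‖) * ‖γ‖ := by
    refine Lp.norm_le_mul_norm_of_ae_le_mul ?_
    have hS : S p = ∑ x ∈ s, x p • testLp (c.continuous.mul (φ x).continuous) (hcφ x) := by
      simp [S]
    rw [sub_apply, hS]
    have hsum : ∀ᵐ t, (∑ x ∈ s, x p • testLp (c.continuous.mul (φ x).continuous) (hcφ x) :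
        Lp ℝ 2 (volume : Measure ℝ)) t = ∑ x ∈ s, x p * (c t * φ x t) := by
      have h1 := Lp.coeFn_finsetSum s
        (fun x : weakPairs →L[ℝ] ℝ => x p • testLp (c.continuous.mul (φ x).continuous) (hcφ x))
      have h2 : ∀ᵐ t, ∀ x ∈ s, (x p • testLp (c.continuous.mul (φ x).continuous) (hcφ x) :
          Lp ℝ 2 (volume : Measure ℝ)) t = x p * (c t * φ x t) := by
        rw [Finset.eventually_all]
        intro x _
        filter_upwards [Lp.coeFn_smul (x p) (testLp (c.continuous.mul (φ x).continuous) (hcφ x)),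
          coeFn_testLp (c.continuous.mul (φ x).continuous) (hcφ x)] with t h3 h4
        rw [h3, Pi.smul_apply, h4, smul_eq_mul, Pi.mul_apply]
      filter_upwards [h1, h2] with t h1 h2
      rw [h1, Finset.sum_apply]
      exact Finset.sum_congr rfl fun x hx => h2 x hx
    filter_upwards [Lp.coeFn_sub (((mulOp (scalarMul c (ContinuousLinearMap.id ℝ ℝ))).comp
      ((ContinuousLinearMap.fst ℝ _ _).comp weakPairs.subtypeL)) p)
      (∑ x ∈ s, x p • testLp (c.continuous.mul (φ x).continuous) (hcφ x)), hsum,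
      coeFn_mulOp (scalarMul c (ContinuousLinearMap.id ℝ ℝ)) p.1.1, evalFunctional_ae_eq p,
      coeFn_testLp c.continuous hc] with t h1 h2 h3 h4 h5
    rw [h1, Pi.sub_apply, h2, h5]
    change ‖mulOp (scalarMul c (ContinuousLinearMap.id ℝ ℝ)) p.1.1 t - _‖ ≤ _
    rw [h3, h4, scalarMul_apply]
    have h6 : (c t • ContinuousLinearMap.id ℝ ℝ) (evalFunctional t p) -
        ∑ x ∈ s, x p * (c t * φ x t) =
        c t * ((evalFunctional t - ∑ x ∈ s, φ x t • x) p) := by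
      rw [sub_apply, mul_sub, smul_apply, smul_eq_mul]
      congr 1
      simp only [sum_apply, smul_apply, smul_eq_mul, Finset.mul_sum]
      exact Finset.sum_congr rfl fun x _ => by ring
    rw [h6, norm_mul, mul_comm]
    by_cases ht : t ∈ tsupport c
    · gcongr
      exact ContinuousLinearMap.le_of_opNorm_le _ (hφ t ht) _
    · rw [image_eq_zero_of_notMem_tsupport ht, norm_zero, mul_zero, mul_zero]
  refine key.trans ?_
  have : ε / (‖γ‖ + 1) * ‖p‖ * ‖γ‖ = (ε * ‖p‖) * (‖γ‖ / (‖γ‖ + 1)) := by ring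
  rw [this]
  refine mul_le_of_le_one_right (by positivity) ?_
  rw [div_le_one (by positivity)]
  linarith

end Rellich

/-! ## The space of paths and the operator `d/dt + A` -/

section PathSpace

variable {W H : Type*} [NormedAddCommGroup W] [InnerProductSpace ℝ W] [NormedAddCommGroup H]
  [InnerProductSpace ℝ H]

theorem mulOp_smul (c : ℝ) (B : ℝ →ᵇ (W →L[ℝ] H)) : mulOp (c • B) = c • mulOp B := by
  ext1 f
  refine Lp.ext ?_
  rw [smul_apply]
  filter_upwards [coeFn_mulOp (c • B) f, coeFn_mulOp B f, Lp.coeFn_smul c (mulOp B f)]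
    with t h1 h2 h3
  rw [h1, h3, Pi.smul_apply, h2]
  rfl

/-- A bounded additive map of real normed spaces is linear. -/
def clmOfAdditive {V X : Type*} [NormedAddCommGroup V] [NormedSpace ℝ V] [NormedAddCommGroup X]
    [NormedSpace ℝ X] (f : V → X) (hadd : ∀ x y, f (x + y) = f x + f y)
    (hf : ∀ x, ‖f x‖ ≤ ‖x‖) : V →L[ℝ] X :=
  (AddMonoidHom.mk' f hadd).toRealLinearMap
    (AddMonoidHomClass.continuous_of_bound _ 1 fun x => by rw [one_mul]; exact hf x)

theorem continuous_add_clm_comp {V X Y Z : Type*} [NormedAddCommGroup V] [NormedSpace ℝ V]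
    [NormedAddCommGroup X] [NormedSpace ℝ X] [NormedAddCommGroup Y] [NormedSpace ℝ Y]
    [NormedAddCommGroup Z] [NormedSpace ℝ Z] (c : X →L[ℝ] Z) (Φ : V →L[ℝ] (Y →L[ℝ] Z))
    (f : X →L[ℝ] Y) : Continuous fun a => c + (Φ a).comp f :=
  continuous_const.add (Φ.continuous.clm_comp continuous_const)

variable (W H) in
/-- Multiplication operators depend linearly and continuously on the multiplier. -/
def mulOpL : (ℝ →ᵇ (W →L[ℝ] H)) →L[ℝ]
    (Lp W 2 (volume : Measure ℝ) →L[ℝ] Lp H 2 (volume : Measure ℝ)) :=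
  clmOfAdditive (V := ℝ →ᵇ (W →L[ℝ] H))
    (X := Lp W 2 (volume : Measure ℝ) →L[ℝ] Lp H 2 (volume : Measure ℝ)) mulOp mulOp_add
    norm_mulOp_le

theorem mulOpL_apply (B : ℝ →ᵇ (W →L[ℝ] H)) : mulOpL W H B = mulOp B := rfl

/-- Pairs `(w, h)` where `w ∈ L²(ℝ, W)` and `h ∈ L²(ℝ, H)` is the weak derivative of `ι w`. -/
def pathSpace (ι : W →L[ℝ] H) :
    Submodule ℝ (Lp W 2 (volume : Measure ℝ) × Lp H 2 (volume : Measure ℝ)) where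
  carrier := {p | IsWeakDeriv (ι.compLpL 2 volume p.1) p.2}
  add_mem' {p q} hp hq := by
    have := IsWeakDeriv.add hp hq
    rwa [← map_add] at this
  zero_mem' := by
    change IsWeakDeriv (ι.compLpL 2 volume 0) 0
    rw [map_zero]
    exact isWeakDeriv_zero
  smul_mem' c p hp := by
    have := IsWeakDeriv.smul c hp
    rwa [← map_smul] at this

theorem isClosed_pathSpace [CompleteSpace H] (ι : W →L[ℝ] H) :
    IsClosed (pathSpace ι : Set (Lp W 2 (volume : Measure ℝ) × Lp H 2 (volume : Measure ℝ))) := by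
  refine isClosed_of_closure_subset fun p hp => ?_
  obtain ⟨u, hu, hup⟩ := mem_closure_iff_seq_limit.1 hp
  exact isWeakDeriv_of_tendsto (l := atTop) hu
    (((ι.compLpL 2 (volume : Measure ℝ)).continuous.tendsto _).comp
      ((continuous_fst.tendsto _).comp hup)) ((continuous_snd.tendsto _).comp hup)

/-- The space of pairs `(w, h)`, where `w ∈ L²(ℝ, W)` and `h ∈ L²(ℝ, H)` is the weak derivative
of `ι w`. -/
def PathSpace (ι : W →L[ℝ] H) : Type _ := pathSpace ι

instance (ι : W →L[ℝ] H) : NormedAddCommGroup (PathSpace ι) :=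
  inferInstanceAs (NormedAddCommGroup (pathSpace ι))

instance (ι : W →L[ℝ] H) : NormedSpace ℝ (PathSpace ι) :=
  inferInstanceAs (NormedSpace ℝ (pathSpace ι))

instance [CompleteSpace W] [CompleteSpace H] (ι : W →L[ℝ] H) : CompleteSpace (PathSpace ι) :=
  (isClosed_pathSpace ι).completeSpace_coe

/-- The component in `L²(ℝ, W)`. -/
def pathFst (ι : W →L[ℝ] H) : PathSpace ι →L[ℝ] Lp W 2 (volume : Measure ℝ) :=
  (ContinuousLinearMap.fst ℝ _ _).comp (pathSpace ι).subtypeL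

/-- The derivative. -/
def pathSnd (ι : W →L[ℝ] H) : PathSpace ι →L[ℝ] Lp H 2 (volume : Measure ℝ) :=
  (ContinuousLinearMap.snd ℝ _ _).comp (pathSpace ι).subtypeL

theorem isWeakDeriv_path {ι : W →L[ℝ] H} (p : PathSpace ι) :
    IsWeakDeriv (ι.compLpL 2 volume (pathFst ι p)) (pathSnd ι p) := p.2

/-- A path from its components. -/
def pathMk {ι : W →L[ℝ] H} {w : Lp W 2 (volume : Measure ℝ)} {h : Lp H 2 (volume : Measure ℝ)}
    (hw : IsWeakDeriv (ι.compLpL 2 volume w) h) : PathSpace ι := ⟨(w, h), hw⟩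

theorem pathFst_mk {ι : W →L[ℝ] H} {w : Lp W 2 (volume : Measure ℝ)}
    {h : Lp H 2 (volume : Measure ℝ)} (hw : IsWeakDeriv (ι.compLpL 2 volume w) h) :
    pathFst ι (pathMk hw) = w := rfl

theorem pathSnd_mk {ι : W →L[ℝ] H} {w : Lp W 2 (volume : Measure ℝ)}
    {h : Lp H 2 (volume : Measure ℝ)} (hw : IsWeakDeriv (ι.compLpL 2 volume w) h) :
    pathSnd ι (pathMk hw) = h := rfl

theorem PathSpace.ext {ι : W →L[ℝ] H} {p q : PathSpace ι} (h1 : pathFst ι p = pathFst ι q)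
    (h2 : pathSnd ι p = pathSnd ι q) : p = q := Subtype.ext (Prod.ext h1 h2)

theorem norm_path {ι : W →L[ℝ] H} (p : PathSpace ι) :
    ‖p‖ = max ‖pathFst ι p‖ ‖pathSnd ι p‖ := rfl

/-- The operator `ξ ↦ dξ/dt + A ξ`. -/
def pathOp (ι : W →L[ℝ] H) (A : ℝ →ᵇ (W →L[ℝ] H)) :
    PathSpace ι →L[ℝ] Lp H 2 (volume : Measure ℝ) :=
  pathSnd ι + (mulOp A).comp (pathFst ι)

theorem pathOp_apply (ι : W →L[ℝ] H) (A : ℝ →ᵇ (W →L[ℝ] H)) (p : PathSpace ι) :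
    pathOp ι A p = pathSnd ι p + mulOp A (pathFst ι p) := rfl

theorem continuous_pathOp (ι : W →L[ℝ] H) : Continuous (pathOp ι) := by
  have h := continuous_add_clm_comp (V := ℝ →ᵇ (W →L[ℝ] H)) (X := PathSpace ι)
    (Y := Lp W 2 (volume : Measure ℝ)) (Z := Lp H 2 (volume : Measure ℝ)) (pathSnd ι)
    (mulOpL W H) (pathFst ι)
  have e : (fun A => pathSnd ι + (mulOpL W H A).comp (pathFst ι)) = pathOp ι := by
    funext A
    rw [mulOpL_apply, pathOp]
  rw [← e]
  exact h

variable [CompleteSpace H]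

/-- Pairing with a vector. -/
def pathPairing (ι : W →L[ℝ] H) (x : H) : PathSpace ι →L[ℝ] weakPairs :=
  (((((innerSL ℝ x).comp ι).compLpL 2 volume).comp (pathFst ι)).prod
    (((innerSL ℝ x).compLpL 2 volume).comp (pathSnd ι))).codRestrict weakPairs (fun p => by
      have h := (isWeakDeriv_path p).compLpL (innerSL ℝ x)
      change IsWeakDeriv _ _ 
      convert h using 1
      swap; · rfl
      refine Lp.ext ?_
      filter_upwards [((innerSL ℝ x).comp ι).coeFn_compLpL (p := 2) (pathFst ι p),
        ι.coeFn_compLpL (p := 2) (pathFst ι p),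
        (innerSL ℝ x).coeFn_compLpL (p := 2) (ι.compLpL 2 volume (pathFst ι p))] with t h1 h2 h3
      rw [h3, h2]
      exact h1)

/-- The operators `L : W → H` for which multiplication by `c • L` is a compact operator for all
compactly supported functions `c`. -/
def locallyCompactMul (ι : W →L[ℝ] H) : Submodule ℝ (W →L[ℝ] H) where
  carrier := {L | ∀ c : ℝ →ᵇ ℝ, HasCompactSupport c →
    IsCompactOperator ((mulOp (scalarMul c L)).comp (pathFst ι))}
  zero_mem' c _ := by
    have : scalarMul c (0 : W →L[ℝ] H) = 0 := by
      ext t w; simp [scalarMul_apply]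
    rw [this, ← mulOpL_apply, map_zero (mulOpL W H), ContinuousLinearMap.zero_comp]
    exact isCompactOperator_zero
  add_mem' {L L'} hL hL' c hc := by
    have : scalarMul c (L + L') = scalarMul c L + scalarMul c L' := by
      ext t w; simp [scalarMul_apply]
    rw [this, mulOp_add, ContinuousLinearMap.add_comp]
    exact (hL c hc).add (hL' c hc)
  smul_mem' a L hL c hc := by
    have : scalarMul c (a • L) = a • scalarMul c L := by
      ext t w; simp [scalarMul_apply, smul_comm a]
    rw [this, mulOp_smul, ContinuousLinearMap.smul_comp]
    exact (hL c hc).smul a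

/-- Norm limits of compact operators are compact, and the multiplication operator depends
continuously on L. This allows the class to be enlarged in three stages: functionals coming from H,
all functionals on W, and finally all compact operators. -/
theorem isClosed_locallyCompactMul (ι : W →L[ℝ] H) :
    IsClosed (locallyCompactMul ι : Set (W →L[ℝ] H)) := by
  refine isClosed_of_closure_subset fun L hL c hc => ?_
  refine isCompactOperator_of_forall_approx fun ε hε => ?_
  obtain ⟨L', hL', hd⟩ := Metric.mem_closure_iff.1 hL (ε / (‖c‖ * ‖pathFst ι‖ + 1))
    (by positivity)
  refine ⟨_, hL' c hc, ?_⟩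
  have : scalarMul c L - scalarMul c L' = scalarMul c (L - L') := by
    ext t w; simp [scalarMul_apply, smul_sub]
  rw [← ContinuousLinearMap.sub_comp, ← mulOp_sub, this]
  have h1 : ‖scalarMul c (L - L')‖ ≤ ‖c‖ * ‖L - L'‖ :=
    BoundedContinuousFunction.norm_ofNormedAddCommGroup_le _ (by positivity) _
  rw [dist_eq_norm] at hd
  calc _ ≤ ‖mulOp (scalarMul c (L - L'))‖ * ‖pathFst ι‖ := ContinuousLinearMap.opNorm_comp_le _ _
    _ ≤ (‖c‖ * ‖L - L'‖) * ‖pathFst ι‖ := by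
        gcongr; exact (norm_mulOp_le _).trans h1
    _ ≤ (‖c‖ * (ε / (‖c‖ * ‖pathFst ι‖ + 1))) * ‖pathFst ι‖ := by gcongr
    _ = ε * ((‖c‖ * ‖pathFst ι‖) / (‖c‖ * ‖pathFst ι‖ + 1)) := by ring
    _ ≤ ε := by
        refine mul_le_of_le_one_right hε.le ?_
        rw [div_le_one (by positivity)]
        linarith

/-- The operator w ↦ ⟪x, ιw⟫ y factors through the scalar function t ↦ ⟪x, ιw(t)⟫. This has a weak
derivative in L² because ιw has one, so Rellich's theorem applies. -/
theorem smulRight_comp_mem_locallyCompactMul (ι : W →L[ℝ] H) (x y : H) :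
    ((innerSL ℝ x).comp ι).smulRight y ∈ locallyCompactMul ι := by
  intro c hc
  have h := ((isCompactOperator_scalarMul_fst hc).comp_clm (pathPairing ι x)).clm_comp
    ((ContinuousLinearMap.toSpanSingleton ℝ y).compLpL 2 (volume : Measure ℝ))
  refine cast (congrArg IsCompactOperator (funext fun p => ?_)) h
  refine Lp.ext (EventuallyEq.symm ?_)
  change mulOp (scalarMul c (((innerSL ℝ x).comp ι).smulRight y)) (pathFst ι p) =ᵐ[volume]
    (ContinuousLinearMap.toSpanSingleton ℝ y).compLpL 2 volume
      (mulOp (scalarMul c (ContinuousLinearMap.id ℝ ℝ))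
        (((innerSL ℝ x).comp ι).compLpL 2 volume (pathFst ι p)))
  filter_upwards [coeFn_mulOp (scalarMul c (((innerSL ℝ x).comp ι).smulRight y)) (pathFst ι p),
    (ContinuousLinearMap.toSpanSingleton ℝ y).coeFn_compLpL (p := 2)
      (mulOp (scalarMul c (ContinuousLinearMap.id ℝ ℝ))
        (((innerSL ℝ x).comp ι).compLpL 2 volume (pathFst ι p))),
    coeFn_mulOp (scalarMul c (ContinuousLinearMap.id ℝ ℝ))
        (((innerSL ℝ x).comp ι).compLpL 2 volume (pathFst ι p)),
    ((innerSL ℝ x).comp ι).coeFn_compLpL (p := 2) (pathFst ι p)] with t h1 h2 h3 h4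
  rw [h1, h2, h3, h4, scalarMul_apply, scalarMul_apply]
  simp [smul_smul]

/-- The functionals ⟪x, ι ·⟫ on W are represented by the range of the adjoint of ι, which is dense
because ι is injective. The general case follows by closedness. -/
theorem smulRight_mem_locallyCompactMul [CompleteSpace W] {ι : W →L[ℝ] H}
    (hι : Function.Injective ι) (w : W) (y : H) :
    (innerSL ℝ w).smulRight y ∈ locallyCompactMul ι := by
  let F : W →L[ℝ] (W →L[ℝ] H) :=
    ((ContinuousLinearMap.smulRightL ℝ W H).flip y).comp (innerSL ℝ)
  have hF : ∀ w, F w = (innerSL ℝ w).smulRight y := fun w => rfl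
  let S : Submodule ℝ W := (locallyCompactMul ι).comap F.toLinearMap
  have hS : IsClosed (S : Set W) := (isClosed_locallyCompactMul ι).preimage F.continuous
  have hr : (ContinuousLinearMap.adjoint ι).range ≤ S := by
    rintro _ ⟨x, rfl⟩
    have h := smulRight_comp_mem_locallyCompactMul ι x y
    change F (ContinuousLinearMap.adjoint ι x) ∈ locallyCompactMul ι
    convert h using 1
    ext w
    simp [hF, ContinuousLinearMap.adjoint_inner_left]
  have hd : (ContinuousLinearMap.adjoint ι).rangeᗮ = ⊥ := by
    rw [ContinuousLinearMap.orthogonal_range, ContinuousLinearMap.adjoint_adjoint]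
    exact LinearMap.ker_eq_bot.2 hι
  have ht : (ContinuousLinearMap.adjoint ι).range.topologicalClosure = ⊤ :=
    (Submodule.topologicalClosure_eq_top_iff).2 hd
  have : w ∈ (ContinuousLinearMap.adjoint ι).range.topologicalClosure := by rw [ht]; trivial
  exact (Submodule.topologicalClosure_minimal _ hr hS) this

/-- Composing L with the projection to a finite-dimensional V with orthonormal basis (b_i) gives the
sum of ⟪L*b_i, ·⟫ b_i. These finite rank operators approximate L because L is compact. -/
theorem mem_locallyCompactMul_of_isCompactOperator [CompleteSpace W] {ι : W →L[ℝ] H}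
    (hι : Function.Injective ι) {L : W →L[ℝ] H} (hL : IsCompactOperator L) :
    L ∈ locallyCompactMul ι := by
  change L ∈ (locallyCompactMul ι : Set (W →L[ℝ] H))
  rw [← (isClosed_locallyCompactMul ι).closure_eq, Metric.mem_closure_iff]
  intro ε hε
  obtain ⟨V, hV, hVL⟩ := exists_finiteDimensional_norm_sub_le hL (half_pos hε)
  refine ⟨V.starProjection.comp L, ?_, by rw [dist_eq_norm]; linarith⟩
  rw [(stdOrthonormalBasis ℝ V).starProjection_eq_sum_rankOne]
  set b := stdOrthonormalBasis ℝ V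
  have : (∑ i, InnerProductSpace.rankOne ℝ (b i : H) (b i : H)).comp L =
      ∑ i, (innerSL ℝ (ContinuousLinearMap.adjoint L (b i))).smulRight (b i : H) := by
    ext w
    simp [sum_apply, ContinuousLinearMap.adjoint_inner_left]
  rw [this]
  exact Submodule.sum_mem _ fun i _ => smulRight_mem_locallyCompactMul hι _ _

/-- A compactly supported continuous cutoff function. -/
def cutoff (R : ℝ) : ℝ →ᵇ ℝ :=
  BoundedContinuousFunction.ofNormedAddCommGroup (fun t => max 0 (min 1 (R + 1 - |t|)))
    (by fun_prop) 1 (fun t => by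
      rw [Real.norm_of_nonneg (le_max_left _ _)]
      exact max_le zero_le_one (min_le_left _ _))

theorem cutoff_nonneg (R t : ℝ) : 0 ≤ cutoff R t := le_max_left _ _

theorem cutoff_le_one (R t : ℝ) : cutoff R t ≤ 1 := max_le zero_le_one (min_le_left _ _)

theorem cutoff_eq_one {R t : ℝ} (h : |t| ≤ R) : cutoff R t = 1 := by
  change max 0 (min 1 (R + 1 - |t|)) = 1
  rw [min_eq_left (by linarith), max_eq_right zero_le_one]

theorem cutoff_eq_zero {R t : ℝ} (h : R + 1 ≤ |t|) : cutoff R t = 0 :=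
  max_eq_left ((min_le_right _ _).trans (by linarith))

theorem hasCompactSupport_cutoff (R : ℝ) : HasCompactSupport (cutoff R) := by
  refine HasCompactSupport.intro (isCompact_Icc (a := -(R + 1)) (b := R + 1)) fun t ht => ?_
  refine cutoff_eq_zero ?_
  by_contra! h
  exact ht (abs_le.1 h.le)

/-- Multiplication by a family of compact operators that tends to zero at infinity is compact. -/
theorem isCompactOperator_mulOp_comp_pathFst [CompleteSpace W] {ι : W →L[ℝ] H}
    (hι : Function.Injective ι) {N : ℝ →ᵇ (W →L[ℝ] H)} (hN : ∀ t, IsCompactOperator (N t))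
    (h0 : Tendsto N (cocompact ℝ) (𝓝 0)) :
    IsCompactOperator ((mulOp N).comp (pathFst ι)) := by
  refine isCompactOperator_of_forall_approx fun ε hε => ?_
  set δ : ℝ := ε / (‖pathFst ι‖ + 1)
  have hδ : 0 < δ := by positivity
  obtain ⟨R, hR⟩ : ∃ R : ℝ, ∀ t, R < |t| → ‖N t‖ ≤ δ := by
    have h1 := (tendsto_zero_iff_norm_tendsto_zero.1 h0).eventually_le_const hδ
    rw [← Metric.cobounded_eq_cocompact, ← comap_norm_atTop, eventually_comap] at h1
    obtain ⟨R, hR⟩ := eventually_atTop.1 h1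
    exact ⟨R, fun t ht => hR _ ht.le t rfl⟩
  have hK : IsCompact (N '' Set.Icc (-(R + 1)) (R + 1)) := isCompact_Icc.image N.continuous
  obtain ⟨s, φ, hs, hφ⟩ := exists_partition_approx (V := W →L[ℝ] H) N.continuous
    (K := Set.Icc (-(R + 1)) (R + 1)) (by exact hK.totallyBounded) hδ
  -- Beyond radius R the values of N are at most δ; up to radius R + 1, which contains the support
  -- of the cutoff, N is within δ of a finite sum with coefficients among its own compact values.
  let S : ℝ →ᵇ (W →L[ℝ] H) := ∑ L ∈ s, scalarMul (cutoff R * φ L) L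
  refine ⟨(mulOp S).comp (pathFst ι), ?_, ?_⟩
  · have : (mulOp S).comp (pathFst ι) =
        ∑ L ∈ s, (mulOp (scalarMul (cutoff R * φ L) L)).comp (pathFst ι) := by
      rw [← mulOpL_apply, map_sum (mulOpL W H), ContinuousLinearMap.finsetSum_comp]
      rfl
    rw [this]
    refine isCompactOperator_finset_sum _ _ fun L hL => ?_
    obtain ⟨t, -, rfl⟩ := hs L hL
    exact mem_locallyCompactMul_of_isCompactOperator hι (hN t) _
      ((hasCompactSupport_cutoff R).mul_right)
  · have hS : ‖N - S‖ ≤ δ := by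
      rw [BoundedContinuousFunction.norm_le hδ.le]
      intro t
      -- A convex combination: the first vector has norm at most δ wherever its weight is nonzero,
      -- and so has the second.
      have h1 : (N - S) t = (1 - cutoff R t) • N t +
          cutoff R t • (N t - ∑ L ∈ s, φ L t • L) := by
        have : S t = cutoff R t • ∑ L ∈ s, φ L t • L := by
          simp only [S, BoundedContinuousFunction.coe_sum, Finset.sum_apply, scalarMul_apply,
            BoundedContinuousFunction.coe_mul, Pi.mul_apply, Finset.smul_sum, smul_smul]
        rw [BoundedContinuousFunction.coe_sub, Pi.sub_apply, this, sub_smul, one_smul, smul_sub]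
        abel
      have h2 : ‖(1 - cutoff R t) • N t‖ ≤ (1 - cutoff R t) * δ := by
        rw [norm_smul, Real.norm_of_nonneg (sub_nonneg.2 (cutoff_le_one R t))]
        rcases le_or_gt |t| R with h | h
        · rw [cutoff_eq_one h, sub_self, zero_mul, zero_mul]
        · exact mul_le_mul_of_nonneg_left (hR t h) (sub_nonneg.2 (cutoff_le_one R t))
      have h3 : ‖cutoff R t • (N t - ∑ L ∈ s, φ L t • L)‖ ≤ cutoff R t * δ := by
        rw [norm_smul, Real.norm_of_nonneg (cutoff_nonneg R t)]
        rcases le_or_gt |t| (R + 1) with h | h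
        · exact mul_le_mul_of_nonneg_left (hφ t (abs_le.1 h)) (cutoff_nonneg R t)
        · rw [cutoff_eq_zero h.le, zero_mul, zero_mul]
      rw [h1]
      exact (norm_add_le_of_le h2 h3).trans (by linarith)
    rw [← ContinuousLinearMap.sub_comp, ← mulOp_sub]
    calc _ ≤ ‖mulOp (N - S)‖ * ‖pathFst ι‖ := ContinuousLinearMap.opNorm_comp_le _ _
      _ ≤ δ * ‖pathFst ι‖ := by gcongr; exact (norm_mulOp_le _).trans hS
      _ = ε * (‖pathFst ι‖ / (‖pathFst ι‖ + 1)) := by simp only [δ]; ring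
      _ ≤ ε := by
        refine mul_le_of_le_one_right hε.le ?_
        rw [div_le_one (by positivity)]
        linarith

end PathSpace

/-! ## The Fredholm property of `d/dt + A` -/

section Gluing

/-- Gluing approximate inverses at the two ends into a parametrix. -/
theorem hasFiniteIndex_of_gluing {X Y : Type*} [NormedAddCommGroup X] [NormedSpace ℝ X]
    [CompleteSpace X] [NormedAddCommGroup Y] [InnerProductSpace ℝ Y] [CompleteSpace Y]
    {D : X →L[ℝ] Y} {D' : Bool → X →L[ℝ] Y} {R : Bool → Y →L[ℝ] X} {M : Bool → X →L[ℝ] X}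
    {m : Bool → Y →L[ℝ] Y} {S N Q : Bool → X →L[ℝ] Y}
    (hDR : ∀ a, (D' a).comp (R a) = ContinuousLinearMap.id ℝ Y)
    (hRD : ∀ a, (R a).comp (D' a) = ContinuousLinearMap.id ℝ X)
    (hm : m true + m false = ContinuousLinearMap.id ℝ Y)
    (hM : M true + M false = ContinuousLinearMap.id ℝ X)
    (hDM : ∀ a, (D' a).comp (M a) = (m a).comp (D' a) + S a)
    (hD : ∀ a, D = D' a + Q a) (hQM : ∀ a, (Q a).comp (M a) = N a)
    (hmQ : ∀ a, (m a).comp (Q a) = N a) (hN : ∀ a, IsCompactOperator (N a)) {ε : ℝ}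
    (hS : ∀ a, ‖S a‖ ≤ ε) (h1 : ε * (‖R true‖ + ‖R false‖) < 1)
    (h2 : ε * (‖R true‖ * ‖R true‖ * ‖Q true‖ + ‖R false‖ * ‖R false‖ * ‖Q false‖) < 1) :
    HasFiniteIndex (D : X →ₗ[ℝ] Y) := by
  -- The parametrix inverts at each end and then cuts off. Moving D past the cutoff M_a leaves the
  -- commutator S_a, which is small, and the product of cutoff and perturbation Q_a, which is the
  -- compact N_a.
  let P : Y →L[ℝ] X := (M true).comp (R true) + (M false).comp (R false)
  have dr : ∀ a y, D' a (R a y) = y := fun a y => DFunLike.congr_fun (hDR a) y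
  have rd : ∀ a x, R a (D' a x) = x := fun a x => DFunLike.congr_fun (hRD a) x
  have mm : ∀ y, m true y + m false y = y := fun y => DFunLike.congr_fun hm y
  have MM : ∀ y, M true y + M false y = y := fun y => DFunLike.congr_fun hM y
  have dM : ∀ a x, D' a (M a x) = m a (D' a x) + S a x := fun a x =>
    DFunLike.congr_fun (hDM a) x
  have d : ∀ a x, D x = D' a x + Q a x := fun a x => DFunLike.congr_fun (hD a) x
  have qM : ∀ a x, Q a (M a x) = N a x := fun a x => DFunLike.congr_fun (hQM a) x
  have mQ : ∀ a x, m a (Q a x) = N a x := fun a x => DFunLike.congr_fun (hmQ a) x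
  have e1 : D.comp P = ContinuousLinearMap.id ℝ Y +
      ((N true).comp (R true) + (N false).comp (R false)) +
      ((S true).comp (R true) + (S false).comp (R false)) := by
    ext y
    have h : ∀ a, D (M a (R a y)) = m a y + S a (R a y) + N a (R a y) := fun a => by
      rw [d a, dM, qM, dr]
    simp only [P, ContinuousLinearMap.comp_apply, add_apply, map_add, h,
      ContinuousLinearMap.id_apply]
    refine sub_eq_zero.1 (Eq.trans ?_ (sub_eq_zero.2 (mm y)))
    abel
  -- Cutting off before or after the inversion differs only by R S R. This makes P a left parametrix
  -- as well, at the price of the additional factor RQ in the error.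
  have MR : ∀ a y, M a (R a y) = R a (m a y) + R a (S a (R a y)) := fun a y => by
    rw [← map_add, ← rd a (M a (R a y)), dM, dr]
  have e2 : P.comp D = ContinuousLinearMap.id ℝ X +
      ((R true).comp (N true) + (R false).comp (N false)) +
      ((R true).comp ((S true).comp ((R true).comp (Q true))) +
        (R false).comp ((S false).comp ((R false).comp (Q false)))) := by
    ext x
    have h : ∀ a, M a (R a (D x)) = M a x + R a (N a x) + R a (S a (R a (Q a x))) := fun a => by
      rw [d a, map_add, map_add, rd, MR, mQ]
      abel
    simp only [P, ContinuousLinearMap.comp_apply, add_apply, h, ContinuousLinearMap.id_apply]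
    refine sub_eq_zero.1 (Eq.trans ?_ (sub_eq_zero.2 (MM x)))
    abel
  have b1 : ∀ a, ‖(S a).comp (R a)‖ ≤ ε * ‖R a‖ := fun a =>
    (ContinuousLinearMap.opNorm_comp_le _ _).trans (by gcongr; exact hS a)
  have b2 : ∀ a, ‖(R a).comp ((S a).comp ((R a).comp (Q a)))‖ ≤
      ‖R a‖ * (ε * (‖R a‖ * ‖Q a‖)) := fun a => by
    refine (ContinuousLinearMap.opNorm_comp_le _ _).trans ?_
    gcongr
    refine (ContinuousLinearMap.opNorm_comp_le _ _).trans ?_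
    have := (norm_nonneg _).trans (hS a)
    gcongr
    · exact hS a
    · exact ContinuousLinearMap.opNorm_comp_le _ _
  constructor
  · refine finiteDimensional_ker_of_parametrix e2
      (((hN true).clm_comp (R true)).add ((hN false).clm_comp (R false)))
      ((norm_add_le_of_le (b2 true) (b2 false)).trans_lt (lt_of_eq_of_lt (by ring) h2))
  · refine finiteDimensional_coker_of_parametrix e1
      (((hN true).comp_clm (R true)).add ((hN false).comp_clm (R false)))
      ((norm_add_le_of_le (b1 true) (b1 false)).trans_lt (lt_of_eq_of_lt (by ring) h1))

end Gluing

/-! ### Constant symmetric invertible coefficients -/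

section Constant

variable {W H : Type*} [NormedAddCommGroup W] [InnerProductSpace ℝ W] [NormedAddCommGroup H]
  [InnerProductSpace ℝ H]

theorem inner_compLpL_toSpanSingleton (x : H) {φ : ℝ → ℝ} (hφ : Continuous φ)
    (hc : HasCompactSupport φ) [CompleteSpace H] (f : Lp H 2 (volume : Measure ℝ)) :
    ⟪f, (ContinuousLinearMap.toSpanSingleton ℝ x).compLpL 2 volume (testLp hφ hc)⟫_ℝ =
      ⟪testPairing hφ hc f, x⟫_ℝ := by
  rw [testPairing_apply, real_inner_comm x, ← integral_inner (integrable_smul_of_test hφ hc f),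
    L2.inner_def]
  refine integral_congr_ae ?_
  filter_upwards [(ContinuousLinearMap.toSpanSingleton ℝ x).coeFn_compLpL (p := 2)
    (testLp hφ hc), coeFn_testLp hφ hc] with t h1 h2
  rw [h1, h2, ContinuousLinearMap.toSpanSingleton_apply, inner_smul_right, inner_smul_right,
    real_inner_comm]

theorem compLpL_toSpanSingleton (L : W →L[ℝ] H) (x : W) (f : Lp ℝ 2 (volume : Measure ℝ)) :
    L.compLpL 2 volume ((ContinuousLinearMap.toSpanSingleton ℝ x).compLpL 2 volume f) =
      (ContinuousLinearMap.toSpanSingleton ℝ (L x)).compLpL 2 volume f := by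
  refine Lp.ext ?_
  filter_upwards [L.coeFn_compLpL (p := 2)
      ((ContinuousLinearMap.toSpanSingleton ℝ x).compLpL 2 volume f),
    (ContinuousLinearMap.toSpanSingleton ℝ x).coeFn_compLpL (p := 2) f,
    (ContinuousLinearMap.toSpanSingleton ℝ (L x)).coeFn_compLpL (p := 2) f] with t h1 h2 h3
  rw [h1, h2, h3]
  simp

theorem inner_compLpL_comm {ι C : W →L[ℝ] H} (h : ∀ x y, ⟪C x, ι y⟫_ℝ = ⟪ι x, C y⟫_ℝ)
    (f g : Lp W 2 (volume : Measure ℝ)) :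
    ⟪C.compLpL 2 volume f, ι.compLpL 2 volume g⟫_ℝ =
      ⟪ι.compLpL 2 volume f, C.compLpL 2 volume g⟫_ℝ := by
  rw [L2.inner_def, L2.inner_def]
  refine integral_congr_ae ?_
  filter_upwards [C.coeFn_compLpL (p := 2) f, C.coeFn_compLpL (p := 2) g,
    ι.coeFn_compLpL (p := 2) f, ι.coeFn_compLpL (p := 2) g] with t h1 h2 h3 h4
  rw [h1, h2, h3, h4, h]

theorem pathOp_const_apply (ι C : W →L[ℝ] H) (p : PathSpace ι) :
    pathOp ι (BoundedContinuousFunction.const ℝ C) p =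
      pathSnd ι p + C.compLpL 2 volume (pathFst ι p) := by
  rw [pathOp_apply, mulOp_const]

theorem compLpL_inverse {C : W →L[ℝ] H} (hC : C.IsInvertible)
    (f : Lp W 2 (volume : Measure ℝ)) :
    C.inverse.compLpL 2 volume (C.compLpL 2 volume f) = f := by
  refine Lp.ext ?_
  filter_upwards [C.inverse.coeFn_compLpL (p := 2) (C.compLpL 2 volume f),
    C.coeFn_compLpL (p := 2) f] with t h1 h2
  rw [h1, h2, hC.inverse_apply_self]

theorem compLpL_inverse' {C : W →L[ℝ] H} (hC : C.IsInvertible)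
    (f : Lp H 2 (volume : Measure ℝ)) :
    C.compLpL 2 volume (C.inverse.compLpL 2 volume f) = f := by
  refine Lp.ext ?_
  filter_upwards [C.coeFn_compLpL (p := 2) (C.inverse.compLpL 2 volume f),
    C.inverse.coeFn_compLpL (p := 2) f] with t h1 h2
  rw [h1, h2, hC.self_apply_inverse]

variable [CompleteSpace H]

/-- Formally this is half the integral of d/dt ⟪ιw, Cw⟫. Rigorously, s ↦ ⟪translate s (ιw), Cw⟫ is
even, since C is symmetric and translations are isometric, and its derivative at 0 is the inner
product in question. -/
theorem inner_pathSnd_compLpL {ι C : W →L[ℝ] H} (h : ∀ x y, ⟪C x, ι y⟫_ℝ = ⟪ι x, C y⟫_ℝ)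
    (p : PathSpace ι) : ⟪pathSnd ι p, C.compLpL 2 volume (pathFst ι p)⟫_ℝ = 0 := by
  set w := pathFst ι p
  let g : ℝ → ℝ := fun s => ⟪translate s (ι.compLpL 2 volume w), C.compLpL 2 volume w⟫_ℝ
  have hg : HasDerivAt g ⟪pathSnd ι p, C.compLpL 2 volume w⟫_ℝ 0 := by
    have h1 := (isWeakDeriv_iff_hasDerivAt.1 (isWeakDeriv_path p)).inner ℝ
      (hasDerivAt_const (0 : ℝ) (C.compLpL 2 volume w))
    simpa [g] using h1
  have hsymm : ∀ s, g (-s) = g s := fun s => by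
    change ⟪translate (-s) (ι.compLpL 2 volume w), C.compLpL 2 volume w⟫_ℝ = _
    rw [inner_translate, neg_neg, translate_compLpL, ← inner_compLpL_comm h, ← translate_compLpL,
      real_inner_comm]
  have h2 : HasDerivAt g (-⟪pathSnd ι p, C.compLpL 2 volume w⟫_ℝ) 0 := by
    have h3 := HasDerivAt.scomp (0 : ℝ) (by rwa [neg_zero]) (hasDerivAt_neg (0 : ℝ)) (g₁ := g)
    rw [neg_one_smul] at h3
    exact h3.congr_of_eventuallyEq (Eventually.of_forall fun s => (hsymm s).symm)
  have := hg.unique h2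
  linarith

theorem norm_pathOp_const_sq {ι C : W →L[ℝ] H} (h : ∀ x y, ⟪C x, ι y⟫_ℝ = ⟪ι x, C y⟫_ℝ)
    (p : PathSpace ι) :
    ‖pathOp ι (BoundedContinuousFunction.const ℝ C) p‖ ^ 2 =
      ‖pathSnd ι p‖ ^ 2 + ‖C.compLpL 2 volume (pathFst ι p)‖ ^ 2 := by
  rw [pathOp_const_apply, norm_add_sq_real, inner_pathSnd_compLpL h]
  ring

/-- The path `φ ⊗ w`. -/
def testPath (ι : W →L[ℝ] H) {φ : ℝ → ℝ} (hφ : ContDiff ℝ ∞ φ) (hc : HasCompactSupport φ)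
    (w : W) : PathSpace ι :=
  pathMk (w := (ContinuousLinearMap.toSpanSingleton ℝ w).compLpL 2 volume
      (testLp hφ.continuous hc))
    (h := (ContinuousLinearMap.toSpanSingleton ℝ (ι w)).compLpL 2 volume
      (testLp (hφ.continuous_deriv (by simp)) hc.deriv))
    (by rw [compLpL_toSpanSingleton]; exact (isWeakDeriv_testLp hφ hc).compLpL _)

/-- Orthogonality to the range is the adjoint equation in weak form. Testing with φ ⊗ C⁻¹x and using
that ιC⁻¹ is symmetric on H turns it into (ιC⁻¹η)' = η, so (C⁻¹η, η) is an element of the path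
space. -/
theorem isWeakDeriv_of_orthogonal {ι C : W →L[ℝ] H}
    (h : ∀ x y, ⟪C x, ι y⟫_ℝ = ⟪ι x, C y⟫_ℝ) (hC : C.IsInvertible)
    {η : Lp H 2 (volume : Measure ℝ)}
    (hη : ∀ p, ⟪η, pathOp ι (BoundedContinuousFunction.const ℝ C) p⟫_ℝ = 0) :
    IsWeakDeriv (ι.compLpL 2 volume (C.inverse.compLpL 2 volume η)) η := by
  have hS : ∀ x y, ⟪ι (C.inverse x), y⟫_ℝ = ⟪x, ι (C.inverse y)⟫_ℝ := fun x y => by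
    have := h (C.inverse x) (C.inverse y)
    rw [hC.self_apply_inverse, hC.self_apply_inverse] at this
    exact this.symm
  rw [isWeakDeriv_iff]
  intro φ hφ hc
  have hdφ : Continuous (deriv φ) := hφ.continuous_deriv (by simp)
  refine ext_inner_right ℝ fun x => ?_
  have h1 := hη (testPath ι hφ hc (C.inverse x))
  rw [pathOp_const_apply, testPath, pathFst_mk, pathSnd_mk, compLpL_toSpanSingleton,
    hC.self_apply_inverse, inner_add_right, inner_compLpL_toSpanSingleton,
    inner_compLpL_toSpanSingleton] at h1
  rw [← inner_compLpL_toSpanSingleton, inner_neg_left, ← eq_neg_iff_add_eq_zero.2 h1, ← 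
    inner_compLpL_toSpanSingleton, L2.inner_def, L2.inner_def]
  refine integral_congr_ae ?_
  filter_upwards [ι.coeFn_compLpL (p := 2) (C.inverse.compLpL 2 volume η),
    C.inverse.coeFn_compLpL (p := 2) η,
    (ContinuousLinearMap.toSpanSingleton ℝ x).coeFn_compLpL (p := 2) (testLp hdφ hc.deriv),
    (ContinuousLinearMap.toSpanSingleton ℝ (ι (C.inverse x))).coeFn_compLpL (p := 2)
      (testLp hdφ hc.deriv)] with t h1 h2 h3 h4
  rw [h1, h2, h3, h4]
  rw [ContinuousLinearMap.toSpanSingleton_apply, ContinuousLinearMap.toSpanSingleton_apply,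
    inner_smul_right, inner_smul_right, hS]

variable [CompleteSpace W]

/-- The identity `norm_pathOp_const_sq` bounds p by D p, which gives injectivity and closed range.
Surjectivity follows by excluding vectors orthogonal to the range. -/
theorem bijective_pathOp_const {ι C : W →L[ℝ] H} (h : ∀ x y, ⟪C x, ι y⟫_ℝ = ⟪ι x, C y⟫_ℝ)
    (hC : C.IsInvertible) :
    Function.Bijective (pathOp ι (BoundedContinuousFunction.const ℝ C)) := by
  set D := pathOp ι (BoundedContinuousFunction.const ℝ C)
  set c : ℝ := ‖C.inverse.compLpL 2 (volume : Measure ℝ)‖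
  have hb : ∀ p, ‖p‖ ≤ (1 + c) * ‖D p‖ := by
    intro p
    have h1 := norm_pathOp_const_sq h p
    have h2 : ‖pathSnd ι p‖ ≤ ‖D p‖ := abs_le_of_sq_le_sq' (by
      nlinarith [sq_nonneg (‖C.compLpL 2 (volume : Measure ℝ) (pathFst ι p)‖)]) (norm_nonneg _) |>.2
    have h3 : ‖C.compLpL 2 (volume : Measure ℝ) (pathFst ι p)‖ ≤ ‖D p‖ :=
      abs_le_of_sq_le_sq' (by nlinarith [sq_nonneg (‖pathSnd ι p‖)]) (norm_nonneg _) |>.2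
    have h4 : ‖pathFst ι p‖ ≤ c * ‖D p‖ := by
      calc ‖pathFst ι p‖ = ‖C.inverse.compLpL 2 volume (C.compLpL 2 volume (pathFst ι p))‖ := by
            rw [compLpL_inverse hC]
        _ ≤ c * ‖C.compLpL 2 (volume : Measure ℝ) (pathFst ι p)‖ :=
            ContinuousLinearMap.le_opNorm _ _
        _ ≤ c * ‖D p‖ := by gcongr
    rw [norm_path]
    have := norm_nonneg (D p)
    have hc : 0 ≤ c := by positivity
    refine max_le (h4.trans ?_) (h2.trans ?_) <;> nlinarith
  have hanti : AntilipschitzWith (Real.toNNReal (1 + c)) D := by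
    refine AddMonoidHomClass.antilipschitz_of_bound D fun p => ?_
    rw [Real.coe_toNNReal _ (by positivity)]
    exact hb p
  refine ⟨hanti.injective, ?_⟩
  have hcl : IsClosed (D.range : Set (Lp H 2 (volume : Measure ℝ))) :=
    hanti.isClosed_range D.uniformContinuous
  have : CompleteSpace D.range := hcl.completeSpace_coe
  refine LinearMap.range_eq_top.1 (?_ : D.range = ⊤)
  rw [← Submodule.orthogonal_eq_bot_iff, Submodule.eq_bot_iff]
  intro η hη
  have hη' : ∀ p, ⟪η, D p⟫_ℝ = 0 := fun p => by
    rw [real_inner_comm]; exact hη _ ⟨p, rfl⟩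
  -- The path (C⁻¹η, η) is mapped by D to η + CC⁻¹η = 2η, and η is orthogonal to this.
  have h1 := hη' (pathMk (isWeakDeriv_of_orthogonal h hC hη'))
  rw [pathOp_const_apply, pathFst_mk, pathSnd_mk, compLpL_inverse' hC, inner_add_right,
    real_inner_self_eq_norm_sq] at h1
  have : ‖η‖ = 0 := by nlinarith
  exact norm_eq_zero.1 this

end Constant

/-! ### Cutoffs and the Fredholm property for general paths -/

section Parametrix

variable {W H : Type*} [NormedAddCommGroup W] [InnerProductSpace ℝ W] [NormedAddCommGroup H]
  [InnerProductSpace ℝ H]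

theorem mulOp_smul_mulOp (χ : ℝ →ᵇ ℝ) (B : ℝ →ᵇ (W →L[ℝ] H)) (f : Lp W 2 (volume : Measure ℝ)) :
    mulOp (scalarMul χ (ContinuousLinearMap.id ℝ H)) (mulOp B f) = mulOp (χ • B) f :=
  mulOp_mulOp _ _ _ (fun _ => rfl) f

theorem mulOp_mulOp_smul (χ : ℝ →ᵇ ℝ) (B : ℝ →ᵇ (W →L[ℝ] H)) (f : Lp W 2 (volume : Measure ℝ)) :
    mulOp B (mulOp (scalarMul χ (ContinuousLinearMap.id ℝ W)) f) = mulOp (χ • B) f :=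
  mulOp_mulOp _ _ _ (fun t => by ext w; exact ((B t).map_smul (χ t) w).symm) f

theorem norm_scalarMul_le (c : ℝ →ᵇ ℝ) (L : W →L[ℝ] H) : ‖scalarMul c L‖ ≤ ‖c‖ * ‖L‖ :=
  BoundedContinuousFunction.norm_ofNormedAddCommGroup_le _ (by positivity) _

theorem hasDerivAt_scalarMul {χ χ' : ℝ →ᵇ ℝ} (hd : ∀ t, HasDerivAt χ (χ' t) t) (L : W →L[ℝ] H)
    (t : ℝ) : HasDerivAt (scalarMul χ L) (scalarMul χ' L t) t :=
  (hd t).smul_const L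

theorem mulOp_scalarMul_id_add {χ₁ χ₂ : ℝ →ᵇ ℝ} (h : ∀ t, χ₁ t + χ₂ t = 1)
    (f : Lp W 2 (volume : Measure ℝ)) :
    mulOp (scalarMul χ₁ (ContinuousLinearMap.id ℝ W)) f +
      mulOp (scalarMul χ₂ (ContinuousLinearMap.id ℝ W)) f = f := by
  rw [← add_apply, ← mulOp_add]
  refine Lp.ext ((coeFn_mulOp _ f).trans (Eventually.of_forall fun t => ?_))
  change χ₁ t • f t + χ₂ t • f t = f t
  rw [← add_smul, h, one_smul]

variable [CompleteSpace H]

/-- Multiplication by a scalar function on the path space. -/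
theorem exists_path_mul (ι : W →L[ℝ] H) {χ χ' : ℝ →ᵇ ℝ} (hd : ∀ t, HasDerivAt χ (χ' t) t) :
    ∃ M : PathSpace ι →L[ℝ] PathSpace ι,
      (∀ p, pathFst ι (M p) = mulOp (scalarMul χ (ContinuousLinearMap.id ℝ W)) (pathFst ι p)) ∧
      ∀ p, pathSnd ι (M p) = mulOp (scalarMul χ (ContinuousLinearMap.id ℝ H)) (pathSnd ι p) +
        mulOp (scalarMul χ' ι) (pathFst ι p) := by
  let M₁ : PathSpace ι →L[ℝ] Lp W 2 (volume : Measure ℝ) :=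
    (mulOp (scalarMul χ (ContinuousLinearMap.id ℝ W))).comp (pathFst ι)
  let M₂ : PathSpace ι →L[ℝ] Lp H 2 (volume : Measure ℝ) :=
    (mulOp (scalarMul χ (ContinuousLinearMap.id ℝ H))).comp (pathSnd ι) +
      (mulOp (scalarMul χ' ι)).comp (pathFst ι)
  have h : ∀ p, (M₁.prod M₂) p ∈ pathSpace ι := by
    intro p
    have h1 := (isWeakDeriv_path p).mulOp
      (hasDerivAt_scalarMul hd (ContinuousLinearMap.id ℝ H))
    have e1 : mulOp (scalarMul χ (ContinuousLinearMap.id ℝ H)) (ι.compLpL 2 volume (pathFst ι p)) =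
        ι.compLpL 2 volume (M₁ p) := by
      rw [← mulOp_const]
      change _ = mulOp _ (mulOp _ _)
      rw [mulOp_smul_mulOp, mulOp_mulOp_smul]
      rfl
    have e2 : mulOp (scalarMul χ' (ContinuousLinearMap.id ℝ H))
        (ι.compLpL 2 volume (pathFst ι p)) = mulOp (scalarMul χ' ι) (pathFst ι p) := by
      rw [← mulOp_const, mulOp_smul_mulOp]
      rfl
    rw [e1, e2] at h1
    exact h1
  exact ⟨(M₁.prod M₂).codRestrict (pathSpace ι) h, fun p => rfl, fun p => rfl⟩

/-- A smooth step function, with derivative of size `1 / L`. -/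
theorem exists_step {L : ℝ} (hL : 0 < L) : ∃ χ χ' : ℝ →ᵇ ℝ, (∀ t, HasDerivAt χ (χ' t) t) ∧
    Tendsto χ atBot (𝓝 0) ∧ Tendsto χ atTop (𝓝 1) ∧ ‖χ'‖ ≤ L⁻¹ := by
  have hb1 : ∀ t : ℝ, ‖1 / 2 + Real.arctan (t / L) / Real.pi‖ ≤ 1 := fun t => by
    have h1 := Real.neg_pi_div_two_lt_arctan (t / L)
    have h2 := Real.arctan_lt_pi_div_two (t / L)
    have hpi := Real.pi_pos
    rw [Real.norm_eq_abs, abs_le]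
    have h3 : Real.arctan (t / L) / Real.pi ≤ 1 / 2 := by
      rw [div_le_iff₀ hpi]; linarith
    have h4 : -(1 / 2) ≤ Real.arctan (t / L) / Real.pi := by
      rw [le_div_iff₀ hpi]; linarith
    constructor <;> linarith
  have hb2 : ∀ t : ℝ, ‖1 / (1 + (t / L) ^ 2) * (1 / L) / Real.pi‖ ≤ L⁻¹ := fun t => by
    rw [Real.norm_of_nonneg (by positivity), mul_div_assoc, one_div L]
    refine (mul_le_of_le_one_left (by positivity) ?_).trans (div_le_self (by positivity) ?_)
    · rw [div_le_one (by positivity)]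
      nlinarith [sq_nonneg (t / L)]
    · linarith [Real.pi_gt_three]
  have hd : ∀ t : ℝ, HasDerivAt (fun t => 1 / 2 + Real.arctan (t / L) / Real.pi)
      (1 / (1 + (t / L) ^ 2) * (1 / L) / Real.pi) t := fun t =>
    ((((hasDerivAt_id t).div_const L).arctan).div_const Real.pi).const_add _
  refine ⟨BoundedContinuousFunction.ofNormedAddCommGroup _
    (continuous_iff_continuousAt.2 fun t => (hd t).continuousAt) 1 hb1,
    BoundedContinuousFunction.ofNormedAddCommGroup
      (fun t => 1 / (1 + (t / L) ^ 2) * (1 / L) / Real.pi) ?_ L⁻¹ hb2, hd, ?_, ?_, ?_⟩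
  · have : ∀ t : ℝ, 1 + (t / L) ^ 2 ≠ 0 := fun t => by positivity
    fun_prop (disch := assumption)
  · have h := (((Real.tendsto_arctan_atBot.mono_right nhdsWithin_le_nhds).comp
      ((tendsto_id (α := ℝ) (x := atBot)).atBot_div_const hL)).div_const Real.pi).const_add (1 / 2)
    have e : 1 / 2 + -(Real.pi / 2) / Real.pi = 0 := by field_simp; ring
    rw [e] at h
    exact h
  · have h := (((Real.tendsto_arctan_atTop.mono_right nhdsWithin_le_nhds).comp
      ((tendsto_id (α := ℝ) (x := atTop)).atTop_div_const hL)).div_const Real.pi).const_add (1 / 2)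
    have e : 1 / 2 + (Real.pi / 2) / Real.pi = 1 := by field_simp; ring
    rw [e] at h
    exact h
  · exact BoundedContinuousFunction.norm_ofNormedAddCommGroup_le _ (by positivity) _

variable [CompleteSpace W]

/-- The operator `d/dt + A` has finite index if the limits of `A` are symmetric and invertible and
differ from all values of `A` by compact operators. -/
theorem hasFiniteIndex_pathOp {ι : W →L[ℝ] H} (hι : Function.Injective ι)
    {A : ℝ →ᵇ (W →L[ℝ] H)} {C : Bool → W →L[ℝ] H}
    (hs : ∀ a x y, ⟪C a x, ι y⟫_ℝ = ⟪ι x, C a y⟫_ℝ) (hC : ∀ a, (C a).IsInvertible)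
    (hc : ∀ a t, IsCompactOperator (A t - C a))
    (hbot : Tendsto A atBot (𝓝 (C false))) (htop : Tendsto A atTop (𝓝 (C true))) :
    HasFiniteIndex (pathOp ι A : PathSpace ι →ₗ[ℝ] Lp H 2 (volume : Measure ℝ)) := by
  let D' : Bool → PathSpace ι →L[ℝ] Lp H 2 (volume : Measure ℝ) := fun a =>
    pathOp ι (BoundedContinuousFunction.const ℝ (C a))
  have hD' : ∀ a, Function.Bijective (D' a) := fun a => bijective_pathOp_const (hs a) (hC a)
  let e : Bool → PathSpace ι ≃L[ℝ] Lp H 2 (volume : Measure ℝ) := fun a =>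
    ContinuousLinearEquiv.ofBijective (D' a) (LinearMap.ker_eq_bot.2 (hD' a).1)
      (LinearMap.range_eq_top.2 (hD' a).2)
  let R : Bool → Lp H 2 (volume : Measure ℝ) →L[ℝ] PathSpace ι := fun a => (e a).symm
  let B : Bool → ℝ →ᵇ (W →L[ℝ] H) := fun a => A - BoundedContinuousFunction.const ℝ (C a)
  let Q : Bool → PathSpace ι →L[ℝ] Lp H 2 (volume : Measure ℝ) := fun a =>
    (mulOp (B a)).comp (pathFst ι)
  set c₁ : ℝ := ‖R true‖ + ‖R false‖
  set c₂ : ℝ := ‖R true‖ * ‖R true‖ * ‖Q true‖ + ‖R false‖ * ‖R false‖ * ‖Q false‖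
  set c₃ : ℝ := ‖ι‖ * ‖pathFst ι‖
  have hc₁ : 0 ≤ c₁ := by positivity
  have hc₂ : 0 ≤ c₂ := by positivity
  have hc₃ : 0 ≤ c₃ := by positivity
  -- A step of width L has commutators of norm at most c₃ / L. This choice makes both c₃ c₁ / L and
  -- c₃ c₂ / L less than 1, as the gluing requires.
  set L : ℝ := c₃ * (c₁ + c₂) + 1
  have hL : 0 < L := by positivity
  obtain ⟨χ, χ', hd, hχ0, hχ1, hχ'⟩ := exists_step hL
  let X : Bool → ℝ →ᵇ ℝ := fun a => bif a then χ else BoundedContinuousFunction.const ℝ 1 - χ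
  let X' : Bool → ℝ →ᵇ ℝ := fun a => bif a then χ' else -χ'
  have hX : ∀ a t, HasDerivAt (X a) (X' a t) t := by
    rintro (_ | _) t
    · exact (hd t).const_sub 1
    · exact hd t
  have hX' : ∀ a, ‖X' a‖ ≤ L⁻¹ := by
    rintro (_ | _)
    · exact (norm_neg χ').trans_le hχ'
    · exact hχ'
  have hsum : ∀ t, X true t + X false t = 1 := fun t => add_sub_cancel _ _
  choose M hM1 hM2 using fun a => exists_path_mul ι (hX a)
  let m : Bool → Lp H 2 (volume : Measure ℝ) →L[ℝ] Lp H 2 (volume : Measure ℝ) := fun a =>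
    mulOp (scalarMul (X a) (ContinuousLinearMap.id ℝ H))
  let S : Bool → PathSpace ι →L[ℝ] Lp H 2 (volume : Measure ℝ) := fun a =>
    (mulOp (scalarMul (X' a) ι)).comp (pathFst ι)
  let N : Bool → PathSpace ι →L[ℝ] Lp H 2 (volume : Measure ℝ) := fun a =>
    (mulOp (X a • B a)).comp (pathFst ι)
  have hDM : ∀ a, (D' a).comp (M a) = (m a).comp (D' a) + S a := by
    intro a
    refine ContinuousLinearMap.ext fun p => ?_
    change pathOp ι (BoundedContinuousFunction.const ℝ (C a)) (M a p) =
      mulOp (scalarMul (X a) (ContinuousLinearMap.id ℝ H))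
        (pathOp ι (BoundedContinuousFunction.const ℝ (C a)) p) +
      mulOp (scalarMul (X' a) ι) (pathFst ι p)
    rw [pathOp_apply, pathOp_apply, hM1, hM2, map_add, mulOp_smul_mulOp, mulOp_mulOp_smul]
    abel
  -- At the end labelled a the difference of A and C_a tends to zero, and at the opposite end the
  -- cutoff X_a does. The product thus vanishes at both ends, and its values are compact.
  have hN : ∀ a, IsCompactOperator (N a) := by
    intro a
    refine isCompactOperator_mulOp_comp_pathFst hι (fun t => (hc a t).smul (X a t)) ?_
    have hB0 : Tendsto (fun t => A t - C a) (bif a then atTop else atBot) (𝓝 0) := by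
      cases a
      · simpa using hbot.sub_const (C false)
      · simpa using htop.sub_const (C true)
    have hX0 : Tendsto (X a) (bif a then atBot else atTop) (𝓝 0) := by
      cases a
      · have := hχ1.const_sub 1
        rw [sub_self] at this
        exact this
      · exact hχ0
    have hXb : ∀ t, ‖X a t‖ ≤ ‖X a‖ := (X a).norm_coe_le_norm
    have hBb : ∀ t, ‖A t - C a‖ ≤ ‖B a‖ := (B a).norm_coe_le_norm
    have t1 : Tendsto (X a • B a : ℝ →ᵇ (W →L[ℝ] H)) (bif a then atTop else atBot) (𝓝 0) := by
      refine squeeze_zero_norm (fun t => ?_)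
        (by simpa using (tendsto_zero_iff_norm_tendsto_zero.1 hB0).const_mul ‖X a‖)
      exact (norm_smul_le _ _).trans (mul_le_mul (hXb t) le_rfl (norm_nonneg _) (norm_nonneg _))
    have t2 : Tendsto (X a • B a : ℝ →ᵇ (W →L[ℝ] H)) (bif a then atBot else atTop) (𝓝 0) := by
      refine squeeze_zero_norm (fun t => ?_)
        (by simpa using (tendsto_zero_iff_norm_tendsto_zero.1 hX0).mul_const ‖B a‖)
      exact (norm_smul_le _ _).trans (mul_le_mul le_rfl (hBb t) (norm_nonneg _) (abs_nonneg _))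
    rw [cocompact_eq_atBot_atTop]
    cases a
    · exact t1.sup t2
    · exact t2.sup t1
  refine hasFiniteIndex_of_gluing (D' := D') (R := R) (M := M) (m := m) (S := S) (N := N) (Q := Q)
    (ε := L⁻¹ * c₃) (fun a => ?_) (fun a => ?_) ?_ ?_ hDM (fun a => ?_) (fun a => ?_)
    (fun a => ?_) hN (fun a => ?_) ?_ ?_
  · exact ContinuousLinearMap.ext fun y => (e a).apply_symm_apply y
  · exact ContinuousLinearMap.ext fun y => (e a).symm_apply_apply y
  · exact ContinuousLinearMap.ext fun f => mulOp_scalarMul_id_add hsum f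
  · refine ContinuousLinearMap.ext fun p => PathSpace.ext ?_ ?_
    · change pathFst ι (M true p + M false p) = pathFst ι p
      rw [map_add, hM1, hM1, mulOp_scalarMul_id_add hsum]
    · change pathSnd ι (M true p + M false p) = pathSnd ι p
      have h0 : scalarMul (X' true) ι + scalarMul (X' false) ι = 0 := by
        ext t w
        change (χ' t) • ι w + (-χ' t) • ι w = 0
        rw [← add_smul, add_neg_cancel, zero_smul]
      have h1 : mulOp (scalarMul (X' true) ι) (pathFst ι p) +
          mulOp (scalarMul (X' false) ι) (pathFst ι p) = 0 := by
        rw [← add_apply, ← mulOp_add, h0, ← mulOpL_apply, map_zero (mulOpL W H)]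
        rfl
      rw [map_add, hM2, hM2, add_add_add_comm, mulOp_scalarMul_id_add hsum, h1, add_zero]
  · refine ContinuousLinearMap.ext fun p => ?_
    change pathSnd ι p + mulOp A (pathFst ι p) =
      pathSnd ι p + mulOp (BoundedContinuousFunction.const ℝ (C a)) (pathFst ι p) +
      mulOp (B a) (pathFst ι p)
    rw [add_assoc, ← add_apply, ← mulOp_add]
    congr 3
    exact (add_sub_cancel (BoundedContinuousFunction.const ℝ (C a)) A).symm
  · refine ContinuousLinearMap.ext fun p => ?_
    change mulOp (B a) (pathFst ι (M a p)) = mulOp (X a • B a) (pathFst ι p)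
    rw [hM1, mulOp_mulOp_smul]
  · exact ContinuousLinearMap.ext fun p => mulOp_smul_mulOp _ _ _
  · refine (ContinuousLinearMap.opNorm_comp_le _ _).trans ?_
    calc _ ≤ (L⁻¹ * ‖ι‖) * ‖pathFst ι‖ := by
          gcongr
          exact (norm_mulOp_le _).trans ((norm_scalarMul_le _ _).trans (by gcongr; exact hX' a))
      _ = L⁻¹ * c₃ := by simp only [c₃]; ring
  · change L⁻¹ * c₃ * c₁ < 1
    rw [mul_assoc, inv_mul_lt_iff₀ hL, mul_one]
    nlinarith [mul_nonneg hc₃ hc₂]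
  · change L⁻¹ * c₃ * c₂ < 1
    rw [mul_assoc, inv_mul_lt_iff₀ hL, mul_one]
    nlinarith [mul_nonneg hc₃ hc₁]

end Parametrix

/-! ## Admissible operators -/

section Symmetric

variable {W H : Type*} [NormedAddCommGroup W] [InnerProductSpace ℝ W] [NormedAddCommGroup H]
  [InnerProductSpace ℝ H]

/-- Symmetry of an operator `B : W → H` with respect to `ι : W → H`. -/
def IsSymmetricAlong (ι B : W →L[ℝ] H) : Prop := ∀ x y, ⟪B x, ι y⟫_ℝ = ⟪ι x, B y⟫_ℝ

theorem IsSymmetricAlong.add {ι B C : W →L[ℝ] H} (hB : IsSymmetricAlong ι B)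
    (hC : IsSymmetricAlong ι C) : IsSymmetricAlong ι (B + C) := fun x y => by
  rw [add_apply, add_apply, inner_add_left, inner_add_right, hB, hC]

theorem IsSymmetricAlong.smul {ι B : W →L[ℝ] H} (c : ℝ) (hB : IsSymmetricAlong ι B) :
    IsSymmetricAlong ι (c • B) := fun x y => by
  rw [smul_apply, smul_apply, inner_smul_left, inner_smul_right, hB]; rfl

theorem IsSymmetricAlong.sub {ι B C : W →L[ℝ] H} (hB : IsSymmetricAlong ι B)
    (hC : IsSymmetricAlong ι C) : IsSymmetricAlong ι (B - C) := fun x y => by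
  rw [sub_apply, sub_apply, inner_sub_left, inner_sub_right, hB, hC]

theorem isSymmetricAlong_self (ι : W →L[ℝ] H) : IsSymmetricAlong ι ι := fun _ _ => rfl

theorem isSymmetricAlong_zero (ι : W →L[ℝ] H) : IsSymmetricAlong ι 0 := fun x y => by
  rw [zero_apply, zero_apply, inner_zero_left, inner_zero_right]

theorem isClosed_isSymmetricAlong (ι : W →L[ℝ] H) : IsClosed {B | IsSymmetricAlong ι B} := by
  have : {B | IsSymmetricAlong ι B} = ⋂ x, ⋂ y, {B : W →L[ℝ] H | ⟪B x, ι y⟫_ℝ = ⟪ι x, B y⟫_ℝ} := by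
    ext B; simp [IsSymmetricAlong]
  rw [this]
  refine isClosed_iInter fun x => isClosed_iInter fun y => isClosed_eq ?_ ?_
  · exact (ContinuousLinearMap.apply ℝ H x).continuous.inner continuous_const
  · exact continuous_const.inner (ContinuousLinearMap.apply ℝ H y).continuous

theorem isClosed_isCompactOperator_sub [CompleteSpace H] (C : W →L[ℝ] H) :
    IsClosed {B : W →L[ℝ] H | IsCompactOperator (B - C)} := by
  have hc := isClosed_setOfPred_isCompactOperator (𝕜₁ := ℝ) (𝕜₂ := ℝ) (M₁ := W) (M₂ := H)
    (σ₁₂ := RingHom.id ℝ)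
  have h : Continuous fun B : W →L[ℝ] H => B - C := continuous_id.sub continuous_const
  exact hc.preimage h

end Symmetric

namespace ReferenceOperator

variable (T : ReferenceOperator.{u})

theorem incl_injective : Function.Injective T.incl := by
  rw [injective_iff_map_eq_zero]
  intro w hw
  obtain ⟨h, h'⟩ := (mem_graphSpace_iff T.op w.1).1 w.2
  have h1 : w.1.fst = 0 := hw
  have h2 : w.1.snd = 0 := by
    rw [← h']
    have : (⟨w.1.fst, h⟩ : T.op.domain) = 0 := Subtype.ext h1
    rw [this, LinearPMap.map_zero]
  exact Subtype.ext (WithLp.ofLp_injective 2 (Prod.ext h1 h2))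

theorem denseRange_incl : DenseRange T.incl := by
  refine T.dense_domain.mono fun x hx => ?_
  exact ⟨⟨WithLp.toLp 2 (x, T.op ⟨x, hx⟩), (mem_graphSpace_iff _ _).2 ⟨hx, rfl⟩⟩, rfl⟩

theorem isSymmetricAlong_base : IsSymmetricAlong T.incl T.base := by
  intro x y
  obtain ⟨hx, hx'⟩ := (mem_graphSpace_iff T.op x.1).1 x.2
  obtain ⟨hy, hy'⟩ := (mem_graphSpace_iff T.op y.1).1 y.2
  have h := LinearPMap.adjoint_isFormalAdjoint T.dense_domain
  rw [LinearPMap.isSelfAdjoint_def.mp T.isSelfAdjoint] at h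
  change ⟪x.1.snd, y.1.fst⟫_ℝ = ⟪x.1.fst, y.1.snd⟫_ℝ
  rw [← hx', ← hy']
  exact h ⟨_, hx⟩ ⟨_, hy⟩

variable {T}

theorem isAdmissible_iff {B : T.W →L[ℝ] T.H} :
    T.IsAdmissible B ↔ IsCompactOperator (B - T.base) ∧ IsSymmetricAlong T.incl B := by
  constructor
  · rintro ⟨K, hK, hs, rfl⟩
    rw [add_sub_cancel_left]
    exact ⟨hK, T.isSymmetricAlong_base.add hs⟩
  · rintro ⟨hK, hs⟩
    exact ⟨B - T.base, hK, hs.sub T.isSymmetricAlong_base, (add_sub_cancel _ _).symm⟩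

theorem IsAdmissible.isSymmetricAlong {B : T.W →L[ℝ] T.H} (hB : T.IsAdmissible B) :
    IsSymmetricAlong T.incl B := (isAdmissible_iff.1 hB).2

theorem IsAdmissible.isCompactOperator_sub {B C : T.W →L[ℝ] T.H} (hB : T.IsAdmissible B)
    (hC : T.IsAdmissible C) : IsCompactOperator (B - C) := by
  have h := (isAdmissible_iff.1 hB).1.sub (isAdmissible_iff.1 hC).1
  have e : (B - C : T.W →L[ℝ] T.H) = (B - T.base) - (C - T.base) := by abel
  rw [e]
  exact h

theorem IsAdmissible.add {B K : T.W →L[ℝ] T.H} (hB : T.IsAdmissible B)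
    (hK : IsCompactOperator K) (hs : IsSymmetricAlong T.incl K) : T.IsAdmissible (B + K) := by
  obtain ⟨h1, h2⟩ := isAdmissible_iff.1 hB
  refine isAdmissible_iff.2 ⟨?_, h2.add hs⟩
  have e : (B + K - T.base : T.W →L[ℝ] T.H) = (B - T.base) + K := by abel
  rw [e]
  exact h1.add hK

theorem isAdmissible_base : T.IsAdmissible T.base :=
  isAdmissible_iff.2 ⟨by rw [sub_self]; exact isCompactOperator_zero, T.isSymmetricAlong_base⟩

theorem isClosed_isAdmissible : IsClosed {B | T.IsAdmissible B} := by
  have : {B | T.IsAdmissible B} = {B : T.W →L[ℝ] T.H | IsCompactOperator (B - T.base)} ∩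
      {B | IsSymmetricAlong T.incl B} := by
    ext B; exact isAdmissible_iff
  rw [this]
  exact (isClosed_isCompactOperator_sub T.base).inter (isClosed_isSymmetricAlong _)

theorem IsAdmissible.of_tendsto {l : Filter ℝ} [l.NeBot] {A : ℝ → T.W →L[ℝ] T.H}
    {B : T.W →L[ℝ] T.H} (hA : ∀ t, T.IsAdmissible (A t)) (h : Tendsto A l (𝓝 B)) :
    T.IsAdmissible B :=
  isClosed_isAdmissible.mem_of_tendsto h (Eventually.of_forall hA)

/-- Convex combinations of admissible operators are admissible. -/
theorem IsAdmissible.lineMap {B C : T.W →L[ℝ] T.H} (hB : T.IsAdmissible B)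
    (hC : T.IsAdmissible C) (s : ℝ) : T.IsAdmissible (B + s • (C - B)) :=
  hB.add ((hC.isCompactOperator_sub hB).smul s)
    ((hC.isSymmetricAlong.sub hB.isSymmetricAlong).smul s)

end ReferenceOperator

open ReferenceOperator

/-! ## Spectral flow as an index -/

variable {T : ReferenceOperator.{u}}

/-- Admissibility is a closed condition, so the limits are admissible. They are therefore symmetric
and differ from each A(t) by a compact operator. -/
theorem hasFiniteIndex_of_mem_admissiblePaths {A : ℝ →ᵇ (T.W →L[ℝ] T.H)}
    (hA : A ∈ T.admissiblePaths) :
    HasFiniteIndex (pathOp T.incl A : PathSpace T.incl →ₗ[ℝ] Lp T.H 2 (volume : Measure ℝ)) := by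
  obtain ⟨hadm, ⟨Bm, hBm, hm⟩, ⟨Bp, hBp, hp⟩⟩ := hA
  have h1 : T.IsAdmissible Bm := IsAdmissible.of_tendsto hadm hm
  have h2 : T.IsAdmissible Bp := IsAdmissible.of_tendsto hadm hp
  refine hasFiniteIndex_pathOp T.incl_injective (C := fun a => bif a then Bp else Bm) ?_ ?_ ?_ hm hp
  · rintro (_ | _)
    exacts [h1.isSymmetricAlong, h2.isSymmetricAlong]
  · rintro (_ | _)
    exacts [hBm, hBp]
  · rintro (_ | _) t
    exacts [(hadm t).isCompactOperator_sub h1, (hadm t).isCompactOperator_sub h2]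

/-- The index of `d/dt + A`. -/
def pathIndex (T : ReferenceOperator.{u}) (A : T.admissiblePaths) : ℤ :=
  linearIndex (pathOp T.incl A.1 : PathSpace T.incl →ₗ[ℝ] Lp T.H 2 (volume : Measure ℝ))

/-- The operator depends continuously on the path in norm and the index is locally constant, hence
constant on connected sets, whether or not these are path-connected. -/
theorem pathIndex_eq_of_mem_connectedComponent {A B : T.admissiblePaths}
    (h : B ∈ connectedComponent A) : pathIndex T A = pathIndex T B := by
  have hl : IsLocallyConstant (pathIndex T) := by
    refine (IsLocallyConstant.iff_eventually_eq _).2 fun A => ?_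
    have h1 := (hasFiniteIndex_of_mem_admissiblePaths A.2).eventually_nhds
    have h2 : Tendsto (fun B : T.admissiblePaths => pathOp T.incl B.1) (𝓝 A)
        (𝓝 (pathOp T.incl A.1)) :=
      ((continuous_pathOp T.incl).comp continuous_subtype_val).tendsto A
    exact (h2.eventually h1).mono fun B hB => hB.2
  exact hl.apply_eq_of_isPreconnected isPreconnected_connectedComponent mem_connectedComponent h

theorem mem_connectedComponent_of_homotopy {γ : ℝ → ℝ →ᵇ (T.W →L[ℝ] T.H)} (hγ : Continuous γ)
    (h : ∀ s ∈ Set.Icc (0 : ℝ) 1, γ s ∈ T.admissiblePaths) {A B : T.admissiblePaths}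
    (hA : γ 0 = A.1) (hB : γ 1 = B.1) : B ∈ connectedComponent A := by
  let g : Set.Icc (0 : ℝ) 1 → T.admissiblePaths := fun s => ⟨γ s, h s s.2⟩
  have hg : Continuous g := (hγ.comp continuous_subtype_val).subtype_mk _
  have h1 : IsPreconnected (Set.range g) := isPreconnected_range hg
  have h2 : A ∈ Set.range g := ⟨⟨0, by simp⟩, Subtype.ext hA⟩
  have h3 : B ∈ Set.range g := ⟨⟨1, by simp⟩, Subtype.ext hB⟩
  exact h1.subset_connectedComponent h2 h3

theorem pathIndex_eq_zero_of_const {A : T.admissiblePaths} (h : ∀ t, A.1 t = A.1 0) :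
    pathIndex T A = 0 := by
  obtain ⟨hadm, -, ⟨B, hB, hp⟩⟩ := A.2
  have h1 : B = A.1 0 := by
    refine tendsto_nhds_unique hp ?_
    exact tendsto_const_nhds.congr fun t => (h t).symm
  have h2 : A.1 = BoundedContinuousFunction.const ℝ B := by
    ext1 t
    rw [h, ← h1]
    rfl
  have := bijective_pathOp_const (IsAdmissible.of_tendsto hadm hp).isSymmetricAlong hB
  rw [pathIndex, h2]
  exact linearIndex_of_bijective this

/-! ### Functoriality in the pair (W, H) -/

section Functoriality

variable {W H W' H' : Type*} [NormedAddCommGroup W] [InnerProductSpace ℝ W] [NormedAddCommGroup H]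
  [InnerProductSpace ℝ H] [NormedAddCommGroup W'] [InnerProductSpace ℝ W'] [NormedAddCommGroup H']
  [InnerProductSpace ℝ H']

theorem compLpL_compLpL {X Y Z : Type*} [NormedAddCommGroup X] [NormedSpace ℝ X]
    [NormedAddCommGroup Y] [NormedSpace ℝ Y] [NormedAddCommGroup Z] [NormedSpace ℝ Z]
    (L : Y →L[ℝ] Z) (M : X →L[ℝ] Y) (f : Lp X 2 (volume : Measure ℝ)) :
    L.compLpL 2 volume (M.compLpL 2 volume f) = (L.comp M).compLpL 2 volume f := by
  refine Lp.ext ?_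
  filter_upwards [L.coeFn_compLpL (p := 2) (M.compLpL 2 volume f), M.coeFn_compLpL (p := 2) f,
    (L.comp M).coeFn_compLpL (p := 2) f] with t h1 h2 h3
  rw [h1, h2, h3]
  rfl

theorem compLpL_id {X : Type*} [NormedAddCommGroup X] [NormedSpace ℝ X]
    (f : Lp X 2 (volume : Measure ℝ)) :
    (ContinuousLinearMap.id ℝ X).compLpL 2 volume f = f :=
  Lp.ext ((ContinuousLinearMap.id ℝ X).coeFn_compLpL (p := 2) f)

theorem compLpL_add_apply {X Y : Type*} [NormedAddCommGroup X] [NormedSpace ℝ X]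
    [NormedAddCommGroup Y] [NormedSpace ℝ Y] (L M : X →L[ℝ] Y)
    (f : Lp X 2 (volume : Measure ℝ)) :
    (L + M).compLpL 2 volume f = L.compLpL 2 volume f + M.compLpL 2 volume f := by
  refine Lp.ext ?_
  filter_upwards [L.coeFn_compLpL (p := 2) f, M.coeFn_compLpL (p := 2) f,
    (L + M).coeFn_compLpL (p := 2) f,
    Lp.coeFn_add (L.compLpL 2 volume f) (M.compLpL 2 volume f)] with t h1 h2 h3 h4
  rw [h3, h4, Pi.add_apply, h1, h2]
  rfl

theorem compLpL_zero_apply {X Y : Type*} [NormedAddCommGroup X] [NormedSpace ℝ X]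
    [NormedAddCommGroup Y] [NormedSpace ℝ Y] (f : Lp X 2 (volume : Measure ℝ)) :
    (0 : X →L[ℝ] Y).compLpL 2 volume f = 0 := by
  refine Lp.ext ?_
  filter_upwards [(0 : X →L[ℝ] Y).coeFn_compLpL (p := 2) f, Lp.coeFn_zero Y 2 volume] with t h1 h2
  rw [h1, h2]
  rfl

theorem compLpL_add_compLpL_eq_self {X X₁ X₂ : Type*} [NormedAddCommGroup X] [NormedSpace ℝ X]
    [NormedAddCommGroup X₁] [NormedSpace ℝ X₁] [NormedAddCommGroup X₂] [NormedSpace ℝ X₂]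
    (a₁ : X →L[ℝ] X₁) (a₂ : X →L[ℝ] X₂) (b₁ : X₁ →L[ℝ] X) (b₂ : X₂ →L[ℝ] X)
    (h : ∀ x, b₁ (a₁ x) + b₂ (a₂ x) = x) (f : Lp X 2 (volume : Measure ℝ)) :
    b₁.compLpL 2 volume (a₁.compLpL 2 volume f) +
      b₂.compLpL 2 volume (a₂.compLpL 2 volume f) = f := by
  rw [compLpL_compLpL, compLpL_compLpL, ← compLpL_add_apply]
  have e : b₁.comp a₁ + b₂.comp a₂ = ContinuousLinearMap.id ℝ X := ContinuousLinearMap.ext h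
  rw [e, compLpL_id]

theorem compLpL_add_eq_fst {X Y Z : Type*} [NormedAddCommGroup X] [NormedSpace ℝ X]
    [NormedAddCommGroup Y] [NormedSpace ℝ Y] [NormedAddCommGroup Z] [NormedSpace ℝ Z]
    (a : X →L[ℝ] Y) (b : Y →L[ℝ] X) (c : Z →L[ℝ] X) (hb : ∀ y, a (b y) = y)
    (hc : ∀ z, a (c z) = 0) (f : Lp Y 2 (volume : Measure ℝ)) (g : Lp Z 2 (volume : Measure ℝ)) :
    a.compLpL 2 volume (b.compLpL 2 volume f + c.compLpL 2 volume g) = f := by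
  rw [map_add, compLpL_compLpL, compLpL_compLpL]
  have e1 : a.comp b = ContinuousLinearMap.id ℝ Y := ContinuousLinearMap.ext hb
  have e2 : a.comp c = 0 := ContinuousLinearMap.ext hc
  rw [e1, e2, compLpL_id, compLpL_zero_apply, add_zero]

theorem compLpL_add_eq_snd {X Y Z : Type*} [NormedAddCommGroup X] [NormedSpace ℝ X]
    [NormedAddCommGroup Y] [NormedSpace ℝ Y] [NormedAddCommGroup Z] [NormedSpace ℝ Z]
    (a : X →L[ℝ] Y) (b : Y →L[ℝ] X) (c : Z →L[ℝ] X) (hb : ∀ y, a (b y) = y)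
    (hc : ∀ z, a (c z) = 0) (f : Lp Y 2 (volume : Measure ℝ)) (g : Lp Z 2 (volume : Measure ℝ)) :
    a.compLpL 2 volume (c.compLpL 2 volume g + b.compLpL 2 volume f) = f := by
  rw [add_comm]
  exact compLpL_add_eq_fst a b c hb hc f g

variable [CompleteSpace H] [CompleteSpace H']

/-- The map on path spaces induced by a morphism of pairs. -/
def pathMap {ι : W →L[ℝ] H} {ι' : W' →L[ℝ] H'} (L : W →L[ℝ] W') (l : H →L[ℝ] H')
    (h : ∀ w, ι' (L w) = l (ι w)) : PathSpace ι →L[ℝ] PathSpace ι' :=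
  (((L.compLpL 2 volume).comp (pathFst ι)).prod
    ((l.compLpL 2 volume).comp (pathSnd ι))).codRestrict (pathSpace ι') (fun p => by
      have h1 := (isWeakDeriv_path p).compLpL l
      change IsWeakDeriv (ι'.compLpL 2 volume (L.compLpL 2 volume (pathFst ι p))) _
      rw [compLpL_compLpL] at h1 ⊢
      have e : ι'.comp L = l.comp ι := ContinuousLinearMap.ext h
      rw [e]
      exact h1)

omit [CompleteSpace H] [CompleteSpace H'] in
theorem compLpL_mulOp (L : W →L[ℝ] W') (l : H →L[ℝ] H') {A : ℝ →ᵇ (W →L[ℝ] H)}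
    {A' : ℝ →ᵇ (W' →L[ℝ] H')} (hA : ∀ t w, A' t (L w) = l (A t w))
    (f : Lp W 2 (volume : Measure ℝ)) :
    l.compLpL 2 volume (mulOp A f) = mulOp A' (L.compLpL 2 volume f) := by
  refine Lp.ext ?_
  filter_upwards [l.coeFn_compLpL (p := 2) (mulOp A f), coeFn_mulOp A f,
    coeFn_mulOp A' (L.compLpL 2 volume f), L.coeFn_compLpL (p := 2) f] with t h1 h2 h3 h4
  rw [h1, h2, h3, h4, hA]

theorem pathOp_pathMap {ι : W →L[ℝ] H} {ι' : W' →L[ℝ] H'} {L : W →L[ℝ] W'} {l : H →L[ℝ] H'}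
    (h : ∀ w, ι' (L w) = l (ι w)) {A : ℝ →ᵇ (W →L[ℝ] H)}
    {A' : ℝ →ᵇ (W' →L[ℝ] H')} (hA : ∀ t w, A' t (L w) = l (A t w)) (p : PathSpace ι) :
    l.compLpL 2 volume (pathOp ι A p) = pathOp ι' A' (pathMap L l h p) := by
  rw [pathOp_apply, map_add, compLpL_mulOp L l hA]
  rfl

end Functoriality

/-! ### Additivity under direct sums -/

section DirectSum

variable (T₁ T₂ : ReferenceOperator.{u})

/-- The inclusion of the first summand. -/
def sumInl : T₁.H →L[ℝ] (T₁.prod T₂).H :=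
  (WithLp.prodContinuousLinearEquiv 2 ℝ T₁.H T₂.H).symm.toContinuousLinearMap.comp
    (ContinuousLinearMap.inl ℝ T₁.H T₂.H)

/-- The inclusion of the second summand. -/
def sumInr : T₂.H →L[ℝ] (T₁.prod T₂).H :=
  (WithLp.prodContinuousLinearEquiv 2 ℝ T₁.H T₂.H).symm.toContinuousLinearMap.comp
    (ContinuousLinearMap.inr ℝ T₁.H T₂.H)

/-- The projection to the first summand. -/
def sumFst : (T₁.prod T₂).H →L[ℝ] T₁.H := WithLp.fstL 2 ℝ T₁.H T₂.H

/-- The projection to the second summand. -/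
def sumSnd : (T₁.prod T₂).H →L[ℝ] T₂.H := WithLp.sndL 2 ℝ T₁.H T₂.H

/-- The inclusion of the first domain. -/
def domInl : T₁.W →L[ℝ] (T₁.prod T₂).W := prodInl T₁.op T₂.op

/-- The inclusion of the second domain. -/
def domInr : T₂.W →L[ℝ] (T₁.prod T₂).W := prodInr T₁.op T₂.op

/-- The projection to the first domain. -/
def domFst : (T₁.prod T₂).W →L[ℝ] T₁.W := prodFst T₁.op T₂.op

/-- The projection to the second domain. -/
def domSnd : (T₁.prod T₂).W →L[ℝ] T₂.W := prodSnd T₁.op T₂.op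

variable {T₁ T₂}

theorem sumFst_sumInl (x : T₁.H) : sumFst T₁ T₂ (sumInl T₁ T₂ x) = x := rfl
theorem sumSnd_sumInl (x : T₁.H) : sumSnd T₁ T₂ (sumInl T₁ T₂ x) = 0 := rfl
theorem sumFst_sumInr (x : T₂.H) : sumFst T₁ T₂ (sumInr T₁ T₂ x) = 0 := rfl
theorem sumSnd_sumInr (x : T₂.H) : sumSnd T₁ T₂ (sumInr T₁ T₂ x) = x := rfl
theorem sumFst_incl (w : (T₁.prod T₂).W) :
    sumFst T₁ T₂ ((T₁.prod T₂).incl w) = T₁.incl (domFst T₁ T₂ w) := rfl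
theorem sumSnd_incl (w : (T₁.prod T₂).W) :
    sumSnd T₁ T₂ ((T₁.prod T₂).incl w) = T₂.incl (domSnd T₁ T₂ w) := rfl
theorem domFst_domInl (w : T₁.W) : domFst T₁ T₂ (domInl T₁ T₂ w) = w := rfl
theorem domSnd_domInl (w : T₁.W) : domSnd T₁ T₂ (domInl T₁ T₂ w) = 0 := rfl
theorem domFst_domInr (w : T₂.W) : domFst T₁ T₂ (domInr T₁ T₂ w) = 0 := rfl
theorem domSnd_domInr (w : T₂.W) : domSnd T₁ T₂ (domInr T₁ T₂ w) = w := rfl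

theorem sum_ext {x y : (T₁.prod T₂).H} (h1 : sumFst T₁ T₂ x = sumFst T₁ T₂ y)
    (h2 : sumSnd T₁ T₂ x = sumSnd T₁ T₂ y) : x = y :=
  WithLp.ofLp_injective 2 (Prod.ext h1 h2)

theorem dom_ext {x y : (T₁.prod T₂).W} (h1 : domFst T₁ T₂ x = domFst T₁ T₂ y)
    (h2 : domSnd T₁ T₂ x = domSnd T₁ T₂ y) : x = y := by
  refine (T₁.prod T₂).incl_injective (sum_ext ?_ ?_)
  · rw [sumFst_incl, sumFst_incl, h1]
  · rw [sumSnd_incl, sumSnd_incl, h2]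

theorem sumInl_add_sumInr (x : (T₁.prod T₂).H) :
    sumInl T₁ T₂ (sumFst T₁ T₂ x) + sumInr T₁ T₂ (sumSnd T₁ T₂ x) = x :=
  sum_ext (by rw [map_add, sumFst_sumInl, sumFst_sumInr, add_zero])
    (by rw [map_add, sumSnd_sumInl, sumSnd_sumInr, zero_add])

theorem domInl_add_domInr (x : (T₁.prod T₂).W) :
    domInl T₁ T₂ (domFst T₁ T₂ x) + domInr T₁ T₂ (domSnd T₁ T₂ x) = x :=
  dom_ext (by rw [map_add, domFst_domInl, domFst_domInr, add_zero])
    (by rw [map_add, domSnd_domInl, domSnd_domInr, zero_add])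

theorem inner_sum (x y : (T₁.prod T₂).H) : ⟪x, y⟫_ℝ =
    ⟪sumFst T₁ T₂ x, sumFst T₁ T₂ y⟫_ℝ + ⟪sumSnd T₁ T₂ x, sumSnd T₁ T₂ y⟫_ℝ :=
  WithLp.prod_inner_apply _ _

theorem pathIndex_directSum (A₁ : T₁.admissiblePaths) (A₂ : T₂.admissiblePaths)
    (A : (T₁.prod T₂).admissiblePaths)
    (h : ∀ (t : ℝ) (w : (T₁.prod T₂).W), A.1 t w =
      WithLp.toLp 2 (A₁.1 t (prodFst T₁.op T₂.op w), A₂.1 t (prodSnd T₁.op T₂.op w))) :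
    pathIndex (T₁.prod T₂) A = pathIndex T₁ A₁ + pathIndex T₂ A₂ := by
  let q₁ := pathMap (ι := (T₁.prod T₂).incl) (ι' := T₁.incl) (domFst T₁ T₂) (sumFst T₁ T₂)
    (fun w => rfl)
  let q₂ := pathMap (ι := (T₁.prod T₂).incl) (ι' := T₂.incl) (domSnd T₁ T₂) (sumSnd T₁ T₂)
    (fun w => rfl)
  let i₁ := pathMap (ι := T₁.incl) (ι' := (T₁.prod T₂).incl) (domInl T₁ T₂) (sumInl T₁ T₂)
    (fun w => rfl)
  let i₂ := pathMap (ι := T₂.incl) (ι' := (T₁.prod T₂).incl) (domInr T₁ T₂) (sumInr T₁ T₂)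
    (fun w => rfl)
  let e : PathSpace (T₁.prod T₂).incl →ₗ[ℝ] PathSpace T₁.incl × PathSpace T₂.incl :=
    q₁.toLinearMap.prod q₂.toLinearMap
  let e' : Lp (T₁.prod T₂).H 2 (volume : Measure ℝ) →ₗ[ℝ]
      Lp T₁.H 2 (volume : Measure ℝ) × Lp T₂.H 2 (volume : Measure ℝ) :=
    ((sumFst T₁ T₂).compLpL 2 volume).toLinearMap.prod ((sumSnd T₁ T₂).compLpL 2 volume).toLinearMap
  have he : Function.Bijective e := by
    refine Function.bijective_iff_has_inverse.2 ⟨fun p => i₁ p.1 + i₂ p.2, fun p => ?_, fun p => ?_⟩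
    · exact PathSpace.ext (compLpL_add_compLpL_eq_self (domFst T₁ T₂) (domSnd T₁ T₂)
          (domInl T₁ T₂) (domInr T₁ T₂) domInl_add_domInr (pathFst _ p))
        (compLpL_add_compLpL_eq_self (sumFst T₁ T₂) (sumSnd T₁ T₂)
          (sumInl T₁ T₂) (sumInr T₁ T₂) sumInl_add_sumInr (pathSnd _ p))
    · refine Prod.ext (PathSpace.ext ?_ ?_) (PathSpace.ext ?_ ?_)
      · exact compLpL_add_eq_fst (domFst T₁ T₂) (domInl T₁ T₂) (domInr T₁ T₂) domFst_domInl
          domFst_domInr (pathFst _ p.1) (pathFst _ p.2)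
      · exact compLpL_add_eq_fst (sumFst T₁ T₂) (sumInl T₁ T₂) (sumInr T₁ T₂) sumFst_sumInl
          sumFst_sumInr (pathSnd _ p.1) (pathSnd _ p.2)
      · exact (compLpL_add_eq_snd (domSnd T₁ T₂) (domInr T₁ T₂) (domInl T₁ T₂) domSnd_domInr
            domSnd_domInl (pathFst _ p.2) (pathFst _ p.1))
      · exact (compLpL_add_eq_snd (sumSnd T₁ T₂) (sumInr T₁ T₂) (sumInl T₁ T₂) sumSnd_sumInr
            sumSnd_sumInl (pathSnd _ p.2) (pathSnd _ p.1))
  have he' : Function.Bijective e' := by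
    refine Function.bijective_iff_has_inverse.2 ⟨fun p => (sumInl T₁ T₂).compLpL 2 volume p.1 +
      (sumInr T₁ T₂).compLpL 2 volume p.2,
      compLpL_add_compLpL_eq_self (sumFst T₁ T₂) (sumSnd T₁ T₂)
          (sumInl T₁ T₂) (sumInr T₁ T₂) sumInl_add_sumInr, fun p => Prod.ext ?_ ?_⟩
    · exact compLpL_add_eq_fst (sumFst T₁ T₂) (sumInl T₁ T₂) (sumInr T₁ T₂) sumFst_sumInl
          sumFst_sumInr p.1 p.2
    · exact (compLpL_add_eq_snd (sumSnd T₁ T₂) (sumInr T₁ T₂) (sumInl T₁ T₂) sumSnd_sumInr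
            sumSnd_sumInl p.2 p.1)
  have hp := linearIndex_prodMap (hasFiniteIndex_of_mem_admissiblePaths A₁.2)
    (hasFiniteIndex_of_mem_admissiblePaths A₂.2)
  rw [pathIndex, pathIndex, pathIndex, ← hp.2]
  refine linearIndex_conj (hasFiniteIndex_of_mem_admissiblePaths A.2) hp.1 e e' he he' ?_
  refine LinearMap.ext fun p => Prod.ext ?_ ?_
  · exact pathOp_pathMap (L := domFst T₁ T₂) (l := sumFst T₁ T₂) (fun w => rfl)
      (A := A.1) (A' := A₁.1) (fun t w => (congrArg (sumFst T₁ T₂) (h t w)).symm) p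
  · exact pathOp_pathMap (L := domSnd T₁ T₂) (l := sumSnd T₁ T₂) (fun w => rfl)
      (A := A.1) (A' := A₂.1) (fun t w => (congrArg (sumSnd T₁ T₂) (h t w)).symm) p

end DirectSum

open ReferenceOperator

/-! ## Catenation -/

section Sandwich

variable {W H W₁ H₁ W₂ H₂ : Type*}
  [NormedAddCommGroup W] [InnerProductSpace ℝ W] [NormedAddCommGroup H] [InnerProductSpace ℝ H]
  [NormedAddCommGroup W₁] [InnerProductSpace ℝ W₁] [NormedAddCommGroup H₁]
  [InnerProductSpace ℝ H₁] [NormedAddCommGroup W₂] [InnerProductSpace ℝ W₂]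
  [NormedAddCommGroup H₂] [InnerProductSpace ℝ H₂]

/-- The map `a ↦ i ∘ a ∘ q`. -/
def sandwich (i : H₁ →L[ℝ] H) (q : W →L[ℝ] W₁) : (W₁ →L[ℝ] H₁) →L[ℝ] (W →L[ℝ] H) :=
  (ContinuousLinearMap.compL ℝ W H₁ H i).comp ((ContinuousLinearMap.compL ℝ W W₁ H₁).flip q)

theorem sandwich_apply (i : H₁ →L[ℝ] H) (q : W →L[ℝ] W₁) (a : W₁ →L[ℝ] H₁) (w : W) :
    sandwich i q a w = i (a (q w)) := rfl

theorem isCompactOperator_sandwich (i : H₁ →L[ℝ] H) (q : W →L[ℝ] W₁) {a : W₁ →L[ℝ] H₁}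
    (ha : IsCompactOperator a) : IsCompactOperator (sandwich i q a) :=
  (ha.comp_clm q).clm_comp i

/-- The hypothesis expresses that i is the adjoint of q relative to the two inclusions, so that i a
q is a congruence transform of a. -/
theorem isSymmetricAlong_sandwich {ι : W →L[ℝ] H} {ι₁ : W₁ →L[ℝ] H₁} {i : H₁ →L[ℝ] H}
    {q : W →L[ℝ] W₁} (h : ∀ x w, ⟪i x, ι w⟫_ℝ = ⟪x, ι₁ (q w)⟫_ℝ) {a : W₁ →L[ℝ] H₁}
    (ha : IsSymmetricAlong ι₁ a) : IsSymmetricAlong ι (sandwich i q a) := fun x y => by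
  rw [sandwich_apply, sandwich_apply, h, real_inner_comm _ (ι x), h, ha, real_inner_comm]

/-- The direct sum of two invertible operators, with respect to decompositions of the domain
and the codomain. -/
theorem isInvertible_sandwich_add {q₁ : W →L[ℝ] W₁} {q₂ : W →L[ℝ] W₂} {k₁ : W₁ →L[ℝ] W}
    {k₂ : W₂ →L[ℝ] W} {r₁ : H →L[ℝ] H₁} {r₂ : H →L[ℝ] H₂} {i₁ : H₁ →L[ℝ] H} {i₂ : H₂ →L[ℝ] H}
    (hqk : ∀ w, k₁ (q₁ w) + k₂ (q₂ w) = w) (hri : ∀ x, i₁ (r₁ x) + i₂ (r₂ x) = x)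
    (q11 : ∀ w, q₁ (k₁ w) = w) (q12 : ∀ w, q₁ (k₂ w) = 0) (q21 : ∀ w, q₂ (k₁ w) = 0)
    (q22 : ∀ w, q₂ (k₂ w) = w) (r11 : ∀ x, r₁ (i₁ x) = x) (r12 : ∀ x, r₁ (i₂ x) = 0)
    (r21 : ∀ x, r₂ (i₁ x) = 0) (r22 : ∀ x, r₂ (i₂ x) = x) {a : W₁ →L[ℝ] H₁} {b : W₂ →L[ℝ] H₂}
    (ha : a.IsInvertible) (hb : b.IsInvertible) :
    (sandwich i₁ q₁ a + sandwich i₂ q₂ b).IsInvertible := by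
  refine ContinuousLinearMap.IsInvertible.of_inverse
    (g := k₁.comp (a.inverse.comp r₁) + k₂.comp (b.inverse.comp r₂)) ?_ ?_
  · ext x
    simp only [ContinuousLinearMap.comp_apply, add_apply, sandwich_apply, map_add, q11, q12, q21,
      q22, map_zero, add_zero, zero_add, ha.self_apply_inverse, hb.self_apply_inverse, hri,
      ContinuousLinearMap.id_apply]
  · ext w
    simp only [ContinuousLinearMap.comp_apply, add_apply, sandwich_apply, map_add, r11, r12, r21,
      r22, map_zero, add_zero, zero_add, ha.inverse_apply_self, hb.inverse_apply_self, hqk,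
      ContinuousLinearMap.id_apply]

end Sandwich

section Diagonal

variable {T₁ T₂ : ReferenceOperator.{u}}

theorem inner_sumInl_incl (x : T₁.H) (w : (T₁.prod T₂).W) :
    ⟪sumInl T₁ T₂ x, (T₁.prod T₂).incl w⟫_ℝ = ⟪x, T₁.incl (domFst T₁ T₂ w)⟫_ℝ := by
  rw [inner_sum, sumFst_sumInl, sumSnd_sumInl, inner_zero_left, add_zero, sumFst_incl]

theorem inner_sumInr_incl (x : T₂.H) (w : (T₁.prod T₂).W) :
    ⟪sumInr T₁ T₂ x, (T₁.prod T₂).incl w⟫_ℝ = ⟪x, T₂.incl (domSnd T₁ T₂ w)⟫_ℝ := by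
  rw [inner_sum, sumFst_sumInr, sumSnd_sumInr, inner_zero_left, zero_add, sumSnd_incl]

/-- The direct sum of two operators. -/
def diagOp (a : T₁.W →L[ℝ] T₁.H) (b : T₂.W →L[ℝ] T₂.H) : (T₁.prod T₂).W →L[ℝ] (T₁.prod T₂).H :=
  sandwich (sumInl T₁ T₂) (domFst T₁ T₂) a + sandwich (sumInr T₁ T₂) (domSnd T₁ T₂) b

theorem diagOp_apply (a : T₁.W →L[ℝ] T₁.H) (b : T₂.W →L[ℝ] T₂.H) (w : (T₁.prod T₂).W) :
    diagOp a b w = WithLp.toLp 2 (a (prodFst T₁.op T₂.op w), b (prodSnd T₁.op T₂.op w)) :=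
  sum_ext (add_zero _) (zero_add _)

theorem sumFst_diagOp (a : T₁.W →L[ℝ] T₁.H) (b : T₂.W →L[ℝ] T₂.H) (w : (T₁.prod T₂).W) :
    sumFst T₁ T₂ (diagOp a b w) = a (domFst T₁ T₂ w) := by rw [diagOp_apply]; rfl

theorem sumSnd_diagOp (a : T₁.W →L[ℝ] T₁.H) (b : T₂.W →L[ℝ] T₂.H) (w : (T₁.prod T₂).W) :
    sumSnd T₁ T₂ (diagOp a b w) = b (domSnd T₁ T₂ w) := by rw [diagOp_apply]; rfl

theorem isAdmissible_diagOp {a : T₁.W →L[ℝ] T₁.H} {b : T₂.W →L[ℝ] T₂.H} (ha : T₁.IsAdmissible a)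
    (hb : T₂.IsAdmissible b) : (T₁.prod T₂).IsAdmissible (diagOp a b) := by
  obtain ⟨ha1, ha2⟩ := isAdmissible_iff.1 ha
  obtain ⟨hb1, hb2⟩ := isAdmissible_iff.1 hb
  refine isAdmissible_iff.2 ⟨?_, (isSymmetricAlong_sandwich inner_sumInl_incl ha2).add
    (isSymmetricAlong_sandwich inner_sumInr_incl hb2)⟩
  have e : (T₁.prod T₂).base = diagOp T₁.base T₂.base :=
    ContinuousLinearMap.ext fun w => sum_ext (add_zero _).symm (zero_add _).symm
  have e' : diagOp a b - (T₁.prod T₂).base =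
      sandwich (sumInl T₁ T₂) (domFst T₁ T₂) (a - T₁.base) +
        sandwich (sumInr T₁ T₂) (domSnd T₁ T₂) (b - T₂.base) := by
    rw [e, diagOp, diagOp, map_sub, map_sub]
    abel
  rw [e']
  exact (isCompactOperator_sandwich _ _ ha1).add (isCompactOperator_sandwich _ _ hb1)

theorem isInvertible_diagOp {a : T₁.W →L[ℝ] T₁.H} {b : T₂.W →L[ℝ] T₂.H} (ha : a.IsInvertible)
    (hb : b.IsInvertible) : (diagOp a b).IsInvertible :=
  isInvertible_sandwich_add (k₁ := domInl T₁ T₂) (k₂ := domInr T₁ T₂) (r₁ := sumFst T₁ T₂)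
    (r₂ := sumSnd T₁ T₂) domInl_add_domInr sumInl_add_sumInr domFst_domInl domFst_domInr
    domSnd_domInl domSnd_domInr sumFst_sumInl sumFst_sumInr sumSnd_sumInl sumSnd_sumInr ha hb

/-- Composition of an operator valued function with a continuous linear map. -/
def bcfMap {V V' : Type*} [NormedAddCommGroup V] [NormedSpace ℝ V] [NormedAddCommGroup V']
    [NormedSpace ℝ V'] (g : V →L[ℝ] V') (f : ℝ →ᵇ V) : ℝ →ᵇ V' :=
  g.compLeftContinuousBounded ℝ f

/-- The direct sum of two paths. -/
def diagPath (A : ℝ →ᵇ (T₁.W →L[ℝ] T₁.H)) (B : ℝ →ᵇ (T₂.W →L[ℝ] T₂.H)) :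
    ℝ →ᵇ ((T₁.prod T₂).W →L[ℝ] (T₁.prod T₂).H) :=
  bcfMap (sandwich (sumInl T₁ T₂) (domFst T₁ T₂)) A +
    bcfMap (sandwich (sumInr T₁ T₂) (domSnd T₁ T₂)) B

theorem tendsto_diagOp {l : Filter ℝ} {A : ℝ → (T₁.W →L[ℝ] T₁.H)} {B : ℝ → (T₂.W →L[ℝ] T₂.H)}
    {a : T₁.W →L[ℝ] T₁.H} {b : T₂.W →L[ℝ] T₂.H} (hA : Tendsto A l (𝓝 a))
    (hB : Tendsto B l (𝓝 b)) : Tendsto (fun t => diagOp (A t) (B t)) l (𝓝 (diagOp a b)) := by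
  have h1 := ((sandwich (sumInl T₁ T₂) (domFst T₁ T₂)).continuous.tendsto a).comp hA
  have h2 := ((sandwich (sumInr T₁ T₂) (domSnd T₁ T₂)).continuous.tendsto b).comp hB
  exact h1.add h2

theorem diagPath_mem {A : ℝ →ᵇ (T₁.W →L[ℝ] T₁.H)} {B : ℝ →ᵇ (T₂.W →L[ℝ] T₂.H)}
    (hA : A ∈ T₁.admissiblePaths) (hB : B ∈ T₂.admissiblePaths) :
    diagPath A B ∈ (T₁.prod T₂).admissiblePaths := by
  obtain ⟨a1, ⟨am, am1, am2⟩, ⟨ap, ap1, ap2⟩⟩ := hA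
  obtain ⟨b1, ⟨bm, bm1, bm2⟩, ⟨bp, bp1, bp2⟩⟩ := hB
  exact ⟨fun t => isAdmissible_diagOp (a1 t) (b1 t),
    ⟨_, isInvertible_diagOp am1 bm1, tendsto_diagOp am2 bm2⟩,
    ⟨_, isInvertible_diagOp ap1 bp1, tendsto_diagOp ap2 bp2⟩⟩

theorem const_mem_admissiblePaths {T : ReferenceOperator.{u}} {B : T.W →L[ℝ] T.H}
    (hB : T.IsAdmissible B) (hi : B.IsInvertible) :
    BoundedContinuousFunction.const ℝ B ∈ T.admissiblePaths :=
  ⟨fun _ => hB, ⟨B, hi, tendsto_const_nhds⟩, ⟨B, hi, tendsto_const_nhds⟩⟩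

end Diagonal

section Catenation

variable {T : ReferenceOperator.{u}}

/-- The projection `(w₁, w₂) ↦ s w₁ + c w₂`. -/
def rotProj (s c : ℝ) : (T.prod T).W →L[ℝ] T.W := s • domFst T T + c • domSnd T T

/-- The inclusion `w ↦ (s w, c w)`. -/
def rotIncl (s c : ℝ) : T.W →L[ℝ] (T.prod T).W := s • domInl T T + c • domInr T T

/-- The projection `(x₁, x₂) ↦ s x₁ + c x₂`. -/
def rotProj' (s c : ℝ) : (T.prod T).H →L[ℝ] T.H := s • sumFst T T + c • sumSnd T T

/-- The inclusion `x ↦ (s x, c x)`. -/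
def rotIncl' (s c : ℝ) : T.H →L[ℝ] (T.prod T).H := s • sumInl T T + c • sumInr T T

theorem rotProj_apply (s c : ℝ) (w : (T.prod T).W) :
    rotProj s c w = s • domFst T T w + c • domSnd T T w := rfl

theorem rotProj'_apply (s c : ℝ) (x : (T.prod T).H) :
    rotProj' s c x = s • sumFst T T x + c • sumSnd T T x := rfl

theorem domFst_rotIncl (s c : ℝ) (w : T.W) : domFst T T (rotIncl s c w) = s • w := by
  change domFst T T (s • domInl T T w + c • domInr T T w) = _
  rw [map_add, map_smul, map_smul, domFst_domInl, domFst_domInr, smul_zero, add_zero]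

theorem domSnd_rotIncl (s c : ℝ) (w : T.W) : domSnd T T (rotIncl s c w) = c • w := by
  change domSnd T T (s • domInl T T w + c • domInr T T w) = _
  rw [map_add, map_smul, map_smul, domSnd_domInl, domSnd_domInr, smul_zero, zero_add]

theorem sumFst_rotIncl' (s c : ℝ) (x : T.H) : sumFst T T (rotIncl' s c x) = s • x := by
  change sumFst T T (s • sumInl T T x + c • sumInr T T x) = _
  rw [map_add, map_smul, map_smul, sumFst_sumInl, sumFst_sumInr, smul_zero, add_zero]

theorem sumSnd_rotIncl' (s c : ℝ) (x : T.H) : sumSnd T T (rotIncl' s c x) = c • x := by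
  change sumSnd T T (s • sumInl T T x + c • sumInr T T x) = _
  rw [map_add, map_smul, map_smul, sumSnd_sumInl, sumSnd_sumInr, smul_zero, zero_add]

theorem rotProj_rotIncl (s c s' c' : ℝ) (w : T.W) :
    rotProj s c (rotIncl s' c' w) = (s * s' + c * c') • w := by
  rw [rotProj_apply, domFst_rotIncl, domSnd_rotIncl, smul_smul, smul_smul, add_smul]

theorem rotProj'_rotIncl' (s c s' c' : ℝ) (x : T.H) :
    rotProj' s c (rotIncl' s' c' x) = (s * s' + c * c') • x := by
  rw [rotProj'_apply, sumFst_rotIncl', sumSnd_rotIncl', smul_smul, smul_smul, add_smul]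

theorem inner_rotIncl' (s c : ℝ) (x : T.H) (w : (T.prod T).W) :
    ⟪rotIncl' s c x, (T.prod T).incl w⟫_ℝ = ⟪x, T.incl (rotProj s c w)⟫_ℝ := by
  rw [inner_sum, sumFst_rotIncl', sumSnd_rotIncl', sumFst_incl, sumSnd_incl, rotProj_apply,
    map_add, map_smul, map_smul, inner_add_right, inner_smul_left, inner_smul_left,
    inner_smul_right, inner_smul_right]
  rfl

/-- In the orthonormal frame (s, c), (c, -s) of ℝ² the operator is a along the first direction and b
along the second: it is a rotated copy of a ⊕ b. -/
theorem isInvertible_rotate {s c : ℝ} (h : s * s + c * c = 1) {a b : T.W →L[ℝ] T.H}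
    (ha : a.IsInvertible) (hb : b.IsInvertible) :
    (diagOp b b + sandwich (rotIncl' s c) (rotProj s c) (a - b)).IsInvertible := by
  have e : diagOp b b + sandwich (rotIncl' s c) (rotProj s c) (a - b) =
      sandwich (rotIncl' s c) (rotProj s c) a +
        sandwich (rotIncl' c (-s)) (rotProj c (-s)) b := by
    refine ContinuousLinearMap.ext fun w => sum_ext ?_ ?_
    · change sumFst T T (sumInl T T (b (domFst T T w)) + sumInr T T (b (domSnd T T w)) +
        rotIncl' s c ((a - b) (rotProj s c w))) = sumFst T T (rotIncl' s c (a (rotProj s c w)) +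
        rotIncl' c (-s) (b (rotProj c (-s) w)))
      simp only [map_add, sumFst_sumInl, sumFst_sumInr, sumFst_rotIncl', sub_apply, rotProj_apply,
        map_smul, smul_sub, smul_smul]
      refine sub_eq_zero.1 (Eq.trans ?_ (zero_smul ℝ (b (domFst T T w))))
      rw [← sub_eq_zero.2 h.symm]
      module
    · change sumSnd T T (sumInl T T (b (domFst T T w)) + sumInr T T (b (domSnd T T w)) +
        rotIncl' s c ((a - b) (rotProj s c w))) = sumSnd T T (rotIncl' s c (a (rotProj s c w)) +
        rotIncl' c (-s) (b (rotProj c (-s) w)))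
      simp only [map_add, sumSnd_sumInl, sumSnd_sumInr, sumSnd_rotIncl', sub_apply, rotProj_apply,
        map_smul, smul_sub, smul_smul]
      refine sub_eq_zero.1 (Eq.trans ?_ (zero_smul ℝ (b (domSnd T T w))))
      rw [← sub_eq_zero.2 h.symm]
      module
  rw [e]
  have h' : c * c + -s * -s = 1 := by linarith
  refine isInvertible_sandwich_add (k₁ := rotIncl s c) (k₂ := rotIncl c (-s))
    (r₁ := rotProj' s c) (r₂ := rotProj' c (-s)) (fun w => dom_ext ?_ ?_) (fun x => sum_ext ?_ ?_)
    ?_ ?_ ?_ ?_ ?_ ?_ ?_ ?_ ha hb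
  · rw [map_add, domFst_rotIncl, domFst_rotIncl, rotProj_apply, rotProj_apply]
    refine sub_eq_zero.1 (Eq.trans ?_ (zero_smul ℝ (domFst T T w)))
    rw [← sub_eq_zero.2 h]
    module
  · rw [map_add, domSnd_rotIncl, domSnd_rotIncl, rotProj_apply, rotProj_apply]
    refine sub_eq_zero.1 (Eq.trans ?_ (zero_smul ℝ (domSnd T T w)))
    rw [← sub_eq_zero.2 h]
    module
  · rw [map_add, sumFst_rotIncl', sumFst_rotIncl', rotProj'_apply, rotProj'_apply]
    refine sub_eq_zero.1 (Eq.trans ?_ (zero_smul ℝ (sumFst T T x)))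
    rw [← sub_eq_zero.2 h]
    module
  · rw [map_add, sumSnd_rotIncl', sumSnd_rotIncl', rotProj'_apply, rotProj'_apply]
    refine sub_eq_zero.1 (Eq.trans ?_ (zero_smul ℝ (sumSnd T T x)))
    rw [← sub_eq_zero.2 h]
    module
  · intro w; rw [rotProj_rotIncl, h, one_smul]
  · intro w; rw [rotProj_rotIncl, show s * c + c * -s = 0 by ring, zero_smul]
  · intro w; rw [rotProj_rotIncl, show c * s + -s * c = 0 by ring, zero_smul]
  · intro w; rw [rotProj_rotIncl, h', one_smul]
  · intro w; rw [rotProj'_rotIncl', h, one_smul]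
  · intro w; rw [rotProj'_rotIncl', show s * c + c * -s = 0 by ring, zero_smul]
  · intro w; rw [rotProj'_rotIncl', show c * s + -s * c = 0 by ring, zero_smul]
  · intro w; rw [rotProj'_rotIncl', h', one_smul]

/-- A linear combination of bounded continuous functions. -/
def bcfComb {V : Type*} [NormedAddCommGroup V] [NormedSpace ℝ V] (f₀ f₁ f₂ f₃ f₄ : ℝ →ᵇ V)
    (a b c d : ℝ) : ℝ →ᵇ V := f₀ + (a • f₁ + b • f₂ + (c • f₃ + d • f₄))

theorem continuous_bcfComb {V : Type*} [NormedAddCommGroup V] [NormedSpace ℝ V]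
    (f₀ f₁ f₂ f₃ f₄ : ℝ →ᵇ V) {a b c d : ℝ → ℝ} (ha : Continuous a) (hb : Continuous b)
    (hc : Continuous c) (hd : Continuous d) :
    Continuous fun x => bcfComb f₀ f₁ f₂ f₃ f₄ (a x) (b x) (c x) (d x) :=
  continuous_const.add (((ha.smul continuous_const).add (hb.smul continuous_const)).add
    ((hc.smul continuous_const).add (hd.smul continuous_const)))

/-- The difference of a bounded continuous function and a constant. -/
def bcfSubConst {V : Type*} [NormedAddCommGroup V] (f : ℝ →ᵇ V) (b : V) : ℝ →ᵇ V :=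
  f - BoundedContinuousFunction.const ℝ b

set_option maxHeartbeats 1000000 in
-- With b = A(0), the path A equals A_l + (A_r - b), since A_r = b on the left half-line and A_l = b
-- on the right. Rotating the perturbation A_r - b from the second copy of H to the first deforms
-- A_l ⊕ A_r into A ⊕ b. On the left half-line the rotation has no effect, and on the right the
-- limit is a rotated copy of an invertible direct sum.
theorem pathIndex_catenation (A Al Ar : T.admissiblePaths)
    (h : ∀ t, 0 ≤ t → Al.1 t = A.1 0 ∧ Ar.1 (-t) = A.1 0)
    (hl : ∀ t, t ≤ 0 → A.1 t = Al.1 t) (hr : ∀ t, 0 ≤ t → A.1 t = Ar.1 t) :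
    pathIndex T A = pathIndex T Al + pathIndex T Ar := by
  set b := A.1 0
  have hAl : ∀ t, 0 ≤ t → Al.1 t = b := fun t ht => (h t ht).1
  have hAr : ∀ t, t ≤ 0 → Ar.1 t = b := fun t ht => by
    have := (h (-t) (by linarith)).2
    rwa [neg_neg] at this
  have hbadm : T.IsAdmissible b := A.2.1 0
  -- The path A_l is constantly b on the right half-line, so b is one of its limits.
  have hbinv : b.IsInvertible := by
    obtain ⟨B, hB, hBt⟩ := Al.2.2.2
    have : Tendsto Al.1 atTop (𝓝 b) :=
      tendsto_const_nhds.congr' ((eventually_ge_atTop 0).mono fun t ht => (hAl t ht).symm)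
    rwa [tendsto_nhds_unique hBt this] at hB
  let N : ℝ →ᵇ (T.W →L[ℝ] T.H) := bcfSubConst Ar.1 b
  have hN : ∀ t, N t = Ar.1 t - b := fun t => rfl
  have hNc : ∀ t, IsCompactOperator (N t) := fun t => (Ar.2.1 t).isCompactOperator_sub hbadm
  have hNs : ∀ t, IsSymmetricAlong T.incl (N t) := fun t =>
    (Ar.2.1 t).isSymmetricAlong.sub hbadm.isSymmetricAlong
  let i₁ := sumInl T T
  let i₂ := sumInr T T
  let q₁ := domFst T T
  let q₂ := domSnd T T
  let F : (T.H →L[ℝ] (T.prod T).H) → ((T.prod T).W →L[ℝ] T.W) →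
      ℝ →ᵇ ((T.prod T).W →L[ℝ] (T.prod T).H) := fun i q =>
    bcfMap (V := T.W →L[ℝ] T.H) (V' := (T.prod T).W →L[ℝ] (T.prod T).H) (sandwich i q) N
  -- The rotated perturbation is expanded into its four matrix entries, with coefficients the
  -- products of s and c. In this form continuity in s and c for the supremum norm is immediate.
  let P : ℝ → ℝ → ℝ →ᵇ ((T.prod T).W →L[ℝ] (T.prod T).H) := fun s c =>
    bcfComb (V := (T.prod T).W →L[ℝ] (T.prod T).H)
      (diagPath Al.1 (BoundedContinuousFunction.const ℝ b)) (F i₁ q₁) (F i₁ q₂) (F i₂ q₁) (F i₂ q₂)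
      (s * s) (s * c) (c * s) (c * c)
  have hP : ∀ s c t, P s c t = diagOp (Al.1 t) b + sandwich (rotIncl' s c) (rotProj s c) (N t) := by
    intro s c t
    refine congrArg (diagOp (Al.1 t) b + ·) (ContinuousLinearMap.ext fun w => ?_)
    change (s * s) • i₁ (N t (q₁ w)) + (s * c) • i₁ (N t (q₂ w)) +
      ((c * s) • i₂ (N t (q₁ w)) + (c * c) • i₂ (N t (q₂ w))) =
      s • i₁ (N t (s • q₁ w + c • q₂ w)) + c • i₂ (N t (s • q₁ w + c • q₂ w))
    simp only [map_add, map_smul]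
    module
  have hPmem : ∀ s c, s * s + c * c = 1 → P s c ∈ (T.prod T).admissiblePaths := by
    intro s c hsc
    refine ⟨fun t => ?_, ?_, ?_⟩
    · rw [hP]
      exact (isAdmissible_diagOp (Al.2.1 t) hbadm).add (isCompactOperator_sandwich _ _ (hNc t))
        (isSymmetricAlong_sandwich (inner_rotIncl' s c) (hNs t))
    · obtain ⟨B, hB, hBt⟩ := Al.2.2.1
      refine ⟨diagOp B b, isInvertible_diagOp hB hbinv, ?_⟩
      refine (tendsto_diagOp hBt tendsto_const_nhds).congr'
        ((eventually_le_atBot 0).mono fun t ht => ?_)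
      rw [hP, hN, hAr t ht, sub_self, map_zero, add_zero]
    · obtain ⟨B, hB, hBt⟩ := Ar.2.2.2
      refine ⟨_, isInvertible_rotate hsc hB hbinv, ?_⟩
      have h1 := ((sandwich (rotIncl' (T := T) s c) (rotProj s c)).continuous.tendsto _).comp
        (hBt.sub_const b)
      refine (h1.const_add (diagOp b b)).congr'
        ((eventually_ge_atTop 0).mono fun t ht => ?_)
      rw [hP, hN, hAl t ht]
      rfl
  have hPc : Continuous fun x : ℝ => P (Real.sin (Real.pi / 2 * x)) (Real.cos (Real.pi / 2 * x)) :=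
    continuous_bcfComb _ _ _ _ _ (by fun_prop) (by fun_prop) (by fun_prop) (by fun_prop)
  have hsc : ∀ x : ℝ, Real.sin x * Real.sin x + Real.cos x * Real.cos x = 1 := fun x => by
    rw [← sq, ← sq, Real.sin_sq_add_cos_sq]
  have hb0 := const_mem_admissiblePaths hbadm hbinv
  let P₀ : (T.prod T).admissiblePaths := ⟨diagPath Al.1 Ar.1, diagPath_mem Al.2 Ar.2⟩
  let P₁ : (T.prod T).admissiblePaths := ⟨diagPath A.1 _, diagPath_mem A.2 hb0⟩
  have e0 : pathIndex (T.prod T) P₀ = pathIndex T Al + pathIndex T Ar :=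
    pathIndex_directSum Al Ar P₀ fun t w => diagOp_apply _ _ _
  have e1 : pathIndex (T.prod T) P₁ = pathIndex T A + pathIndex T ⟨_, hb0⟩ :=
    pathIndex_directSum A ⟨_, hb0⟩ P₁ fun t w => diagOp_apply _ _ _
  have e2 : pathIndex T ⟨_, hb0⟩ = 0 := pathIndex_eq_zero_of_const fun t => rfl
  have e3 : pathIndex (T.prod T) P₀ = pathIndex (T.prod T) P₁ := by
    refine pathIndex_eq_of_mem_connectedComponent (mem_connectedComponent_of_homotopy hPc
      (fun x _ => hPmem _ _ (hsc _)) ?_ ?_)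
    · ext1 t
      change P _ _ t = diagOp (Al.1 t) (Ar.1 t)
      rw [mul_zero, Real.sin_zero, Real.cos_zero, hP, hN]
      refine ContinuousLinearMap.ext fun w => sum_ext ?_ ?_
      · rw [add_apply, map_add, sandwich_apply, sumFst_rotIncl', zero_smul, add_zero,
          sumFst_diagOp, sumFst_diagOp]
      · rw [add_apply, map_add, sandwich_apply, sumSnd_rotIncl', one_smul, sumSnd_diagOp,
          sumSnd_diagOp, rotProj_apply, zero_smul, zero_add, one_smul, sub_apply, add_sub_cancel]
    · ext1 t
      change P _ _ t = diagOp (A.1 t) b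
      rw [mul_one, Real.sin_pi_div_two, Real.cos_pi_div_two, hP, hN]
      have hA : A.1 t = Al.1 t + (Ar.1 t - b) := by
        rcases le_total t 0 with ht | ht
        · rw [hl t ht, hAr t ht, sub_self, add_zero]
        · rw [hr t ht, hAl t ht, add_sub_cancel]
      refine ContinuousLinearMap.ext fun w => sum_ext ?_ ?_
      · rw [add_apply, map_add, sandwich_apply, sumFst_rotIncl', one_smul, sumFst_diagOp,
          sumFst_diagOp, rotProj_apply, zero_smul, add_zero, one_smul, hA, add_apply]
      · rw [add_apply, map_add, sandwich_apply, sumSnd_rotIncl', zero_smul, add_zero,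
          sumSnd_diagOp, sumSnd_diagOp]
  rw [← e0, e3, e1, e2, add_zero]

end Catenation

/-! ## The path `arctan` on a line -/

/-- A primitive of `arctan`. -/
def arctanPrimitive (t : ℝ) : ℝ := t * Real.arctan t - Real.log (1 + t ^ 2) / 2

theorem hasDerivAt_arctanPrimitive (t : ℝ) : HasDerivAt arctanPrimitive (Real.arctan t) t := by
  have h0 : (1 + t ^ 2 : ℝ) ≠ 0 := by positivity
  have h1 := (hasDerivAt_id t).mul (Real.hasDerivAt_arctan t)
  have h2 : HasDerivAt (fun t : ℝ => Real.log (1 + t ^ 2) / 2) (2 * t / (1 + t ^ 2) / 2) t := by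
    have h3 : HasDerivAt (fun t : ℝ => 1 + t ^ 2) (2 * t) t := by
      simpa using (hasDerivAt_pow 2 t).const_add 1
    exact (h3.log h0).div_const 2
  refine (h1.sub h2).congr_deriv ?_
  simp only [id]
  field_simp
  ring

theorem contDiff_arctanPrimitive : ContDiff ℝ ∞ arctanPrimitive := by
  have h1 : ContDiff ℝ ∞ fun t : ℝ => Real.log (1 + t ^ 2) :=
    ContDiff.log (by fun_prop) fun t => by positivity
  exact (contDiff_id.mul Real.contDiff_arctan).sub (h1.div_const 2)

/-- The derivative arctan is increasing, so the function is convex and lies above its tangents. -/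
theorem arctanPrimitive_tangent (s t : ℝ) :
    arctanPrimitive s + Real.arctan s * (t - s) ≤ arctanPrimitive t := by
  have hc : ContinuousOn arctanPrimitive Set.univ := contDiff_arctanPrimitive.continuous.continuousOn
  have hd : Differentiable ℝ arctanPrimitive := fun x =>
    (hasDerivAt_arctanPrimitive x).differentiableAt
  have hd' : deriv arctanPrimitive = Real.arctan :=
    funext fun x => (hasDerivAt_arctanPrimitive x).deriv
  rcases le_total s t with h | h
  · have := (convex_Icc s t).mul_sub_le_image_sub_of_le_deriv (hc.mono (Set.subset_univ _))
      hd.differentiableOn (C := Real.arctan s) (fun x hx => by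
        rw [interior_Icc] at hx
        rw [hd']; exact Real.arctan_mono hx.1.le) s ⟨le_rfl, h⟩ t ⟨h, le_rfl⟩ h
    linarith
  · have := (convex_Icc t s).image_sub_le_mul_sub_of_deriv_le (hc.mono (Set.subset_univ _))
      hd.differentiableOn (C := Real.arctan s) (fun x hx => by
        rw [interior_Icc] at hx
        rw [hd']; exact Real.arctan_mono hx.2.le) t ⟨le_rfl, h⟩ s ⟨h, le_rfl⟩ h
    linarith

theorem arctanPrimitive_nonneg (t : ℝ) : 0 ≤ arctanPrimitive t := by
  have := arctanPrimitive_tangent 0 t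
  simpa [arctanPrimitive] using this

/-- The tangents at 1 and -1 have slopes π/4 and -π/4. The resulting linear growth makes exp(-G)
square integrable. -/
theorem le_arctanPrimitive (t : ℝ) :
    Real.pi / 4 * |t| - Real.log 2 / 2 ≤ arctanPrimitive t := by
  have h1 : arctanPrimitive 1 = Real.pi / 4 - Real.log 2 / 2 := by
    simp only [arctanPrimitive, Real.arctan_one]; norm_num
  have h2 : arctanPrimitive (-1) = Real.pi / 4 - Real.log 2 / 2 := by
    simp only [arctanPrimitive, Real.arctan_neg, Real.arctan_one]; norm_num
  rcases abs_cases t with ⟨h, -⟩ | ⟨h, -⟩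
  · have := arctanPrimitive_tangent 1 t
    rw [h1, Real.arctan_one] at this
    rw [h]; linarith
  · have := arctanPrimitive_tangent (-1) t
    rw [h2, Real.arctan_neg, Real.arctan_one] at this
    rw [h]; linarith

theorem continuous_exp_arctanPrimitive (σ : ℝ) :
    Continuous fun t => Real.exp (σ * arctanPrimitive t) :=
  Real.continuous_exp.comp (contDiff_arctanPrimitive.continuous.const_mul σ)

theorem integrable_exp_neg_mul_abs {b : ℝ} (hb : 0 < b) :
    Integrable fun t : ℝ => Real.exp (-b * |t|) := by
  rw [← integrableOn_univ, ← Set.Iic_union_Ioi (a := (0 : ℝ)), integrableOn_union]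
  constructor
  · refine (integrableOn_exp_mul_Iic hb 0).congr_fun (fun t ht => ?_) measurableSet_Iic
    simp only [abs_of_nonpos (Set.mem_Iic.1 ht), neg_mul_neg]
  · refine (integrableOn_exp_mul_Ioi (neg_lt_zero.2 hb) 0).congr_fun (fun t ht => ?_)
      measurableSet_Ioi
    simp only [abs_of_pos (Set.mem_Ioi.1 ht)]

theorem memLp_exp_arctanPrimitive :
    MemLp (fun t => Real.exp (-1 * arctanPrimitive t)) 2 volume := by
  refine (memLp_two_iff_integrable_sq
    (continuous_exp_arctanPrimitive (-1)).aestronglyMeasurable).2 ?_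
  have h1 : Integrable fun t : ℝ => Real.exp (-(Real.pi / 2) * |t|) * 2 :=
    (integrable_exp_neg_mul_abs (by positivity)).mul_const 2
  refine h1.mono' ((continuous_exp_arctanPrimitive (-1)).pow 2).aestronglyMeasurable
    (Eventually.of_forall fun t => ?_)
  rw [Real.norm_of_nonneg (by positivity), ← Real.exp_nat_mul]
  have h2 : (2 : ℝ) = Real.exp (Real.log 2) := (Real.exp_log (by norm_num)).symm
  nth_rw 2 [h2]
  rw [← Real.exp_add, Real.exp_le_exp]
  have := le_arctanPrimitive t
  push_cast
  linarith

/-- Solutions of `f' = σ arctan f` in the sense of distributions. -/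
theorem exists_ae_eq_exp {σ : ℝ} {f : Lp ℝ 2 (volume : Measure ℝ)}
    (h : ∀ φ : ℝ → ℝ, ContDiff ℝ ∞ φ → HasCompactSupport φ →
      ∫ t, (deriv φ t + σ * Real.arctan t * φ t) * f t = 0) :
    ∃ c : ℝ, f =ᵐ[volume] fun t => c * Real.exp (σ * arctanPrimitive t) := by
  -- The integrating factor exp(-σG) turns the equation into (exp(-σG) f)' = 0: the equation for f
  -- is tested with ψ exp(-σG), and the lemma of du Bois-Reymond applies.
  have hl : LocallyIntegrable (fun t => Real.exp (-σ * arctanPrimitive t) * f t) volume :=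
    (locallyIntegrable_Lp f).continuous_mul (continuous_exp_arctanPrimitive (-σ))
  obtain ⟨c, hc⟩ := exists_ae_eq_const hl fun ψ hψ hψc => by
    have hE : ContDiff ℝ ∞ fun t => Real.exp (-σ * arctanPrimitive t) :=
      Real.contDiff_exp.comp (contDiff_const.mul contDiff_arctanPrimitive)
    rw [← h (fun t => ψ t * Real.exp (-σ * arctanPrimitive t)) (hψ.mul hE) hψc.mul_right]
    refine integral_congr_ae (Eventually.of_forall fun t => ?_)
    have h1 := ((hψ.differentiable (by simp)) t).hasDerivAt.mul
      (((hasDerivAt_arctanPrimitive t).const_mul (-σ)).exp)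
    have h2 : deriv (fun t => ψ t * Real.exp (-σ * arctanPrimitive t)) t = _ := h1.deriv
    simp only [h2]
    ring
  refine ⟨c, hc.mono fun t ht => ?_⟩
  change f t = c * _
  change Real.exp (-σ * arctanPrimitive t) * f t = c at ht
  rw [← ht, mul_right_comm, ← Real.exp_add, neg_mul, neg_add_cancel, Real.exp_zero, one_mul]

/-- The path `arctan`. -/
def arctanPath : ℝ →ᵇ (ℝ →L[ℝ] ℝ) :=
  BoundedContinuousFunction.ofNormedAddCommGroup
    (fun t => Real.arctan t • ContinuousLinearMap.id ℝ ℝ)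
    (Real.continuous_arctan.smul continuous_const) (Real.pi / 2) fun t => by
      rw [norm_smul, ContinuousLinearMap.norm_id, mul_one, Real.norm_eq_abs]
      exact abs_le.2 ⟨(Real.neg_pi_div_two_lt_arctan t).le, (Real.arctan_lt_pi_div_two t).le⟩

theorem arctanPath_apply (t x : ℝ) : arctanPath t x = Real.arctan t * x := rfl

theorem isInvertible_smul_id {c : ℝ} (hc : c ≠ 0) :
    (c • ContinuousLinearMap.id ℝ ℝ).IsInvertible :=
  ContinuousLinearMap.IsInvertible.of_inverse (g := c⁻¹ • ContinuousLinearMap.id ℝ ℝ)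
    (by ext; simp [hc]) (by ext; simp [hc])

theorem hasFiniteIndex_arctanPath :
    HasFiniteIndex (pathOp (ContinuousLinearMap.id ℝ ℝ) arctanPath :
      PathSpace (ContinuousLinearMap.id ℝ ℝ) →ₗ[ℝ] Lp ℝ 2 (volume : Measure ℝ)) := by
  have hp := Real.pi_pos
  refine hasFiniteIndex_pathOp (fun _ _ h => h)
    (C := fun a => (bif a then Real.pi / 2 else -(Real.pi / 2)) • ContinuousLinearMap.id ℝ ℝ)
    ?_ ?_ ?_ ?_ ?_
  · exact fun a => (isSymmetricAlong_self _).smul _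
  · rintro (_ | _) <;> refine isInvertible_smul_id ?_ <;> simp [hp.ne']
  · exact fun a t => isCompactOperator_of_locallyCompactSpace_dom _
  · exact (tendsto_nhds_of_tendsto_nhdsWithin Real.tendsto_arctan_atBot).smul_const _
  · exact (tendsto_nhds_of_tendsto_nhdsWithin Real.tendsto_arctan_atTop).smul_const _

/-- A vector orthogonal to the range solves η' = arctan(t) η, so it is a multiple of exp(G), which
is square integrable only if it vanishes. The kernel equation has the opposite sign and is solved
exactly by the multiples of exp(-G). -/
theorem linearIndex_arctanPath :
    linearIndex (pathOp (ContinuousLinearMap.id ℝ ℝ) arctanPath :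
      PathSpace (ContinuousLinearMap.id ℝ ℝ) →ₗ[ℝ] Lp ℝ 2 (volume : Measure ℝ)) = 1 := by
  set ι := ContinuousLinearMap.id ℝ ℝ
  set D := pathOp ι arctanPath
  have hD : HasFiniteIndex (D : PathSpace ι →ₗ[ℝ] Lp ℝ 2 (volume : Measure ℝ)) :=
    hasFiniteIndex_arctanPath
  have hr : D.range = ⊤ := by
    have := hD.isClosed_range.completeSpace_coe
    rw [← Submodule.orthogonal_eq_bot_iff, Submodule.eq_bot_iff]
    intro η hη
    obtain ⟨c, hc⟩ := exists_ae_eq_exp (σ := 1) (f := η) fun φ hφ hφc => by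
      have h1 := hη _ ⟨testPath ι hφ hφc 1, rfl⟩
      rw [L2.inner_def] at h1
      rw [← h1]
      refine integral_congr_ae ?_
      change _ =ᵐ[volume] fun t => ⟪(pathSnd ι (testPath ι hφ hφc 1) +
        mulOp arctanPath (pathFst ι (testPath ι hφ hφc 1)) : Lp ℝ 2 volume) t, η t⟫_ℝ
      filter_upwards [Lp.coeFn_add (pathSnd ι (testPath ι hφ hφc 1))
        (mulOp arctanPath (pathFst ι (testPath ι hφ hφc 1))),
        coeFn_mulOp arctanPath (pathFst ι (testPath ι hφ hφc 1)),
        (ContinuousLinearMap.toSpanSingleton ℝ (1 : ℝ)).coeFn_compLpL (p := 2)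
          (testLp hφ.continuous hφc),
        (ContinuousLinearMap.toSpanSingleton ℝ (1 : ℝ)).coeFn_compLpL (p := 2)
          (testLp (hφ.continuous_deriv (by simp)) hφc.deriv),
        coeFn_testLp hφ.continuous hφc,
        coeFn_testLp (hφ.continuous_deriv (by simp)) hφc.deriv] with t e1 e2 e3 e4 e5 e6
      have e3' : pathFst ι (testPath ι hφ hφc 1) t = φ t := by
        refine e3.trans ?_
        rw [e5, ContinuousLinearMap.toSpanSingleton_apply, smul_eq_mul, mul_one]
      have e4' : pathSnd ι (testPath ι hφ hφc 1) t = deriv φ t := by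
        refine e4.trans ?_
        rw [e6, ContinuousLinearMap.toSpanSingleton_apply, smul_eq_mul, mul_one]
      rw [e1, Pi.add_apply, e2, e3', e4', arctanPath_apply, one_mul]
      exact mul_comm _ _
    -- Since G is nonnegative, |c| is bounded by |η|, and the only square integrable constant on the
    -- line is zero.
    have h2 : MemLp (fun _ : ℝ => c) 2 volume := by
      refine (Lp.memLp η).of_le aestronglyMeasurable_const (hc.mono fun t ht => ?_)
      rw [ht, norm_mul, Real.norm_of_nonneg (Real.exp_pos _).le]
      refine le_mul_of_one_le_right (norm_nonneg _) (Real.one_le_exp ?_)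
      rw [one_mul]
      exact arctanPrimitive_nonneg t
    have h3 : c = 0 := by
      rcases (memLp_const_iff (by norm_num) (by norm_num)).1 h2 with h | h
      · exact h
      · simp at h
    refine Lp.ext (hc.trans ?_)
    filter_upwards [Lp.coeFn_zero ℝ 2 (volume : Measure ℝ)] with t ht
    rw [ht, h3, zero_mul]
    rfl
  have hm := memLp_exp_arctanPrimitive
  have hm' : MemLp (fun t => -Real.arctan t * Real.exp (-1 * arctanPrimitive t)) 2 volume := by
    refine (hm.const_mul (Real.pi / 2)).of_le
      (Real.continuous_arctan.neg.mul (continuous_exp_arctanPrimitive (-1))).aestronglyMeasurable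
      (Eventually.of_forall fun t => ?_)
    rw [norm_mul, norm_mul, norm_neg, Real.norm_of_nonneg Real.pi_div_two_pos.le]
    gcongr
    exact abs_le.2 ⟨(Real.neg_pi_div_two_lt_arctan t).le, (Real.arctan_lt_pi_div_two t).le⟩
  have hw : IsWeakDeriv (ι.compLpL 2 volume (hm.toLp _)) (hm'.toLp _) := by
    rw [compLpL_id]
    refine isWeakDeriv_toLp hm hm' fun t => ?_
    exact (((hasDerivAt_arctanPrimitive t).const_mul (-1)).exp).congr_deriv (by ring)
  have hk : Module.finrank ℝ D.ker = 1 := by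
    have hmem : pathMk hw ∈ D.ker := by
      refine LinearMap.mem_ker.2 ?_
      change hm'.toLp _ + mulOp arctanPath (hm.toLp _) = 0
      refine Lp.ext ?_
      filter_upwards [Lp.coeFn_add (hm'.toLp _) (mulOp arctanPath (hm.toLp _)),
        coeFn_mulOp arctanPath (hm.toLp _), hm.coeFn_toLp, hm'.coeFn_toLp,
        Lp.coeFn_zero ℝ 2 (volume : Measure ℝ)] with t e1 e2 e3 e4 e5
      rw [e1, Pi.add_apply, e2, e3, e4, e5, arctanPath_apply, Pi.zero_apply]
      ring
    refine (finrank_eq_one_iff_of_nonzero' (⟨pathMk hw, hmem⟩ : D.ker) ?_).2 ?_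
    · intro h0
      have h1 : hm.toLp _ = 0 := congrArg (fun p => pathFst ι p.1) h0
      have h2 := hm.coeFn_toLp.symm.trans ((Lp.ext_iff.1 h1).trans (Lp.coeFn_zero ℝ 2 volume))
      obtain ⟨t, ht⟩ := h2.exists
      exact (Real.exp_pos _).ne' ht
    · rintro ⟨p, hp⟩
      have hp' : pathSnd ι p + mulOp arctanPath (pathFst ι p) = 0 := LinearMap.mem_ker.1 hp
      have hs : pathSnd ι p =ᵐ[volume] fun t => -(Real.arctan t * pathFst ι p t) := by
        rw [eq_neg_of_add_eq_zero_left hp']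
        filter_upwards [Lp.coeFn_neg (mulOp arctanPath (pathFst ι p)),
          coeFn_mulOp arctanPath (pathFst ι p)] with t e1 e2
        rw [e1, Pi.neg_apply, e2, arctanPath_apply]
      obtain ⟨c, hc⟩ := exists_ae_eq_exp (σ := -1) (f := pathFst ι p) fun φ hφ hφc => by
        have h1 := isWeakDeriv_path p
        rw [compLpL_id] at h1
        have h2 := h1 φ hφ hφc
        have i1 := integrable_smul_of_test (hφ.continuous_deriv (by simp)) hφc.deriv (pathFst ι p)
        have i2 := integrable_smul_of_test hφ.continuous hφc (pathSnd ι p)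
        rw [← sub_eq_zero, sub_neg_eq_add, ← integral_add i1 i2] at h2
        rw [← h2]
        refine integral_congr_ae (hs.mono fun t ht => ?_)
        simp only [ht, smul_eq_mul]
        ring
      have hf : c • hm.toLp _ = pathFst ι p := by
        refine Lp.ext ?_
        filter_upwards [Lp.coeFn_smul c (hm.toLp _), hm.coeFn_toLp, hc] with t e1 e2 e3
        rw [e1, Pi.smul_apply, e2, e3]
        rfl
      refine ⟨c, Subtype.ext (PathSpace.ext hf ?_)⟩
      refine IsWeakDeriv.unique (f := pathFst ι p) ?_ ?_
      · have := hw.smul c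
        rw [compLpL_id, hf] at this
        exact this
      · have := isWeakDeriv_path p
        rwa [compLpL_id] at this
  have hr' : LinearMap.range (D : PathSpace ι →ₗ[ℝ] Lp ℝ 2 (volume : Measure ℝ)) = ⊤ := hr
  have hk' : Module.finrank ℝ
      (LinearMap.ker (D : PathSpace ι →ₗ[ℝ] Lp ℝ 2 (volume : Measure ℝ))) = 1 := hk
  rw [linearIndex, hk', hr', Module.finrank_zero_of_subsingleton]
  norm_num

theorem compLpL_symm_compLpL {X Y : Type*} [NormedAddCommGroup X] [NormedSpace ℝ X]
    [NormedAddCommGroup Y] [NormedSpace ℝ Y] (e : X ≃L[ℝ] Y)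
    (f : Lp X 2 (volume : Measure ℝ)) :
    e.symm.toContinuousLinearMap.compLpL 2 volume (e.toContinuousLinearMap.compLpL 2 volume f) =
      f := by
  rw [compLpL_compLpL, e.coe_symm_comp_coe, compLpL_id]

theorem bijective_compLpL {X Y : Type*} [NormedAddCommGroup X] [NormedSpace ℝ X]
    [NormedAddCommGroup Y] [NormedSpace ℝ Y] (e : X ≃L[ℝ] Y) :
    Function.Bijective (e.toContinuousLinearMap.compLpL 2 (volume : Measure ℝ)) :=
  Function.bijective_iff_has_inverse.2 ⟨e.symm.toContinuousLinearMap.compLpL 2 volume,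
    compLpL_symm_compLpL e, compLpL_symm_compLpL e.symm⟩

theorem bijective_pathMap {W H W' H' : Type*} [NormedAddCommGroup W] [InnerProductSpace ℝ W]
    [NormedAddCommGroup H] [InnerProductSpace ℝ H] [NormedAddCommGroup W']
    [InnerProductSpace ℝ W'] [NormedAddCommGroup H'] [InnerProductSpace ℝ H'] [CompleteSpace H]
    [CompleteSpace H'] {ι : W →L[ℝ] H} {ι' : W' →L[ℝ] H'} (L : W ≃L[ℝ] W') (l : H ≃L[ℝ] H')
    (h : ∀ w, ι' (L w) = l (ι w)) :
    Function.Bijective (pathMap (ι := ι) (ι' := ι') L.toContinuousLinearMap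
      l.toContinuousLinearMap h) := by
  have h' : ∀ w, ι (L.symm w) = l.symm (ι' w) := fun w => by
    rw [← l.symm_apply_apply (ι (L.symm w)), ← h, L.apply_symm_apply]
  refine Function.bijective_iff_has_inverse.2 ⟨pathMap (ι := ι') (ι' := ι)
    L.symm.toContinuousLinearMap l.symm.toContinuousLinearMap h', fun p => ?_, fun p => ?_⟩
  · exact PathSpace.ext (compLpL_symm_compLpL L _) (compLpL_symm_compLpL l _)
  · exact PathSpace.ext (compLpL_symm_compLpL L.symm _) (compLpL_symm_compLpL l.symm _)

theorem ReferenceOperator.incl_bijective (T : ReferenceOperator.{u}) [FiniteDimensional ℝ T.H] :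
    Function.Bijective T.incl := by
  refine ⟨T.incl_injective, LinearMap.range_eq_top.1 (?_ : T.incl.range = ⊤)⟩
  have h1 := (Submodule.closed_of_finiteDimensional T.incl.range).closure_eq
  have h2 : closure (T.incl.range : Set T.H) = Set.univ := T.denseRange_incl.closure_range
  exact SetLike.coe_injective (h1.symm.trans h2)

theorem pathIndex_arctan (T : ReferenceOperator.{u}) (A : T.admissiblePaths)
    (h1 : Module.finrank ℝ T.H = 1) (hA : ∀ t w, A.1 t w = Real.arctan t • T.incl w) :
    pathIndex T A = 1 := by
  have : FiniteDimensional ℝ T.H := Module.finite_of_finrank_eq_succ h1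
  let l : T.H ≃L[ℝ] ℝ := ContinuousLinearEquiv.ofFinrankEq (by rw [h1, Module.finrank_self])
  let i : T.W ≃L[ℝ] T.H := ContinuousLinearEquiv.ofBijective T.incl
    (LinearMap.ker_eq_bot.2 T.incl_bijective.1) (LinearMap.range_eq_top.2 T.incl_bijective.2)
  have hi : ∀ w, i w = T.incl w := fun w => rfl
  let L : T.W ≃L[ℝ] ℝ := i.trans l
  have hL : ∀ w, ContinuousLinearMap.id ℝ ℝ (L w) = l (T.incl w) := fun w => rfl
  rw [pathIndex, ← linearIndex_arctanPath]
  refine linearIndex_conj (hasFiniteIndex_of_mem_admissiblePaths A.2) hasFiniteIndex_arctanPath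
    (pathMap (ι := T.incl) (ι' := ContinuousLinearMap.id ℝ ℝ) L.toContinuousLinearMap
      l.toContinuousLinearMap hL).toLinearMap
    (l.toContinuousLinearMap.compLpL 2 volume).toLinearMap
    (bijective_pathMap L l hL) (bijective_compLpL l) (LinearMap.ext fun p => ?_)
  refine pathOp_pathMap (ι := T.incl) (ι' := ContinuousLinearMap.id ℝ ℝ)
    (L := L.toContinuousLinearMap) (l := l.toContinuousLinearMap) hL (A := A.1)
    (A' := arctanPath) (fun t w => ?_) p
  rw [hA]
  exact (l.map_smul _ _).symm

theorem isSpectralFlow_pathIndex : IsSpectralFlow.{u} pathIndex where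
  homotopy _ _ _ h := pathIndex_eq_of_mem_connectedComponent h
  constant _ _ h := pathIndex_eq_zero_of_const h
  directSum _ _ A₁ A₂ A h := pathIndex_directSum A₁ A₂ A h
  catenation _ A Al Ar h hl hr := pathIndex_catenation A Al Ar h hl hr
  normalization T A h hA := pathIndex_arctan T A h hA

/-! ## Finite rank perturbations -/

section RankOne

variable {W H : Type*} [NormedAddCommGroup W] [InnerProductSpace ℝ W] [NormedAddCommGroup H]
  [InnerProductSpace ℝ H]

/-- The symmetric operator `x ↦ ⟪e, ι x⟫ e` of rank one. -/
def rankOne (ι : W →L[ℝ] H) (e : H) : W →L[ℝ] H := ((innerSL ℝ e).comp ι).smulRight e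

theorem rankOne_apply (ι : W →L[ℝ] H) (e : H) (x : W) : rankOne ι e x = ⟪e, ι x⟫_ℝ • e := rfl

theorem isCompactOperator_rankOne (ι : W →L[ℝ] H) (e : H) : IsCompactOperator (rankOne ι e) :=
  isCompactOperator_smulRight _ _

theorem isSymmetricAlong_rankOne (ι : W →L[ℝ] H) (e : H) : IsSymmetricAlong ι (rankOne ι e) :=
  fun x y => by
    rw [rankOne_apply, rankOne_apply, inner_smul_left, inner_smul_right, real_inner_comm e (ι x)]
    exact mul_comm _ _

theorem continuous_rankOne (ι : W →L[ℝ] H) : Continuous (rankOne ι) := by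
  have h1 : Continuous fun e : H => (innerSL ℝ e).comp ι :=
    ((ContinuousLinearMap.compL ℝ W H ℝ).flip ι).continuous.comp (innerSL ℝ).continuous
  exact ((ContinuousLinearMap.smulRightL ℝ W H).continuous.comp h1).clm_apply continuous_id

/-- The Sherman-Morrison formula. -/
theorem isInvertible_add_rankOne {ι B : W →L[ℝ] H} (hB : B.IsInvertible) {e : H} {c : ℝ}
    (h : 1 + c * ⟪e, ι (B.inverse e)⟫_ℝ ≠ 0) : (B + c • rankOne ι e).IsInvertible := by
  set d := 1 + c * ⟪e, ι (B.inverse e)⟫_ℝ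
  refine ContinuousLinearMap.IsInvertible.of_inverse
    (g := B.inverse - (c / d) • (((innerSL ℝ e).comp (ι.comp B.inverse)).smulRight (B.inverse e)))
    ?_ ?_
  · ext y
    change B (B.inverse y - (c / d) • (⟪e, ι (B.inverse y)⟫_ℝ • B.inverse e)) +
      c • (⟪e, ι (B.inverse y - (c / d) • (⟪e, ι (B.inverse y)⟫_ℝ • B.inverse e))⟫_ℝ • e) = y
    simp only [map_sub, map_smul, hB.self_apply_inverse, inner_sub_right, inner_smul_right]
    have e1 : (-(c / d * ⟪e, ι (B.inverse y)⟫_ℝ) + c * (⟪e, ι (B.inverse y)⟫_ℝ - c / d *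
        (⟪e, ι (B.inverse y)⟫_ℝ * ⟪e, ι (B.inverse e)⟫_ℝ))) = 0 := by
      have : c * ⟪e, ι (B.inverse e)⟫_ℝ = d - 1 := by simp only [d]; ring
      field_simp
      linear_combination (-c * ⟪e, ι (B.inverse y)⟫_ℝ) * this
    rw [← sub_eq_zero, ← zero_smul ℝ e, ← e1]
    module
  · ext x
    change B.inverse (B x + c • (⟪e, ι x⟫_ℝ • e)) - (c / d) • (⟪e, ι (B.inverse (B x +
      c • (⟪e, ι x⟫_ℝ • e)))⟫_ℝ • B.inverse e) = x
    simp only [map_add, map_smul, hB.inverse_apply_self, inner_add_right, inner_smul_right]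
    have e1 : c * ⟪e, ι x⟫_ℝ - c / d * (⟪e, ι x⟫_ℝ + c * (⟪e, ι x⟫_ℝ *
        ⟪e, ι (B.inverse e)⟫_ℝ)) = 0 := by
      have : c * ⟪e, ι (B.inverse e)⟫_ℝ = d - 1 := by simp only [d]; ring
      field_simp
      linear_combination (-c * ⟪e, ι x⟫_ℝ) * this
    rw [← sub_eq_zero, ← zero_smul ℝ (B.inverse e), ← e1]
    module

/-- If the number vanished, B⁻¹e would lie in the kernel of the perturbed operator; so it would be
zero, and the number would be 1. -/
theorem one_add_ne_zero_of_isInvertible {ι B : W →L[ℝ] H} (hB : B.IsInvertible) {e : H} {c : ℝ}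
    (h : (B + c • rankOne ι e).IsInvertible) : 1 + c * ⟪e, ι (B.inverse e)⟫_ℝ ≠ 0 := by
  intro h0
  have h1 : (B + c • rankOne ι e) (B.inverse e) = 0 := by
    change B (B.inverse e) + c • (⟪e, ι (B.inverse e)⟫_ℝ • e) = 0
    rw [hB.self_apply_inverse, smul_smul]
    rw [← zero_smul ℝ e, ← h0]
    module
  have h2 : B.inverse e = 0 := by
    rw [← h.inverse_apply_self (B.inverse e), h1, map_zero]
  rw [h2, map_zero, inner_zero_right, mul_zero, add_zero] at h0
  exact one_ne_zero h0

/-- Finite sums of multiples of symmetric operators of rank one. -/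
def finiteRankSymm (ι : W →L[ℝ] H) : Submodule ℝ (W →L[ℝ] H) :=
  Submodule.span ℝ (Set.range (rankOne ι))

theorem isCompactOperator_of_mem_finiteRankSymm {ι N : W →L[ℝ] H} (hN : N ∈ finiteRankSymm ι) :
    IsCompactOperator N := by
  induction hN using Submodule.span_induction with
  | mem x hx => obtain ⟨e, rfl⟩ := hx; exact isCompactOperator_rankOne ι e
  | zero => exact isCompactOperator_zero
  | add x y _ _ hx hy => exact hx.add hy
  | smul c x _ hx => exact hx.smul c

theorem isSymmetricAlong_of_mem_finiteRankSymm {ι N : W →L[ℝ] H} (hN : N ∈ finiteRankSymm ι) :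
    IsSymmetricAlong ι N := by
  induction hN using Submodule.span_induction with
  | mem x hx => obtain ⟨e, rfl⟩ := hx; exact isSymmetricAlong_rankOne ι e
  | zero => exact isSymmetricAlong_zero ι
  | add x y _ _ hx hy => exact hx.add hy
  | smul c x _ hx => exact hx.smul c

theorem isOpen_isInvertible [CompleteSpace W] : IsOpen {B : W →L[ℝ] H | B.IsInvertible} :=
  ContinuousLinearEquiv.isOpen

/-- An injective compact perturbation of an invertible operator is invertible. -/
theorem isInvertible_of_isCompactOperator_sub [CompleteSpace H] {C B : W →L[ℝ] H}
    (hC : C.IsInvertible) (hK : IsCompactOperator (B - C)) (hB : Function.Injective B) :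
    B.IsInvertible := by
  have hK' : IsCompactOperator ((B - C).comp C.inverse) := hK.comp_clm C.inverse
  have h1 : B.comp C.inverse = 1 + (B - C).comp C.inverse := by
    ext x
    change B (C.inverse x) = x + (B (C.inverse x) - C (C.inverse x))
    rw [hC.self_apply_inverse]
    abel
  have hCinj : Function.Injective C.inverse := fun x y h => by
    rw [← hC.self_apply_inverse x, h, hC.self_apply_inverse]
  have h2 : IsUnit (B.comp C.inverse) := by
    -- The Fredholm alternative for the compact operator (B - C)C⁻¹ at -1: an eigenvector would
    -- produce a kernel element of B.
    rcases hK'.hasEigenvalue_or_mem_resolventSet (μ := (-1 : ℝ)) (by norm_num) with h | h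
    · exfalso
      obtain ⟨x, hx⟩ := h.exists_hasEigenvector
      refine hx.2 (hCinj (hB ?_))
      have h3 : (B - C).comp C.inverse x = (-1 : ℝ) • x := hx.apply_eq_smul
      have h4 : B.comp C.inverse x = x + (B - C).comp C.inverse x := by rw [h1]; rfl
      rw [h3] at h4
      rw [map_zero, map_zero]
      refine h4.trans ?_
      rw [neg_one_smul, add_neg_cancel]
    · rw [spectrum.mem_resolventSet_iff] at h
      rw [h1]
      have h3 : (1 : H →L[ℝ] H) + (B - C).comp C.inverse =
          -(algebraMap ℝ (H →L[ℝ] H) (-1) - (B - C).comp C.inverse) := by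
        rw [map_neg, map_one]; abel
      rw [h3]
      exact h.neg
  obtain ⟨U, hU⟩ := h2
  refine ContinuousLinearMap.IsInvertible.of_inverse
    (g := C.inverse.comp ((U⁻¹ : (H →L[ℝ] H)ˣ) : H →L[ℝ] H)) ?_ ?_
  · rw [← ContinuousLinearMap.comp_assoc, ← hU]
    exact U.mul_inv
  · ext x
    have h3 : ((U⁻¹ : (H →L[ℝ] H)ˣ) : H →L[ℝ] H) ((U : H →L[ℝ] H) (C x)) = C x :=
      congrArg (fun f : H →L[ℝ] H => f (C x)) U.inv_mul
    have h4 : (U : H →L[ℝ] H) (C x) = B x := by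
      rw [hU]
      change B (C.inverse (C x)) = B x
      rw [hC.inverse_apply_self]
    rw [h4] at h3
    change C.inverse (((U⁻¹ : (H →L[ℝ] H)ˣ) : H →L[ℝ] H) (B x)) = x
    rw [h3, hC.inverse_apply_self]

/-- The orthogonal projection to the image of a finite dimensional subspace `V`. -/
theorem exists_finiteRankSymm_projection (ι : W →L[ℝ] H) (V : Submodule ℝ W)
    [FiniteDimensional ℝ V] : ∃ N ∈ finiteRankSymm ι, (∀ x, ∃ v ∈ V, N x = ι v) ∧
      ∀ x, ∀ v ∈ V, ⟪N x, ι v⟫_ℝ = ⟪ι x, ι v⟫_ℝ := by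
  set U : Submodule ℝ H := V.map (ι : W →ₗ[ℝ] H)
  let b := stdOrthonormalBasis ℝ U
  refine ⟨∑ i, rankOne ι (b i : H), Submodule.sum_mem _ fun i _ =>
    Submodule.subset_span ⟨_, rfl⟩, ?_, ?_⟩
  · intro x
    have : (∑ i, rankOne ι (b i : H)) x ∈ U := by
      rw [sum_apply]
      exact Submodule.sum_mem _ fun i _ => U.smul_mem _ (b i).2
    obtain ⟨v, hv, h⟩ := this
    exact ⟨v, hv, h.symm⟩
  · intro x v hv
    have h1 := b.sum_repr' ⟨ι v, ⟨v, hv, rfl⟩⟩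
    have h2 : ∑ i, ⟪(b i : H), ι v⟫_ℝ • (b i : H) = ι v := by
      have := congrArg (fun z : U => (z : H)) h1
      simpa using this
    rw [sum_apply, sum_inner]
    conv_rhs => rw [← h2, _root_.inner_sum]
    refine Finset.sum_congr rfl fun i _ => ?_
    rw [rankOne_apply, inner_smul_left, inner_smul_right, real_inner_comm (ι x)]
    exact mul_comm _ _

/-- If Bx = -Nx, then Nx lies in the image of ker B and, by symmetry of B, is orthogonal to it;
hence Nx = 0 and x lies in ker B. There N reproduces the inner product of ιx with itself, so x = 0.
-/
theorem injective_add_of_projection {ι B N : W →L[ℝ] H} (hι : Function.Injective ι)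
    (hs : IsSymmetricAlong ι B) (h1 : ∀ x, ∃ v ∈ B.ker, N x = ι v)
    (h2 : ∀ x, ∀ v ∈ B.ker, ⟪N x, ι v⟫_ℝ = ⟪ι x, ι v⟫_ℝ) : Function.Injective (B + N) := by
  rw [injective_iff_map_eq_zero]
  intro x hx
  have hx' : B x = - N x := eq_neg_of_add_eq_zero_left hx
  obtain ⟨v, hv, hv'⟩ := h1 x
  have h3 : ⟪N x, ι v⟫_ℝ = 0 := by
    have := hs x v
    rw [show B v = 0 from LinearMap.mem_ker.1 hv, inner_zero_right, hx', inner_neg_left] at this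
    linarith
  have h4 : N x = 0 := by
    rw [← hv'] at h3
    exact inner_self_eq_zero.1 h3
  have h5 : x ∈ B.ker := LinearMap.mem_ker.2 (by rw [← neg_zero, ← h4]; exact hx')
  have h6 := h2 x x h5
  rw [h4, inner_zero_left] at h6
  exact hι ((inner_self_eq_zero.1 h6.symm).trans (map_zero ι).symm)

end RankOne

/-! ### Invertibility after a finite rank perturbation -/

namespace ReferenceOperator

variable {T : ReferenceOperator.{u}}

theorem IsAdmissible.add_finiteRankSymm {B N : T.W →L[ℝ] T.H} (hB : T.IsAdmissible B)
    (hN : N ∈ finiteRankSymm T.incl) : T.IsAdmissible (B + N) :=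
  hB.add (isCompactOperator_of_mem_finiteRankSymm hN) (isSymmetricAlong_of_mem_finiteRankSymm hN)

theorem isFredholm_base (T : ReferenceOperator.{u}) : T.base.IsFredholm :=
  (zero_notMem_essentialSpectrum_iff _).1 T.zero_notMem

/-- The cokernel of a self-adjoint operator is its kernel. -/
theorem mem_range_base_sup (y : T.H) : ∃ x, ∃ k ∈ T.base.ker, T.base x + T.incl k = y := by
  have := T.isFredholm_base.finite_ker
  have hR : IsClosed ((T.base.range ⊔ T.base.ker.map (T.incl : T.W →ₗ[ℝ] T.H) :
      Submodule ℝ T.H) : Set T.H) := by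
    have := T.isFredholm_base.finite_coker
    refine Submodule.isClosed_mono_of_finiteDimensional_quotient
      T.isFredholm_base.isClosed_range le_sup_left
  have hc := hR.completeSpace_coe
  have htop : T.base.range ⊔ T.base.ker.map (T.incl : T.W →ₗ[ℝ] T.H) = ⊤ := by
    rw [← Submodule.orthogonal_eq_bot_iff, Submodule.eq_bot_iff]
    intro η hη
    -- A vector η orthogonal to the range lies in the domain of the adjoint and is annihilated by
    -- it. By self-adjointness it belongs to the kernel, hence to the sum to which it is orthogonal.
    have h1 : ∀ x : T.op.domain, ⟪(0 : T.H), (x : T.H)⟫_ℝ = ⟪η, T.op x⟫_ℝ := fun x => by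
      rw [inner_zero_left, real_inner_comm]
      refine (hη _ (Submodule.mem_sup_left ⟨⟨WithLp.toLp 2 ((x : T.H), T.op x),
        (mem_graphSpace_iff _ _).2 ⟨x.2, rfl⟩⟩, rfl⟩)).symm
    have hadj := LinearPMap.isSelfAdjoint_def.mp T.isSelfAdjoint
    have h2 : η ∈ T.op.adjoint.domain := LinearPMap.mem_adjoint_domain_of_exists _ ⟨0, h1⟩
    have h3 : T.op.adjoint ⟨η, h2⟩ = 0 := LinearPMap.adjoint_apply_eq T.dense_domain _ h1
    have h4 : (η, (0 : T.H)) ∈ T.op.graph := by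
      rw [← hadj, LinearPMap.mem_graph_iff]
      exact ⟨⟨η, h2⟩, rfl, h3⟩
    have h5 : η ∈ T.base.range ⊔ T.base.ker.map (T.incl : T.W →ₗ[ℝ] T.H) :=
      Submodule.mem_sup_right ⟨⟨WithLp.toLp 2 (η, (0 : T.H)), h4⟩, LinearMap.mem_ker.2 rfl, rfl⟩
    exact inner_self_eq_zero.1 (hη η h5)
  obtain ⟨a, ⟨x, hx⟩, b, ⟨k, hk, hk'⟩, h⟩ := Submodule.mem_sup.1 (htop.ge (Submodule.mem_top : y ∈ ⊤))
  exact ⟨x, k, hk, by rw [← h, ← hx, ← hk']; rfl⟩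

/-- The perturbation is the orthogonal projection to the finite-dimensional kernel. Symmetry gives
injectivity, and H = range + kernel gives surjectivity. The resulting operator is the one with which
all other admissible operators are compared. -/
theorem exists_isInvertible_base_add (T : ReferenceOperator.{u}) :
    ∃ N ∈ finiteRankSymm T.incl, (T.base + N).IsInvertible := by
  have := T.isFredholm_base.finite_ker
  obtain ⟨N, hN, h1, h2⟩ := exists_finiteRankSymm_projection T.incl T.base.ker
  have hk : ∀ k ∈ T.base.ker, N k = T.incl k := by
    intro k hk
    obtain ⟨v, hv, hv'⟩ := h1 k
    have h3 := h2 k (v - k) (T.base.ker.sub_mem hv hk)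
    rw [hv', ← sub_eq_zero, ← inner_sub_left, ← map_sub] at h3
    rw [hv', sub_eq_zero.1 ((map_sub T.incl v k).symm.trans (inner_self_eq_zero.1 h3))]
  refine ⟨N, hN, ?_⟩
  have hinj : Function.Injective (T.base + N) :=
    injective_add_of_projection T.incl_injective T.isSymmetricAlong_base h1 h2
  have hsurj : Function.Surjective (T.base + N) := fun y => by
    obtain ⟨x, k, hk1, rfl⟩ := mem_range_base_sup y
    obtain ⟨v, hv, hv'⟩ := h1 x
    refine ⟨x - v + k, ?_⟩
    rw [add_apply, map_add, map_add, map_sub, map_sub, hk k hk1, hk v hv, hv',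
      show T.base v = 0 from LinearMap.mem_ker.1 hv, show T.base k = 0 from LinearMap.mem_ker.1 hk1]
    abel
  exact ⟨ContinuousLinearEquiv.ofBijective _ (LinearMap.ker_eq_bot.2 hinj)
    (LinearMap.range_eq_top.2 hsurj), rfl⟩

/-- Admissible operators become invertible after the addition of a suitable operator of
finite rank. -/
theorem IsAdmissible.exists_isInvertible_add {B : T.W →L[ℝ] T.H} (hB : T.IsAdmissible B) :
    ∃ N ∈ finiteRankSymm T.incl, (B + N).IsInvertible := by
  obtain ⟨N₀, hN₀, hC⟩ := T.exists_isInvertible_base_add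
  set C := T.base + N₀
  have hCa : T.IsAdmissible C := isAdmissible_base.add_finiteRankSymm hN₀
  have hker : FiniteDimensional ℝ B.ker := by
    -- An invertible finite rank perturbation C of the reference operator differs from B by a
    -- compact operator, so its inverse is a parametrix.
    refine finiteDimensional_ker_of_parametrix (D := B) (P := C.inverse)
      (K := C.inverse.comp (B - C)) (E := 0) ?_
      ((hB.isCompactOperator_sub hCa).clm_comp C.inverse) (ContinuousLinearMap.opNorm_zero.trans_lt one_pos)
    refine ContinuousLinearMap.ext fun x => ?_
    change C.inverse (B x) = x + C.inverse (B x - C x) + 0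
    rw [map_sub, hC.inverse_apply_self]
    abel
  obtain ⟨N, hN, h1, h2⟩ := exists_finiteRankSymm_projection T.incl B.ker
  exact ⟨N, hN, isInvertible_of_isCompactOperator_sub hC
    ((hB.add_finiteRankSymm hN).isCompactOperator_sub hCa)
    (injective_add_of_projection T.incl_injective hB.isSymmetricAlong h1 h2)⟩

end ReferenceOperator

/-! ## Uniqueness of the spectral flow -/

section Steps

variable {V : Type*} [NormedAddCommGroup V] [NormedSpace ℝ V]

/-- The function which is `0` on `(-∞, 0]`, `1` on `[1, ∞)` and affine in between. -/
def ramp (t : ℝ) : ℝ := max 0 (min 1 t)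

theorem continuous_ramp : Continuous ramp := by unfold ramp; fun_prop

theorem ramp_of_nonpos {t : ℝ} (h : t ≤ 0) : ramp t = 0 :=
  max_eq_left ((min_le_right _ _).trans h)

theorem ramp_of_one_le {t : ℝ} (h : 1 ≤ t) : ramp t = 1 := by
  rw [ramp, min_eq_left h, max_eq_right zero_le_one]

theorem ramp_mem (t : ℝ) : ramp t ∈ Set.Icc (0 : ℝ) 1 :=
  ⟨le_max_left _ _, max_le zero_le_one (min_le_left _ _)⟩

/-- The path from `b` to `c` along a segment which is traversed during `[a, a + 1]`. -/
def stepPath (a : ℝ) (b c : V) : ℝ →ᵇ V :=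
  BoundedContinuousFunction.ofNormedAddCommGroup (fun t => b + ramp (t - a) • (c - b))
    (continuous_const.add
      ((continuous_ramp.comp (continuous_id.sub continuous_const)).smul continuous_const))
    (‖b‖ + ‖c - b‖) fun t => by
      refine (norm_add_le _ _).trans (add_le_add le_rfl ?_)
      rw [norm_smul, Real.norm_of_nonneg (ramp_mem _).1]
      exact mul_le_of_le_one_left (norm_nonneg _) (ramp_mem _).2

theorem stepPath_apply (a : ℝ) (b c : V) (t : ℝ) :
    stepPath a b c t = b + ramp (t - a) • (c - b) := rfl

theorem stepPath_of_le {a t : ℝ} (b c : V) (h : t ≤ a) : stepPath a b c t = b := by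
  rw [stepPath_apply, ramp_of_nonpos (by linarith), zero_smul, add_zero]

theorem stepPath_of_ge {a t : ℝ} (b c : V) (h : a + 1 ≤ t) : stepPath a b c t = c := by
  rw [stepPath_apply, ramp_of_one_le (by linarith), one_smul, add_sub_cancel]

theorem tendsto_stepPath_atBot (a : ℝ) (b c : V) : Tendsto (stepPath a b c) atBot (𝓝 b) :=
  tendsto_const_nhds.congr' ((eventually_le_atBot a).mono fun _ h => (stepPath_of_le b c h).symm)

theorem tendsto_stepPath_atTop (a : ℝ) (b c : V) : Tendsto (stepPath a b c) atTop (𝓝 c) :=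
  tendsto_const_nhds.congr'
    ((eventually_ge_atTop (a + 1)).mono fun _ h => (stepPath_of_ge b c h).symm)

/-- The line through `f` with direction `g`. -/
def bcfLine (f g : ℝ →ᵇ V) (s : ℝ) : ℝ →ᵇ V := f + s • g

theorem continuous_bcfLine (f g : ℝ →ᵇ V) : Continuous (bcfLine f g) :=
  continuous_const.add (continuous_id.smul continuous_const)

/-- The segment between two paths. -/
def bcfSegment (f g : ℝ →ᵇ V) : ℝ → ℝ →ᵇ V := bcfLine f (g - f)

theorem bcfSegment_apply (f g : ℝ →ᵇ V) (s t : ℝ) :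
    bcfSegment f g s t = f t + s • (g t - f t) := rfl

theorem continuous_bcfSegment (f g : ℝ →ᵇ V) : Continuous (bcfSegment f g) :=
  continuous_bcfLine f (g - f)

theorem bcfSegment_zero (f g : ℝ →ᵇ V) : bcfSegment f g 0 = f := by
  ext1 t; rw [bcfSegment_apply, zero_smul, add_zero]

theorem bcfSegment_one (f g : ℝ →ᵇ V) : bcfSegment f g 1 = g := by
  ext1 t; rw [bcfSegment_apply, one_smul, add_sub_cancel]

theorem tendsto_bcfSegment {f g : ℝ →ᵇ V} {l : Filter ℝ} {b c : V} (hf : Tendsto f l (𝓝 b))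
    (hg : Tendsto g l (𝓝 c)) (s : ℝ) : Tendsto (bcfSegment f g s) l (𝓝 (b + s • (c - b))) :=
  hf.add ((hg.sub hf).const_smul s)

/-- The path from `b` through `c` to `d`. -/
def twoStepPath (b c d : V) : ℝ →ᵇ V := stepPath (-1) b c + stepPath 0 0 (d - c)

theorem twoStepPath_apply (b c d : V) (t : ℝ) :
    twoStepPath b c d t = stepPath (-1) b c t + ramp t • (d - c) := by
  change _ + (0 + ramp (t - 0) • (d - c - 0)) = _
  rw [sub_zero, sub_zero, zero_add]

theorem twoStepPath_of_nonpos (b c d : V) {t : ℝ} (h : t ≤ 0) :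
    twoStepPath b c d t = stepPath (-1) b c t := by
  rw [twoStepPath_apply, ramp_of_nonpos h, zero_smul, add_zero]

theorem twoStepPath_of_nonneg (b c d : V) {t : ℝ} (h : 0 ≤ t) :
    twoStepPath b c d t = stepPath 0 c d t := by
  rw [twoStepPath_apply, stepPath_of_ge b c (by linarith), stepPath_apply, sub_zero]

end Steps

section OperatorSegments

variable {W H : Type*} [NormedAddCommGroup W] [InnerProductSpace ℝ W] [NormedAddCommGroup H]
  [InnerProductSpace ℝ H]

/-- The segment between two paths of operators. -/
def opSegment (f g : ℝ →ᵇ (W →L[ℝ] H)) : ℝ → ℝ →ᵇ (W →L[ℝ] H) := bcfSegment f g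

theorem continuous_opSegment (f g : ℝ →ᵇ (W →L[ℝ] H)) : Continuous (opSegment f g) :=
  continuous_bcfSegment f g

theorem opSegment_zero (f g : ℝ →ᵇ (W →L[ℝ] H)) : opSegment f g 0 = f := bcfSegment_zero f g

theorem opSegment_one (f g : ℝ →ᵇ (W →L[ℝ] H)) : opSegment f g 1 = g := bcfSegment_one f g

theorem tendsto_opSegment {f g : ℝ →ᵇ (W →L[ℝ] H)} {l : Filter ℝ} {b c : W →L[ℝ] H}
    (hf : Tendsto f l (𝓝 b)) (hg : Tendsto g l (𝓝 c)) (s : ℝ) :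
    Tendsto (opSegment f g s) l (𝓝 (b + s • (c - b))) :=
  tendsto_bcfSegment hf hg s

theorem tendsto_opSegment_self {f g : ℝ →ᵇ (W →L[ℝ] H)} {l : Filter ℝ} {b : W →L[ℝ] H}
    (hf : Tendsto f l (𝓝 b)) (hg : Tendsto g l (𝓝 b)) (s : ℝ) :
    Tendsto (opSegment f g s) l (𝓝 b) := by
  have := tendsto_opSegment hf hg s
  rwa [sub_self, smul_zero, add_zero] at this

end OperatorSegments

/-- The invertible admissible operators. -/
def ReferenceOperator.invertibles (T : ReferenceOperator.{u}) : Set (T.W →L[ℝ] T.H) :=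
  {B | T.IsAdmissible B ∧ B.IsInvertible}

theorem mem_admissiblePaths {T : ReferenceOperator.{u}} {A : ℝ →ᵇ (T.W →L[ℝ] T.H)}
    {B C : T.W →L[ℝ] T.H} (hA : ∀ t, T.IsAdmissible (A t)) (hB : B.IsInvertible)
    (hC : C.IsInvertible) (h1 : Tendsto A atBot (𝓝 B)) (h2 : Tendsto A atTop (𝓝 C)) :
    A ∈ T.admissiblePaths := ⟨hA, ⟨B, hB, h1⟩, ⟨C, hC, h2⟩⟩

theorem stepPath_mem {T : ReferenceOperator.{u}} (a : ℝ) {B C : T.W →L[ℝ] T.H}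
    (hB : B ∈ T.invertibles) (hC : C ∈ T.invertibles) : stepPath a B C ∈ T.admissiblePaths :=
  mem_admissiblePaths (fun _ => hB.1.lineMap hC.1 _) hB.2 hC.2 (tendsto_stepPath_atBot a B C)
    (tendsto_stepPath_atTop a B C)

/-- The difference of two spectral flows. -/
structure IsNullFlow (δ : ∀ T : ReferenceOperator.{u}, T.admissiblePaths → ℤ) : Prop where
  homotopy : ∀ (T : ReferenceOperator.{u}) (A B : T.admissiblePaths),
    B ∈ connectedComponent A → δ T A = δ T B
  constant : ∀ (T : ReferenceOperator.{u}) (A : T.admissiblePaths),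
    (∀ t, A.1 t = A.1 0) → δ T A = 0
  directSum : ∀ (T₁ T₂ : ReferenceOperator.{u}) (A₁ : T₁.admissiblePaths)
    (A₂ : T₂.admissiblePaths) (A : (T₁.prod T₂).admissiblePaths),
    (∀ (t : ℝ) (w : (T₁.prod T₂).W), A.1 t w =
      WithLp.toLp 2 (A₁.1 t (prodFst T₁.op T₂.op w), A₂.1 t (prodSnd T₁.op T₂.op w))) →
    δ (T₁.prod T₂) A = δ T₁ A₁ + δ T₂ A₂
  catenation : ∀ (T : ReferenceOperator.{u}) (A Al Ar : T.admissiblePaths),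
    (∀ t, 0 ≤ t → Al.1 t = A.1 0 ∧ Ar.1 (-t) = A.1 0) →
    (∀ t, t ≤ 0 → A.1 t = Al.1 t) → (∀ t, 0 ≤ t → A.1 t = Ar.1 t) →
    δ T A = δ T Al + δ T Ar
  normalization : ∀ (T : ReferenceOperator.{u}) (A : T.admissiblePaths),
    Module.finrank ℝ T.H = 1 → (∀ t w, A.1 t w = Real.arctan t • T.incl w) → δ T A = 0

theorem IsSpectralFlow.sub {μ ν : ∀ T : ReferenceOperator.{u}, T.admissiblePaths → ℤ}
    (hμ : IsSpectralFlow μ) (hν : IsSpectralFlow ν) : IsNullFlow fun T A => μ T A - ν T A where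
  homotopy T A B h := by rw [hμ.homotopy T A B h, hν.homotopy T A B h]
  constant T A h := by rw [hμ.constant T A h, hν.constant T A h, sub_zero]
  directSum T₁ T₂ A₁ A₂ A h := by
    rw [hμ.directSum T₁ T₂ A₁ A₂ A h, hν.directSum T₁ T₂ A₁ A₂ A h]; ring
  catenation T A Al Ar h hl hr := by
    rw [hμ.catenation T A Al Ar h hl hr, hν.catenation T A Al Ar h hl hr]; ring
  normalization T A h hA := by rw [hμ.normalization T A h hA, hν.normalization T A h hA, sub_self]

/-- `B` and `C` are joined by a path on which `δ` vanishes. -/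
def NullRel (δ : ∀ T : ReferenceOperator.{u}, T.admissiblePaths → ℤ) (T : ReferenceOperator.{u})
    (B C : T.W →L[ℝ] T.H) : Prop :=
  ∃ (hB : B ∈ T.invertibles) (hC : C ∈ T.invertibles), δ T ⟨stepPath 0 B C, stepPath_mem 0 hB hC⟩ = 0

namespace IsNullFlow

variable {δ : ∀ T : ReferenceOperator.{u}, T.admissiblePaths → ℤ} (hδ : IsNullFlow δ)
  {T : ReferenceOperator.{u}}
include hδ

theorem eq_of_homotopy {γ : ℝ → ℝ →ᵇ (T.W →L[ℝ] T.H)} (hγ : Continuous γ)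
    (h : ∀ s ∈ Set.Icc (0 : ℝ) 1, γ s ∈ T.admissiblePaths) {A B : T.admissiblePaths}
    (hA : γ 0 = A.1) (hB : γ 1 = B.1) : δ T A = δ T B :=
  hδ.homotopy T A B (mem_connectedComponent_of_homotopy hγ h hA hB)

/-- The value on a path only depends on the limits of the path. -/
theorem eq_of_tendsto {A A' : T.admissiblePaths} {B C : T.W →L[ℝ] T.H} (h1 : Tendsto A.1 atBot (𝓝 B))
    (h2 : Tendsto A.1 atTop (𝓝 C)) (h1' : Tendsto A'.1 atBot (𝓝 B))
    (h2' : Tendsto A'.1 atTop (𝓝 C)) : δ T A = δ T A' := by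
  have hB : B.IsInvertible := by
    obtain ⟨B', hB', h⟩ := A.2.2.1
    rwa [tendsto_nhds_unique h h1] at hB'
  have hC : C.IsInvertible := by
    obtain ⟨B', hB', h⟩ := A.2.2.2
    rwa [tendsto_nhds_unique h h2] at hB'
  refine hδ.eq_of_homotopy (continuous_opSegment A.1 A'.1) (fun s _ => ?_)
    (opSegment_zero A.1 A'.1) (opSegment_one A.1 A'.1)
  exact mem_admissiblePaths (fun t => (A.2.1 t).lineMap (A'.2.1 t) s) hB hC
    (tendsto_opSegment_self h1 h1' s) (tendsto_opSegment_self h2 h2' s)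

theorem eq_zero_of_nullRel {A : T.admissiblePaths} {B C : T.W →L[ℝ] T.H} (h : NullRel δ T B C)
    (h1 : Tendsto A.1 atBot (𝓝 B)) (h2 : Tendsto A.1 atTop (𝓝 C)) : δ T A = 0 := by
  obtain ⟨hB, hC, h⟩ := h
  rw [← h]
  exact hδ.eq_of_tendsto h1 h2 (tendsto_stepPath_atBot 0 B C) (tendsto_stepPath_atTop 0 B C)

theorem nullRel_of_tendsto {A : T.admissiblePaths} {B C : T.W →L[ℝ] T.H}
    (h1 : Tendsto A.1 atBot (𝓝 B)) (h2 : Tendsto A.1 atTop (𝓝 C)) (h : δ T A = 0) :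
    NullRel δ T B C := by
  have hB : B ∈ T.invertibles := by
    obtain ⟨B', hB', h⟩ := A.2.2.1
    refine ⟨.of_tendsto A.2.1 h1, ?_⟩
    rwa [tendsto_nhds_unique h h1] at hB'
  have hC : C ∈ T.invertibles := by
    obtain ⟨B', hB', h⟩ := A.2.2.2
    refine ⟨.of_tendsto A.2.1 h2, ?_⟩
    rwa [tendsto_nhds_unique h h2] at hB'
  refine ⟨hB, hC, ?_⟩
  rw [← h]
  exact hδ.eq_of_tendsto (tendsto_stepPath_atBot 0 B C) (tendsto_stepPath_atTop 0 B C) h1 h2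

/-- The two legs are traversed during [-1, 0] and [0, 1], so that they meet at time 0 as the
catenation axiom demands. Shifting a leg in time or replacing the concatenation by the direct
segment costs nothing, because only the limits matter. -/
theorem step_add_step {B C D : T.W →L[ℝ] T.H} (hB : B ∈ T.invertibles) (hC : C ∈ T.invertibles)
    (hD : D ∈ T.invertibles) : δ T ⟨stepPath 0 B D, stepPath_mem 0 hB hD⟩ =
      δ T ⟨stepPath 0 B C, stepPath_mem 0 hB hC⟩ + δ T ⟨stepPath 0 C D, stepPath_mem 0 hC hD⟩ := by
  have h1 : ∀ t, t ≤ 0 → twoStepPath B C D t = stepPath (-1) B C t := fun t =>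
    twoStepPath_of_nonpos B C D
  have h2 : ∀ t, 0 ≤ t → twoStepPath B C D t = stepPath 0 C D t := fun t =>
    twoStepPath_of_nonneg B C D
  have h3 : Tendsto (twoStepPath B C D) atBot (𝓝 B) :=
    (tendsto_stepPath_atBot (-1) B C).congr'
      ((eventually_le_atBot 0).mono fun t ht => (h1 t ht).symm)
  have h4 : Tendsto (twoStepPath B C D) atTop (𝓝 D) :=
    (tendsto_stepPath_atTop 0 C D).congr'
      ((eventually_ge_atTop 0).mono fun t ht => (h2 t ht).symm)
  have hmem : twoStepPath B C D ∈ T.admissiblePaths := by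
    refine mem_admissiblePaths (fun t => ?_) hB.2 hD.2 h3 h4
    rcases le_total t 0 with h | h
    · rw [h1 t h]; exact (stepPath_mem (-1) hB hC).1 t
    · rw [h2 t h]; exact (stepPath_mem 0 hC hD).1 t
  have h5 : twoStepPath B C D 0 = C := by rw [h2 0 le_rfl, stepPath_of_le _ _ le_rfl]
  have e1 := hδ.catenation T ⟨_, hmem⟩ ⟨_, stepPath_mem (-1) hB hC⟩ ⟨_, stepPath_mem 0 hC hD⟩
    (fun t ht => ⟨(stepPath_of_ge B C (by linarith)).trans h5.symm,
      (stepPath_of_le C D (by linarith)).trans h5.symm⟩) h1 h2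
  rw [hδ.eq_of_tendsto (A := ⟨_, stepPath_mem (-1) hB hC⟩) (A' := ⟨_, stepPath_mem 0 hB hC⟩)
    (tendsto_stepPath_atBot (-1) B C) (tendsto_stepPath_atTop (-1) B C)
    (tendsto_stepPath_atBot 0 B C) (tendsto_stepPath_atTop 0 B C)] at e1
  rw [← e1]
  exact hδ.eq_of_tendsto (tendsto_stepPath_atBot 0 B D) (tendsto_stepPath_atTop 0 B D) h3 h4

theorem nullRel_refl {B : T.W →L[ℝ] T.H} (hB : B ∈ T.invertibles) : NullRel δ T B B := by
  refine ⟨hB, hB, hδ.constant T _ fun t => ?_⟩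
  change stepPath 0 B B t = stepPath 0 B B 0
  rw [stepPath_apply, stepPath_apply, sub_self, smul_zero, smul_zero]

theorem nullRel_trans {B C D : T.W →L[ℝ] T.H} (h1 : NullRel δ T B C) (h2 : NullRel δ T C D) :
    NullRel δ T B D := by
  obtain ⟨hB, hC, h1⟩ := h1
  obtain ⟨_, hD, h2⟩ := h2
  exact ⟨hB, hD, by rw [hδ.step_add_step hB hC hD, h1, h2, add_zero]⟩

theorem nullRel_symm {B C : T.W →L[ℝ] T.H} (h : NullRel δ T B C) : NullRel δ T C B := by
  obtain ⟨hB, hC, h⟩ := h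
  obtain ⟨_, _, h'⟩ := hδ.nullRel_refl hB
  refine ⟨hC, hB, ?_⟩
  rw [hδ.step_add_step hB hC hB, h, zero_add] at h'
  exact h'

/-- Retracting the right end along the segment deforms the step from B to C into the constant path
at B. All intermediate right limits are points of the segment, hence invertible. -/
theorem nullRel_of_segment {B C : T.W →L[ℝ] T.H} (hB : T.IsAdmissible B) (hC : T.IsAdmissible C)
    (h : ∀ s ∈ Set.Icc (0 : ℝ) 1, (B + s • (C - B)).IsInvertible) : NullRel δ T B C := by
  have hB' : B ∈ T.invertibles := ⟨hB, by simpa using h 0 ⟨le_rfl, zero_le_one⟩⟩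
  have hC' : C ∈ T.invertibles := ⟨hC, by simpa using h 1 ⟨zero_le_one, le_rfl⟩⟩
  obtain ⟨_, _, h0⟩ := hδ.nullRel_refl hB'
  refine ⟨hB', hC', ?_⟩
  rw [← h0]
  refine (hδ.eq_of_homotopy (continuous_opSegment (stepPath 0 B B) (stepPath 0 B C))
    (fun s hs => ?_) (opSegment_zero _ _) (opSegment_one _ _)).symm
  refine mem_admissiblePaths (fun t => ?_) hB'.2 (h s hs)
    (tendsto_opSegment_self (tendsto_stepPath_atBot 0 B B) (tendsto_stepPath_atBot 0 B C) s)
    (tendsto_opSegment (tendsto_stepPath_atTop 0 B B) (tendsto_stepPath_atTop 0 B C) s)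
  exact ((stepPath_mem 0 hB' hB').1 t).lineMap ((stepPath_mem 0 hB' hC').1 t) s

/-- Nearby invertible operators are related. -/
theorem eventually_nullRel {B : T.W →L[ℝ] T.H} (hB : B ∈ T.invertibles) :
    ∀ᶠ C in 𝓝 B, T.IsAdmissible C → NullRel δ T B C := by
  obtain ⟨r, hr, h⟩ := Metric.isOpen_iff.1 (isOpen_isInvertible (W := T.W) (H := T.H)) B hB.2
  filter_upwards [Metric.ball_mem_nhds B hr] with C hC hC'
  refine hδ.nullRel_of_segment hB.1 hC' fun s hs => h ?_
  exact (convex_ball B r).add_smul_sub_mem (Metric.mem_ball_self hr) hC hs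

/-- The relation is an equivalence relation whose classes are open among the invertible admissible
operators, and the parameter line is connected. -/
theorem nullRel_of_continuous {γ : ℝ → T.W →L[ℝ] T.H} (hγ : Continuous γ)
    (h : ∀ s, γ s ∈ T.invertibles) (s s' : ℝ) : NullRel δ T (γ s) (γ s') := by
  refine isPreconnected_univ.induction₂ (fun s s' => NullRel δ T (γ s) (γ s')) (fun s _ => ?_)
    (fun _ _ _ _ _ _ => hδ.nullRel_trans) (fun _ _ _ _ => hδ.nullRel_symm)
    (Set.mem_univ s) (Set.mem_univ s')
  rw [nhdsWithin_univ]
  exact ((hγ.tendsto s).eventually (hδ.eventually_nullRel (h s))).mono fun s' hs' => hs' (h s').1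

/-- Cancellation of a direct summand. -/
theorem nullRel_of_diagOp {T' : ReferenceOperator.{u}} {B C : T.W →L[ℝ] T.H}
    {b c : T'.W →L[ℝ] T'.H} (hB : B ∈ T.invertibles) (hC : C ∈ T.invertibles)
    (h : NullRel δ (T.prod T') (diagOp B b) (diagOp C c)) (h' : NullRel δ T' b c) :
    NullRel δ T B C := by
  obtain ⟨h1, h2, h3⟩ := h
  obtain ⟨hb, hc, h4⟩ := h'
  refine ⟨hB, hC, ?_⟩
  rw [hδ.directSum T T' ⟨_, stepPath_mem 0 hB hC⟩ ⟨_, stepPath_mem 0 hb hc⟩, h4, add_zero] at h3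
  · exact h3
  · intro t w
    refine Eq.trans ?_ (diagOp_apply (stepPath 0 B C t) (stepPath 0 b c t) w)
    change (diagOp B b + ramp (t - 0) • (diagOp C c - diagOp B b)) w =
      diagOp (B + ramp (t - 0) • (C - B)) (b + ramp (t - 0) • (c - b)) w
    refine sum_ext ?_ ?_
    · rw [sumFst_diagOp, add_apply, smul_apply, sub_apply, map_add, map_smul, map_sub,
        sumFst_diagOp, sumFst_diagOp]
      rfl
    · rw [sumSnd_diagOp, add_apply, smul_apply, sub_apply, map_add, map_smul, map_sub,
        sumSnd_diagOp, sumSnd_diagOp]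
      rfl

end IsNullFlow

/-! ### The auxiliary line and the comparison of invertible operators -/

/-- The zero operator on a line. -/
def ReferenceOperator.line : ReferenceOperator.{u} where
  H := EuclideanSpace ℝ PUnit.{u + 1}
  op := (0 : EuclideanSpace ℝ PUnit.{u + 1} →ₗ[ℝ] EuclideanSpace ℝ PUnit.{u + 1}).toPMap ⊤
  dense_domain := dense_univ
  isSelfAdjoint := isSelfAdjoint_of_symmetric_of_maximal _ dense_univ
    (fun _ _ => (inner_zero_left _).trans (inner_zero_right _).symm) (fun _ _ _ => trivial)
  zero_notMem := (zero_notMem_essentialSpectrum_iff _).2 (isFredholm_of_finiteDimensional _)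

theorem finrank_line : Module.finrank ℝ line.{u}.H = 1 :=
  (finrank_euclideanSpace (ι := PUnit.{u + 1}) (𝕜 := ℝ)).trans Fintype.card_punit

instance : FiniteDimensional ℝ line.{u}.H := Module.finite_of_finrank_eq_succ finrank_line

theorem exists_unit_line : ∃ f : line.{u}.W, ‖line.{u}.incl f‖ = 1 ∧
    ∀ x, ⟪line.{u}.incl f, x⟫_ℝ • line.{u}.incl f = x := by
  have : Nontrivial line.{u}.H :=
    Module.nontrivial_of_finrank_pos (R := ℝ) (by rw [finrank_line]; exact one_pos)
  obtain ⟨y, hy⟩ := exists_norm_eq line.{u}.H zero_le_one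
  obtain ⟨f, hf⟩ := line.{u}.incl_bijective.2 y
  have h1 : ‖line.{u}.incl f‖ = 1 := by rw [hf, hy]
  refine ⟨f, h1, fun x => ?_⟩
  obtain ⟨c, rfl⟩ := exists_smul_eq_of_finrank_eq_one finrank_line
    (norm_ne_zero_iff.1 (h1.trans_ne one_ne_zero)) x
  rw [inner_smul_right, real_inner_self_eq_norm_sq, h1, one_pow, mul_one]

theorem isInvertible_smul {W H : Type*} [NormedAddCommGroup W] [NormedSpace ℝ W]
    [NormedAddCommGroup H] [NormedSpace ℝ H] {B : W →L[ℝ] H} (hB : B.IsInvertible) {c : ℝ}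
    (hc : c ≠ 0) : (c • B).IsInvertible :=
  ContinuousLinearMap.IsInvertible.of_inverse (g := c⁻¹ • B.inverse)
    (by ext x; change c • B (c⁻¹ • B.inverse x) = x
        rw [map_smul, smul_smul, mul_inv_cancel₀ hc, one_smul, hB.self_apply_inverse])
    (by ext x; change c⁻¹ • B.inverse (c • B x) = x
        rw [map_smul, smul_smul, inv_mul_cancel₀ hc, one_smul, hB.inverse_apply_self])

theorem isInvertible_incl_line : line.{u}.incl.IsInvertible :=
  ⟨ContinuousLinearEquiv.ofBijective _ (LinearMap.ker_eq_bot.2 line.incl_bijective.1)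
    (LinearMap.range_eq_top.2 line.incl_bijective.2), rfl⟩

theorem isAdmissible_smul_incl_line (c : ℝ) : line.{u}.IsAdmissible (c • line.{u}.incl) :=
  isAdmissible_iff.2 ⟨isCompactOperator_of_locallyCompactSpace_dom _,
    (isSymmetricAlong_self _).smul c⟩

theorem smul_incl_line_mem {c : ℝ} (hc : c ≠ 0) : c • line.{u}.incl ∈ line.{u}.invertibles :=
  ⟨isAdmissible_smul_incl_line c, isInvertible_smul isInvertible_incl_line hc⟩

/-- The path `t ↦ arctan t • v`. -/
def arctanSmul {V : Type*} [NormedAddCommGroup V] [NormedSpace ℝ V] (v : V) : ℝ →ᵇ V :=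
  BoundedContinuousFunction.ofNormedAddCommGroup (fun t => Real.arctan t • v)
    (Real.continuous_arctan.smul continuous_const) (Real.pi / 2 * ‖v‖) fun t => by
      rw [norm_smul, Real.norm_eq_abs]
      gcongr
      exact abs_le.2 ⟨(Real.neg_pi_div_two_lt_arctan t).le, (Real.arctan_lt_pi_div_two t).le⟩

theorem tendsto_arctanSmul_atBot {V : Type*} [NormedAddCommGroup V] [NormedSpace ℝ V] (v : V) :
    Tendsto (arctanSmul v) atBot (𝓝 (-(Real.pi / 2) • v)) :=
  (tendsto_nhds_of_tendsto_nhdsWithin Real.tendsto_arctan_atBot).smul_const v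

theorem tendsto_arctanSmul_atTop {V : Type*} [NormedAddCommGroup V] [NormedSpace ℝ V] (v : V) :
    Tendsto (arctanSmul v) atTop (𝓝 ((Real.pi / 2) • v)) :=
  (tendsto_nhds_of_tendsto_nhdsWithin Real.tendsto_arctan_atTop).smul_const v

namespace IsNullFlow

variable {δ : ∀ T : ReferenceOperator.{u}, T.admissiblePaths → ℤ} (hδ : IsNullFlow δ)
  {T : ReferenceOperator.{u}}
include hδ

/-- Multiples with the same sign are joined by a segment of invertible operators. The sign is
changed by the arctan path from -π/2 to π/2, on which δ is zero by normalization. -/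
theorem nullRel_line {a b : ℝ} (ha : a ≠ 0) (hb : b ≠ 0) :
    NullRel δ line.{u} (a • line.{u}.incl) (b • line.{u}.incl) := by
  have hp : (0 : ℝ) < Real.pi / 2 := Real.pi_div_two_pos
  have hseg : ∀ {a b : ℝ}, 0 < a * b →
      NullRel δ line.{u} (a • line.{u}.incl) (b • line.{u}.incl) := fun {a b} hab => by
    refine hδ.nullRel_of_segment (isAdmissible_smul_incl_line a) (isAdmissible_smul_incl_line b)
      fun s hs => ?_
    have e : a • line.{u}.incl + s • (b • line.{u}.incl - a • line.{u}.incl) =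
        (a + s * (b - a)) • line.{u}.incl := by module
    rw [e]
    refine isInvertible_smul isInvertible_incl_line fun h0 => ?_
    have h1 : 0 < (1 - s) * (a * a) + s * (a * b) := by
      rcases hs.1.eq_or_lt with h | h
      · rw [← h]; nlinarith [mul_self_nonneg a, mul_self_pos.2 (left_ne_zero_of_mul hab.ne')]
      · nlinarith [mul_pos h hab, mul_nonneg (sub_nonneg.2 hs.2) (mul_self_nonneg a)]
    have h2 : (1 - s) * (a * a) + s * (a * b) = a * (a + s * (b - a)) := by ring
    rw [h2, h0, mul_zero] at h1
    exact lt_irrefl _ h1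
  have hflip : NullRel δ line.{u} (-(Real.pi / 2) • line.{u}.incl)
      ((Real.pi / 2) • line.{u}.incl) := by
    have hmem : arctanSmul line.{u}.incl ∈ line.{u}.admissiblePaths :=
      mem_admissiblePaths (fun t => isAdmissible_smul_incl_line _)
        (smul_incl_line_mem (neg_ne_zero.2 hp.ne')).2 (smul_incl_line_mem hp.ne').2
        (tendsto_arctanSmul_atBot _) (tendsto_arctanSmul_atTop _)
    exact hδ.nullRel_of_tendsto (A := ⟨_, hmem⟩) (tendsto_arctanSmul_atBot _)
      (tendsto_arctanSmul_atTop _) (hδ.normalization line ⟨_, hmem⟩ finrank_line fun t w => rfl)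
  have hall : ∀ {a : ℝ}, a ≠ 0 →
      NullRel δ line.{u} (a • line.{u}.incl) ((Real.pi / 2) • line.{u}.incl) := fun {a} ha => by
    rcases ha.lt_or_gt with h | h
    · exact hδ.nullRel_trans (hseg (mul_pos_of_neg_of_neg h (neg_lt_zero.2 hp))) hflip
    · exact hseg (mul_pos h hp)
  exact hδ.nullRel_trans (hall ha) (hδ.nullRel_symm (hall hb))

/-- A perturbation of rank one does not change the class of an operator. -/
theorem nullRel_add_rankOne {B : T.W →L[ℝ] T.H} (hB : B ∈ T.invertibles) {e : T.H} {c : ℝ}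
    (h : (B + c • rankOne T.incl e).IsInvertible) : NullRel δ T B (B + c • rankOne T.incl e) := by
  obtain ⟨f, hf, hf'⟩ := exists_unit_line.{u}
  set α := ⟪e, T.incl (B.inverse e)⟫_ℝ with hα
  have hD : 1 + c * α ≠ 0 := one_add_ne_zero_of_isInvertible hB.2 h
  -- The sign κ on the auxiliary line is the sign of α, so that κα has a square root m. This gives
  -- the rotating vector below the same quadratic form at both ends.
  obtain ⟨κ, hκ, m, hm⟩ : ∃ κ : ℝ, κ * κ = 1 ∧ ∃ m : ℝ, m * m = κ * α := by
    rcases le_total 0 α with h | h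
    · exact ⟨1, by norm_num, Real.sqrt α, by rw [Real.mul_self_sqrt h, one_mul]⟩
    · exact ⟨-1, by norm_num, Real.sqrt (-α), by
        rw [Real.mul_self_sqrt (neg_nonneg.2 h), neg_one_mul]⟩
  have hκ0 : κ ≠ 0 := left_ne_zero_of_mul (hκ.trans_ne one_ne_zero)
  set M := diagOp B (κ • line.{u}.incl)
  have hM : M.IsInvertible := isInvertible_diagOp hB.2 (smul_incl_line_mem hκ0).2
  have hMa : (T.prod line.{u}).IsAdmissible M :=
    isAdmissible_diagOp hB.1 (isAdmissible_smul_incl_line κ)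
  -- The vector turns from e to m times the unit vector of the line, and ⟪v, M⁻¹v⟫ = cos² α + sin²
  -- κm² = α throughout. By the Sherman-Morrison criterion the rank one perturbation along v keeps M
  -- invertible. The ends of the curve are (B + c e⊗e) ⊕ κ at s = 0 and B ⊕ κ(1 + cα) at s = π/2.
  let v : ℝ → (T.prod line.{u}).H := fun s =>
    sumInl T line.{u} (Real.cos s • e) + sumInr T line.{u} ((Real.sin s * m) • line.{u}.incl f)
  have hv1 : ∀ s, sumFst T line.{u} (v s) = Real.cos s • e := fun s => by
    rw [map_add, sumFst_sumInl, sumFst_sumInr, add_zero]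
  have hv2 : ∀ s, sumSnd T line.{u} (v s) = (Real.sin s * m) • line.{u}.incl f := fun s => by
    rw [map_add, sumSnd_sumInl, sumSnd_sumInr, zero_add]
  have hvc : Continuous v :=
    ((sumInl T line.{u}).continuous.comp (Real.continuous_cos.smul continuous_const)).add
      ((sumInr T line.{u}).continuous.comp
        ((Real.continuous_sin.mul continuous_const).smul continuous_const))
  have hinv : ∀ s, M.inverse (v s) = domInl T line.{u} (Real.cos s • B.inverse e) +
      domInr T line.{u} ((κ * (Real.sin s * m)) • f) := fun s => by
    have h1 : M (domInl T line.{u} (Real.cos s • B.inverse e) +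
      domInr T line.{u} ((κ * (Real.sin s * m)) • f)) = v s := by
      refine sum_ext ?_ ?_
      · rw [hv1, sumFst_diagOp, map_add, domFst_domInl, domFst_domInr, add_zero, map_smul,
          hB.2.self_apply_inverse]
      · rw [hv2, sumSnd_diagOp, map_add, domSnd_domInl, domSnd_domInr, zero_add, map_smul,
          smul_apply, smul_smul, mul_right_comm, hκ, one_mul]
    rw [← h1, hM.inverse_apply_self]
  have hd : ∀ s, ⟪v s, (T.prod line.{u}).incl (M.inverse (v s))⟫_ℝ = α := fun s => by
    have h1 : domFst T line.{u} (M.inverse (v s)) = Real.cos s • B.inverse e := by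
      rw [hinv, map_add, domFst_domInl, domFst_domInr, add_zero]
    have h2 : domSnd T line.{u} (M.inverse (v s)) = (κ * (Real.sin s * m)) • f := by
      rw [hinv, map_add, domSnd_domInl, domSnd_domInr, zero_add]
    rw [inner_sum, sumFst_incl, sumSnd_incl, hv1, hv2, h1, h2, map_smul, map_smul,
      inner_smul_left, inner_smul_right, inner_smul_left, inner_smul_right, ← hα,
      real_inner_self_eq_norm_sq, hf]
    change Real.cos s * (Real.cos s * α) + Real.sin s * m * (κ * (Real.sin s * m) * 1 ^ 2) = α
    linear_combination (Real.sin s ^ 2 * κ) * hm + (Real.sin s ^ 2 * α) * hκ +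
      α * Real.sin_sq_add_cos_sq s
  have hmem : ∀ s, M + c • rankOne (T.prod line.{u}).incl (v s) ∈ (T.prod line.{u}).invertibles :=
    fun s => ⟨hMa.add ((isCompactOperator_rankOne _ _).smul c)
      ((isSymmetricAlong_rankOne _ _).smul c), isInvertible_add_rankOne hM (by rwa [hd])⟩
  have hγ : Continuous fun s => M + c • rankOne (T.prod line.{u}).incl (v s) := by
    have h1 := (continuous_rankOne (T.prod line.{u}).incl).comp hvc
    exact continuous_const.add (h1.const_smul c)
  have hrel := hδ.nullRel_of_continuous hγ hmem (Real.pi / 2) 0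
  have e1 : M + c • rankOne (T.prod line.{u}).incl (v (Real.pi / 2)) =
      diagOp B ((κ * (1 + c * α)) • line.{u}.incl) := by
    refine ContinuousLinearMap.ext fun w => sum_ext ?_ ?_
    · rw [add_apply, smul_apply, rankOne_apply, map_add, map_smul, map_smul, hv1,
        Real.cos_pi_div_two, zero_smul, smul_zero, smul_zero, add_zero, sumFst_diagOp,
        sumFst_diagOp]
    · rw [add_apply, smul_apply, rankOne_apply, map_add, map_smul, map_smul, inner_sum, hv1, hv2,
        Real.cos_pi_div_two, Real.sin_pi_div_two, zero_smul, inner_zero_left, zero_add, one_mul,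
        sumSnd_incl, sumSnd_diagOp, sumSnd_diagOp, inner_smul_left]
      set x := domSnd T line.{u} w
      have h3 : (m * ⟪line.{u}.incl f, line.{u}.incl x⟫_ℝ) • m • line.{u}.incl f =
          (κ * α) • line.{u}.incl x := by
        rw [← hm]
        conv_rhs => rw [← hf' (line.{u}.incl x)]
        module
      refine (congrArg (fun z => (κ • line.{u}.incl) x + c • z) h3).trans ?_
      rw [smul_apply, smul_apply]
      module
  have e2 : M + c • rankOne (T.prod line.{u}).incl (v 0) =
      diagOp (B + c • rankOne T.incl e) (κ • line.{u}.incl) := by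
    refine ContinuousLinearMap.ext fun w => sum_ext ?_ ?_
    · rw [add_apply, smul_apply, rankOne_apply, map_add, map_smul, map_smul, hv1, inner_sum, hv1,
        hv2, Real.cos_zero, Real.sin_zero, zero_mul, zero_smul, inner_zero_left, add_zero,
        one_smul, sumFst_incl, sumFst_diagOp, sumFst_diagOp]
      rfl
    · rw [add_apply, smul_apply, rankOne_apply, map_add, map_smul, map_smul, hv2,
        Real.sin_zero, zero_mul, zero_smul, smul_zero, smul_zero, add_zero, sumSnd_diagOp,
        sumSnd_diagOp]
  rw [e1, e2] at hrel
  -- The line components κ(1 + cα) and κ are nonzero and hence related, whatever their signs, so the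
  -- line can be cancelled.
  exact hδ.nullRel_of_diagOp hB ⟨hB.1.add ((isCompactOperator_rankOne _ _).smul c)
    ((isSymmetricAlong_rankOne _ _).smul c), h⟩ hrel
    (hδ.nullRel_line (mul_ne_zero hκ0 hD) hκ0)

/-- A symmetric perturbation of finite rank does not change the class of an operator. -/
theorem nullRel_add_finiteRankSymm {N : T.W →L[ℝ] T.H} (hN : N ∈ finiteRankSymm T.incl) :
    ∀ {B : T.W →L[ℝ] T.H}, B ∈ T.invertibles → (B + N).IsInvertible → NullRel δ T B (B + N) := by
  obtain ⟨n, c, g, rfl⟩ := Submodule.mem_span_set'.1 hN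
  have hg : ∀ i, ∃ e, rankOne T.incl e = g i := fun i => (g i).2
  choose e he using hg
  simp only [← he]
  suffices h : ∀ (s : Finset (Fin n)) (B : T.W →L[ℝ] T.H), B ∈ T.invertibles →
      (B + ∑ i ∈ s, c i • rankOne T.incl (e i)).IsInvertible →
      NullRel δ T B (B + ∑ i ∈ s, c i • rankOne T.incl (e i)) from fun {B} => h Finset.univ B
  intro s
  induction s using Finset.induction_on with
  | empty =>
    intro B hB _
    rw [Finset.sum_empty, add_zero]
    exact hδ.nullRel_refl hB
  | insert i s hi ih =>
    intro B hB hBN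
    rw [Finset.sum_insert hi] at hBN ⊢
    set N := ∑ i ∈ s, c i • rankOne T.incl (e i)
    set R := rankOne T.incl (e i)
    have hNa : N ∈ finiteRankSymm T.incl := Submodule.sum_mem _ fun i _ =>
      Submodule.smul_mem _ _ (Submodule.subset_span ⟨_, rfl⟩)
    have hRa : R ∈ finiteRankSymm T.incl := Submodule.subset_span ⟨_, rfl⟩
    have hBNa : T.IsAdmissible (B + (c i • R + N)) :=
      hB.1.add_finiteRankSymm (Submodule.add_mem _ (Submodule.smul_mem _ _ hRa) hNa)
    set α := ⟪e i, T.incl (B.inverse (e i))⟫_ℝ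
    -- Removing one rank one term may destroy invertibility. The coefficient c_i is therefore moved
    -- to a nearby x for which B + xR is invertible and B + xR + N still is. The chain is B, B + xR,
    -- B + xR + N, B + c_i R + N, with N handled by induction.
    have ev1 : ∀ᶠ x in 𝓝[≠] c i, 1 + x * α ≠ 0 := by
      by_cases h0 : 1 + c i * α = 0
      · filter_upwards [self_mem_nhdsWithin] with x hx h1
        have h2 : (x - c i) * α = 0 := by linear_combination h1 - h0
        rcases mul_eq_zero.1 h2 with h | h
        · exact hx (sub_eq_zero.1 h)
        · rw [h, mul_zero, add_zero] at h0
          exact one_ne_zero h0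
      · have h1 : Continuous fun x : ℝ => 1 + x * α := by fun_prop
        exact ((h1.tendsto (c i)).eventually_ne h0).filter_mono nhdsWithin_le_nhds
    have ev2 : ∀ᶠ x in 𝓝[≠] c i, (B + (c i • R + N) + (x - c i) • R).IsInvertible := by
      have h1 : Continuous fun x : ℝ => B + (c i • R + N) + (x - c i) • R :=
        continuous_const.add ((continuous_id.sub continuous_const).smul continuous_const)
      have h2 := h1.tendsto (c i)
      rw [sub_self, zero_smul, add_zero] at h2
      exact (h2.eventually (isOpen_isInvertible.mem_nhds hBN)).filter_mono nhdsWithin_le_nhds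
    obtain ⟨x, hx1, hx2⟩ := (ev1.and ev2).exists
    have hx1' := isInvertible_add_rankOne hB.2 hx1
    have e1 : B + (c i • R + N) + (x - c i) • R = B + x • R + N := by module
    have h1 := hδ.nullRel_add_rankOne hB hx1'
    have h2 := ih (B + x • R)
      ⟨hB.1.add_finiteRankSymm (Submodule.smul_mem _ _ hRa), hx1'⟩ (by rwa [← e1])
    have h3 := hδ.nullRel_add_rankOne ⟨hBNa, hBN⟩ hx2
    rw [e1] at h3
    exact hδ.nullRel_trans h1 (hδ.nullRel_trans h2 (hδ.nullRel_symm h3))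

/-- Any two invertible admissible operators are related. -/
theorem nullRel {B C : T.W →L[ℝ] T.H} (hB : B ∈ T.invertibles) (hC : C ∈ T.invertibles) :
    NullRel δ T B C := by
  -- The relation is extended to all admissible operators, invertible or not, by comparing all their
  -- invertible finite rank corrections. It can then be propagated through the convex set of
  -- admissible operators, whereas the invertible ones need not form a connected set.
  let P : (T.W →L[ℝ] T.H) → (T.W →L[ℝ] T.H) → Prop := fun B C =>
    ∀ N ∈ finiteRankSymm T.incl, ∀ N' ∈ finiteRankSymm T.incl, (B + N).IsInvertible →
      (C + N').IsInvertible → NullRel δ T (B + N) (C + N')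
  have hconv : Convex ℝ {B | T.IsAdmissible B} := fun B hB C hC a b _ _ hab => by
    have e : a • B + b • C = B + b • (C - B) := by
      rw [eq_sub_of_add_eq hab]
      module
    rw [e]
    exact IsAdmissible.lineMap hB hC b
  have hP : P B C := by
    refine hconv.isPreconnected.induction₂ P (fun B hB => ?_) (fun B C D hB hC hD h1 h2 => ?_)
      (fun B C hB hC h N hN N' hN' h1 h2 => hδ.nullRel_symm (h N' hN' N hN h2 h1)) hB.1 hC.1
    · obtain ⟨N₀, hN₀, hi⟩ := IsAdmissible.exists_isInvertible_add hB
      have hadd : ∀ {C N N'}, T.IsAdmissible C → N ∈ finiteRankSymm T.incl →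
          N' ∈ finiteRankSymm T.incl → (C + N).IsInvertible → (C + N').IsInvertible →
          NullRel δ T (C + N) (C + N') := fun {C N N'} hC hN hN' h1 h2 => by
        have e : C + N' = C + N + (N' - N) := by abel
        rw [e] at h2 ⊢
        exact hδ.nullRel_add_finiteRankSymm (Submodule.sub_mem _ hN' hN)
          ⟨hC.add_finiteRankSymm hN, h1⟩ h2
      have h1 : Tendsto (fun C => C + N₀) (𝓝 B) (𝓝 (B + N₀)) :=
        (continuous_id.add continuous_const).tendsto B
      have h2 := h1.eventually (hδ.eventually_nullRel ⟨hB.add_finiteRankSymm hN₀, hi⟩)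
      filter_upwards [h2.filter_mono nhdsWithin_le_nhds, self_mem_nhdsWithin] with C hC hCa
      intro N hN N' hN' h3 h4
      have h5 := hC (hCa.add_finiteRankSymm hN₀)
      obtain ⟨_, ⟨_, h6⟩, _⟩ := id h5
      exact hδ.nullRel_trans (hadd hB hN hN₀ h3 hi)
        (hδ.nullRel_trans h5 (hadd hCa hN₀ hN' h6 h4))
    -- Transitivity requires that the intermediate operator has at least one invertible correction.
    · intro N hN N' hN' h3 h4
      obtain ⟨N₀, hN₀, hi⟩ := IsAdmissible.exists_isInvertible_add hC
      exact hδ.nullRel_trans (h1 N hN N₀ hN₀ h3 hi) (h2 N₀ hN₀ N' hN' hi h4)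
  have h := hP 0 (Submodule.zero_mem _) 0 (Submodule.zero_mem _)
  rw [add_zero, add_zero] at h
  exact h hB.2 hC.2

theorem eq_zero (A : T.admissiblePaths) : δ T A = 0 := by
  obtain ⟨h, ⟨B, hB, h1⟩, ⟨C, hC, h2⟩⟩ := A.2
  exact hδ.eq_zero_of_nullRel
    (hδ.nullRel ⟨.of_tendsto h h1, hB⟩ ⟨.of_tendsto h h2, hC⟩) h1 h2

end IsNullFlow

theorem IsSpectralFlow.unique {μ ν : ∀ T : ReferenceOperator.{u}, T.admissiblePaths → ℤ}
    (hμ : IsSpectralFlow μ) (hν : IsSpectralFlow ν) : μ = ν :=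
  funext fun _ => funext fun A => sub_eq_zero.1 ((hμ.sub hν).eq_zero A)

/-! ## Regularity -/

section Proper

variable {X Y Z : Type*} [NormedAddCommGroup X] [NormedSpace ℝ X] [CompleteSpace X]
  [NormedAddCommGroup Y] [NormedSpace ℝ Y] [CompleteSpace Y] [NormedAddCommGroup Z]
  [NormedSpace ℝ Z]

/-- If `D` has finite index and `J` is injective, then `x ↦ (D x, J x)` is proper. -/
theorem HasFiniteIndex.exists_tendsto {D : X →L[ℝ] Y} (hD : HasFiniteIndex (D : X →ₗ[ℝ] Y))
    {J : X →L[ℝ] Z} (hJ : Function.Injective J) {ι : Type*} {l : Filter ι} [l.NeBot] {x : ι → X}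
    {y : Y} {z : Z} (hy : Tendsto (fun i => D (x i)) l (𝓝 y))
    (hz : Tendsto (fun i => J (x i)) l (𝓝 z)) : ∃ x₀, Tendsto x l (𝓝 x₀) := by
  obtain ⟨P, hP, -⟩ := hD.isFredholm.exists_isQuasiInverse
  have hF := LinearMap.FiniteRangeSetoid.equiv_iff_hasNoetherianRange.1 hP
  -- With a quasi-inverse P, the operator PD - 1 has finite rank. On its range the injective J is a
  -- closed embedding, so convergence of J(Fx) implies convergence of Fx, and x = PDx - Fx
  -- converges.
  let F : X →L[ℝ] X := P.comp D - ContinuousLinearMap.id ℝ X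
  have hN : IsNoetherian ℝ F.range := hF
  have hV : FiniteDimensional ℝ F.range := inferInstance
  let JV : F.range →L[ℝ] Z := J.comp F.range.subtypeL
  have hJV : IsClosedEmbedding JV := LinearMap.isClosedEmbedding_of_injective
    (LinearMap.ker_eq_bot.2 fun a b hab => Subtype.ext (hJ hab))
  let v : ι → F.range := fun i => ⟨F (x i), x i, rfl⟩
  have h1 : Tendsto (fun i => P (D (x i))) l (𝓝 (P y)) := (P.continuous.tendsto y).comp hy
  have h2 : Tendsto (fun i => JV (v i)) l (𝓝 (J (P y) - z)) := by
    refine (((J.continuous.tendsto _).comp h1).sub hz).congr fun i => ?_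
    exact (map_sub J _ _).symm
  obtain ⟨v₀, hv₀⟩ := hJV.isClosed_range.mem_of_tendsto h2 (Eventually.of_forall fun i => ⟨v i, rfl⟩)
  rw [← hv₀] at h2
  have h3 : Tendsto v l (𝓝 v₀) := hJV.isInducing.tendsto_nhds_iff.2 h2
  refine ⟨P y - v₀, (h1.sub ((continuous_subtype_val.tendsto v₀).comp h3)).congr fun i => ?_⟩
  exact sub_sub_cancel _ _

end Proper

/-! ### Higher weak derivatives and coefficients with bounded derivatives -/

section WeakDiff

variable {E F : Type u} [NormedAddCommGroup E] [InnerProductSpace ℝ E] [NormedAddCommGroup F]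
  [InnerProductSpace ℝ F]

/-- `f` has weak derivatives in `L²` up to order `k`. -/
def WeakDiff : ℕ → Lp E 2 (volume : Measure ℝ) → Prop
  | 0, _ => True
  | k + 1, f => ∃ g, IsWeakDeriv f g ∧ WeakDiff k g

theorem WeakDiff.mono : ∀ {k : ℕ} {f : Lp E 2 (volume : Measure ℝ)}, WeakDiff (k + 1) f →
    WeakDiff k f
  | 0, _, _ => trivial
  | _ + 1, _, ⟨g, hg, hg'⟩ => ⟨g, hg, hg'.mono⟩

theorem WeakDiff.add : ∀ {k : ℕ} {f g : Lp E 2 (volume : Measure ℝ)}, WeakDiff k f →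
    WeakDiff k g → WeakDiff k (f + g)
  | 0, _, _, _, _ => trivial
  | _ + 1, _, _, ⟨f', hf, hf'⟩, ⟨g', hg, hg'⟩ => ⟨f' + g', hf.add hg, hf'.add hg'⟩

theorem WeakDiff.smul (c : ℝ) : ∀ {k : ℕ} {f : Lp E 2 (volume : Measure ℝ)}, WeakDiff k f →
    WeakDiff k (c • f)
  | 0, _, _ => trivial
  | _ + 1, _, ⟨f', hf, hf'⟩ => ⟨c • f', hf.smul c, hf'.smul c⟩

theorem WeakDiff.sub {k : ℕ} {f g : Lp E 2 (volume : Measure ℝ)} (hf : WeakDiff k f)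
    (hg : WeakDiff k g) : WeakDiff k (f - g) := by
  have h : f - g = f + (-1 : ℝ) • g := by module
  rw [h]
  exact hf.add (hg.smul _)

theorem weakDiff_iff : ∀ {k : ℕ} {f : Lp E 2 (volume : Measure ℝ)},
    WeakDiff k f ↔ ∃ G : Sobolev E k, G.deriv 0 = f
  | 0, f => ⟨fun _ => ⟨⟨WithLp.toLp 2 fun _ => f, fun j => j.elim0⟩, rfl⟩, fun _ => trivial⟩
  | k + 1, f => by
    constructor
    · rintro ⟨g, hg, hg'⟩
      obtain ⟨G, rfl⟩ := weakDiff_iff.1 hg'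
      refine ⟨⟨WithLp.toLp 2 (Fin.cons f fun j => G.deriv j), fun j => ?_⟩, rfl⟩
      refine Fin.cases ?_ (fun i => ?_) j
      · exact hg
      · exact G.2 i
    · rintro ⟨G, rfl⟩
      refine ⟨G.deriv 1, G.2 0, weakDiff_iff.2 ⟨⟨WithLp.toLp 2 fun j => G.deriv j.succ,
        fun j => G.2 j.succ⟩, rfl⟩⟩

/-- `B` has bounded continuous derivatives up to order `k`. -/
def BoundedDiff {V : Type*} [NormedAddCommGroup V] [NormedSpace ℝ V] : ℕ → (ℝ →ᵇ V) → Prop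
  | 0, _ => True
  | k + 1, B => ∃ B' : ℝ →ᵇ V, (∀ t, HasDerivAt B (B' t) t) ∧ BoundedDiff k B'

theorem BoundedDiff.mono {V : Type*} [NormedAddCommGroup V] [NormedSpace ℝ V] :
    ∀ {k : ℕ} {B : ℝ →ᵇ V}, BoundedDiff (k + 1) B → BoundedDiff k B
  | 0, _, _ => trivial
  | _ + 1, _, ⟨B', hB, hB'⟩ => ⟨B', hB, hB'.mono⟩

theorem WeakDiff.mulOp [CompleteSpace E] [CompleteSpace F] :
    ∀ {k : ℕ} {B : ℝ →ᵇ (E →L[ℝ] F)} {f : Lp E 2 (volume : Measure ℝ)}, BoundedDiff k B →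
      WeakDiff k f → WeakDiff k (SpectralFlow.mulOp B f)
  | 0, _, _, _, _ => trivial
  | _ + 1, _, _, ⟨B', hB, hB'⟩, ⟨_, hf, hf'⟩ =>
    ⟨_, hf.mulOp hB, (WeakDiff.mulOp (BoundedDiff.mono ⟨B', hB, hB'⟩) hf').add
      (WeakDiff.mulOp hB' (WeakDiff.mono ⟨_, hf, hf'⟩))⟩

theorem boundedDiff_of_iteratedDeriv {V : Type*} [NormedAddCommGroup V] [NormedSpace ℝ V]
    {A : ℝ → V} : ∀ (k j : ℕ), ContDiff ℝ (j + k : ℕ) A →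
      (∀ i, j ≤ i → i ≤ j + k → ∃ M, ∀ t, ‖iteratedDeriv i A t‖ ≤ M) →
      ∀ B : ℝ →ᵇ V, (∀ t, B t = iteratedDeriv j A t) → BoundedDiff k B
  | 0, _, _, _, _, _ => trivial
  | k + 1, j, hA, hM, B, hB => by
    obtain ⟨M, hM'⟩ := hM (j + 1) (by omega) (by omega)
    have hA' : ContDiff ℝ (j + 1 + k : ℕ) A := by rwa [show j + 1 + k = j + (k + 1) by ring]
    let B' : ℝ →ᵇ V := BoundedContinuousFunction.ofNormedAddCommGroup (iteratedDeriv (j + 1) A)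
      (hA'.continuous_iteratedDeriv _ (by exact_mod_cast (by omega))) M hM'
    refine ⟨B', fun t => ?_, boundedDiff_of_iteratedDeriv k (j + 1) hA'
      (fun i h1 h2 => hM i (by omega) (by omega)) B' fun t => rfl⟩
    have e : (B : ℝ → V) = iteratedDeriv j A := funext hB
    change HasDerivAt B (iteratedDeriv (j + 1) A t) t
    rw [e, iteratedDeriv_succ]
    exact ((hA'.differentiable_iteratedDeriv j (by exact_mod_cast (by omega))) t).hasDerivAt

/-- Test functions with values in `E` are dense. -/
theorem denseRange_sobolev_deriv [CompleteSpace E] (k : ℕ) :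
    DenseRange fun G : Sobolev E k => G.deriv 0 := by
  have hT : ∀ (x : E) (k : ℕ) (φ : ℝ → ℝ) (hφ : ContDiff ℝ ∞ φ) (hc : HasCompactSupport φ),
      WeakDiff k ((ContinuousLinearMap.toSpanSingleton ℝ x).compLpL 2 volume
        (testLp hφ.continuous hc)) := by
    intro x k
    induction k with
    | zero => exact fun _ _ _ => trivial
    | succ k ih =>
      intro φ hφ hc
      exact ⟨_, (isWeakDeriv_testLp hφ hc).compLpL _, ih (deriv φ)
        ((contDiff_infty_iff_deriv.1 hφ).2) hc.deriv⟩
  let R : Submodule ℝ (Lp E 2 (volume : Measure ℝ)) :=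
    { carrier := {f | WeakDiff k f}
      add_mem' := fun hf hg => WeakDiff.add hf hg
      zero_mem' := weakDiff_iff.2 ⟨0, rfl⟩
      smul_mem' := fun c f hf => WeakDiff.smul c hf }
  -- A vector orthogonal to all φ ⊗ x has vanishing pairing with every test function, so it is zero.
  have hR : R.topologicalClosure = ⊤ := by
    rw [Submodule.topologicalClosure_eq_top_iff, Submodule.eq_bot_iff]
    intro η hη
    refine eq_zero_of_testPairing fun φ hφ hc => ext_inner_right ℝ fun x => ?_
    rw [← inner_compLpL_toSpanSingleton, real_inner_comm, inner_zero_left]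
    exact hη _ (hT x k φ hφ hc)
  have hr : Set.range (fun G : Sobolev E k => G.deriv 0) = R :=
    Set.ext fun f => weakDiff_iff.symm
  rw [DenseRange, hr]
  exact Submodule.dense_iff_topologicalClosure_eq_top.2 hR

end WeakDiff

/-! ### Regularity of solutions by difference quotients -/

section Regularity

theorem injective_compLpL {W H : Type*} [NormedAddCommGroup W] [InnerProductSpace ℝ W]
    [NormedAddCommGroup H] [InnerProductSpace ℝ H] {ι : W →L[ℝ] H} (hι : Function.Injective ι) :
    Function.Injective (ι.compLpL 2 (volume : Measure ℝ)) := by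
  intro f g hfg
  refine Lp.ext ?_
  filter_upwards [ι.coeFn_compLpL (p := 2) f, ι.coeFn_compLpL (p := 2) g, Lp.ext_iff.1 hfg]
    with t h1 h2 h3
  rw [h1, h2] at h3
  exact hι h3

variable {W H : Type u} [NormedAddCommGroup W] [InnerProductSpace ℝ W] [NormedAddCommGroup H]
  [InnerProductSpace ℝ H] [CompleteSpace W] [CompleteSpace H]

theorem injective_compLpL_comp_pathFst {ι : W →L[ℝ] H} (hι : Function.Injective ι) :
    Function.Injective ((ι.compLpL 2 (volume : Measure ℝ)).comp (pathFst ι)) := by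
  intro p q hpq
  have h1 : ι.compLpL 2 volume (pathFst ι p) = ι.compLpL 2 volume (pathFst ι q) := hpq
  refine PathSpace.ext (injective_compLpL hι h1) ?_
  have h2 := isWeakDeriv_path p
  rw [h1] at h2
  exact h2.unique (isWeakDeriv_path q)

/-- The derivative of a solution. -/
theorem exists_isWeakDeriv_of_pathOp {ι : W →L[ℝ] H} (hι : Function.Injective ι)
    {A A' : ℝ →ᵇ (W →L[ℝ] H)} (hA : ∀ t, HasDerivAt A (A' t) t)
    (hD : HasFiniteIndex (pathOp ι A : PathSpace ι →ₗ[ℝ] Lp H 2 (volume : Measure ℝ)))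
    {p : PathSpace ι} {η : Lp H 2 (volume : Measure ℝ)} (hη : IsWeakDeriv (pathOp ι A p) η) :
    ∃ p' : PathSpace ι, IsWeakDeriv (pathFst ι p) (pathFst ι p') ∧
      IsWeakDeriv (pathSnd ι p) (pathSnd ι p') ∧ pathOp ι A p' = η - mulOp A' (pathFst ι p) := by
  set w := pathFst ι p
  set h := pathSnd ι p
  have hwh : IsWeakDeriv (ι.compLpL 2 volume w) h := isWeakDeriv_path p
  have hq : ∀ s : ℝ, IsWeakDeriv (ι.compLpL 2 volume (s⁻¹ • (translate s w - w)))
      (s⁻¹ • (translate s h - h)) := fun s => by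
    have h1 := (((hwh.translate s).add (hwh.smul (-1))).smul s⁻¹)
    rw [neg_one_smul, neg_one_smul, ← sub_eq_add_neg, ← sub_eq_add_neg, translate_compLpL,
      ← map_sub, ← map_smul] at h1
    exact h1
  -- The difference quotients of p. Their images under D converge by the discrete Leibniz rule.
  let q : ℝ → PathSpace ι := fun s => pathMk (hq s)
  have hDq : ∀ s, pathOp ι A (q s) = s⁻¹ • (translate s (pathOp ι A p) - pathOp ι A p) -
      mulOp (diffQuot s A) (translate s w) := fun s => by
    have h1 := diffQuot_translate_mulOp (B := A) w s
    rw [pathOp_apply, pathOp_apply, pathFst_mk, pathSnd_mk, eq_sub_of_add_eq h1.symm, map_add]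
    module
  have h1 : Tendsto (fun s => pathOp ι A (q s)) (𝓝[≠] 0) (𝓝 (η - mulOp A' w)) := by
    simp_rw [hDq]
    refine Tendsto.sub ?_ (tendsto_mulOp_diffQuot hA w)
    have := hasDerivAt_iff_tendsto_slope_zero.1 (isWeakDeriv_iff_hasDerivAt.1 hη)
    simpa only [zero_add, translate_zero] using this
  have hJ : Function.Injective ((ι.compLpL 2 (volume : Measure ℝ)).comp (pathFst ι)) :=
    injective_compLpL_comp_pathFst hι
  have h2 : Tendsto (fun s => ((ι.compLpL 2 (volume : Measure ℝ)).comp (pathFst ι)) (q s)) (𝓝[≠] 0)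
      (𝓝 h) := by
    have := hasDerivAt_iff_tendsto_slope_zero.1 (isWeakDeriv_iff_hasDerivAt.1 hwh)
    simp only [zero_add, translate_zero, translate_compLpL] at this
    refine this.congr fun s => ?_
    rw [← map_sub, ← map_smul]
    rfl
  -- A priori the quotients of w converge only after applying ι. Properness of D relative to this
  -- weaker map upgrades this to convergence in the path space, so w has a weak derivative with
  -- values in W.
  obtain ⟨p', hp'⟩ := hD.exists_tendsto hJ h1 h2
  have h3 : ∀ {E : Type u} [NormedAddCommGroup E] [InnerProductSpace ℝ E]
      [CompleteSpace E] (f g : Lp E 2 (volume : Measure ℝ)),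
      Tendsto (fun s : ℝ => s⁻¹ • (translate s f - f)) (𝓝[≠] 0) (𝓝 g) → IsWeakDeriv f g := by
    intro E _ _ _ f g hfg
    refine isWeakDeriv_iff_hasDerivAt.2 (hasDerivAt_iff_tendsto_slope_zero.2 ?_)
    simpa only [zero_add, translate_zero] using hfg
  refine ⟨p', h3 _ _ (((pathFst ι).continuous.tendsto p').comp hp'),
    h3 _ _ (((pathSnd ι).continuous.tendsto p').comp hp'), ?_⟩
  exact tendsto_nhds_unique (((pathOp ι A).continuous.tendsto p').comp hp') h1

/-- Induction on k: the derivative p' of a solution solves D p' = (D p)' - A'w, and its right-hand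
side has order k by the case already known for p. The same case applied to p' gains one derivative.
-/
theorem weakDiff_of_pathOp {ι : W →L[ℝ] H} (hι : Function.Injective ι) {A : ℝ →ᵇ (W →L[ℝ] H)}
    (hD : HasFiniteIndex (pathOp ι A : PathSpace ι →ₗ[ℝ] Lp H 2 (volume : Measure ℝ))) :
    ∀ {k : ℕ}, BoundedDiff k A → ∀ {p : PathSpace ι}, WeakDiff k (pathOp ι A p) →
      WeakDiff k (pathFst ι p) ∧ WeakDiff k (pathSnd ι p)
  | 0, _, _, _ => ⟨trivial, trivial⟩
  | k + 1, ⟨A', hA, hA'⟩, p, ⟨η, hη, hη'⟩ => by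
    have hAk : BoundedDiff k A := BoundedDiff.mono ⟨A', hA, hA'⟩
    obtain ⟨h1, h2⟩ := weakDiff_of_pathOp hι hD hAk (WeakDiff.mono ⟨η, hη, hη'⟩)
    obtain ⟨p', e1, e2, e3⟩ := exists_isWeakDeriv_of_pathOp hι hA hD hη
    obtain ⟨h3, h4⟩ := weakDiff_of_pathOp hι hD hAk (p := p') (by
      rw [e3]
      exact hη'.sub (h1.mulOp hA'))
    exact ⟨⟨_, e1, h3⟩, ⟨_, e2, h4⟩⟩

end Regularity

/-! ## The operator `d/dt + A` on Sobolev spaces -/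

section SobolevComplete

variable {E : Type u} [NormedAddCommGroup E] [InnerProductSpace ℝ E] [CompleteSpace E]

instance (k : ℕ) : CompleteSpace (Sobolev E k) := by
  have h : IsClosed (sobolevTuples E k :
      Set (PiLp 2 fun _ : Fin (k + 1) => Lp E 2 (volume : Measure ℝ))) := by
    refine isClosed_of_closure_subset fun f hf j => ?_
    obtain ⟨u, hu, huf⟩ := mem_closure_iff_seq_limit.1 hf
    have hc : ∀ i : Fin (k + 1), Tendsto (fun n => u n i) atTop (𝓝 (f i)) := fun i =>
      ((PiLp.continuous_apply 2 _ i).tendsto f).comp huf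
    exact isWeakDeriv_of_tendsto (fun n => hu n j) (hc _) (hc _)
  exact h.completeSpace_coe

/-- The `j`-th weak derivative as a bounded operator. -/
def sobolevDeriv (k : ℕ) (j : Fin (k + 1)) : Sobolev E k →L[ℝ] Lp E 2 (volume : Measure ℝ) :=
  (PiLp.proj 2 (fun _ : Fin (k + 1) => Lp E 2 (volume : Measure ℝ)) j).comp
    (sobolevTuples E k).subtypeL

omit [CompleteSpace E] in
theorem sobolevDeriv_apply {k : ℕ} (j : Fin (k + 1)) (f : Sobolev E k) :
    sobolevDeriv k j f = f.deriv j := rfl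

/-- Weak derivatives are unique, so the zeroth component determines the whole tuple. -/
theorem injective_sobolevDeriv (k : ℕ) : Function.Injective (sobolevDeriv (E := E) k 0) := by
  intro f g hfg
  refine Subtype.ext (WithLp.ofLp_injective 2 (funext fun j => ?_))
  induction j using Fin.induction with
  | zero => exact hfg
  | succ j ih =>
    have h1 := f.2 j
    have h2 := g.2 j
    have ih' : f.1 j.castSucc = g.1 j.castSucc := ih
    rw [ih'] at h1
    exact h1.unique h2

end SobolevComplete

theorem iteratedDeriv_sub_const_of_pos {V : Type*} [NormedAddCommGroup V] [NormedSpace ℝ V]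
    (A : ℝ → V) (B : V) {i : ℕ} (hi : 0 < i) :
    iteratedDeriv i (fun s => A s - B) = iteratedDeriv i A := by
  obtain ⟨j, rfl⟩ := Nat.exists_eq_succ_of_ne_zero hi.ne'
  rw [iteratedDeriv_succ', iteratedDeriv_succ']
  congr 1
  exact funext fun t => deriv_sub_const B

theorem boundedDiff_of_bddAbove {V : Type*} [NormedAddCommGroup V] [NormedSpace ℝ V] {k : ℕ}
    {A : ℝ →ᵇ V} (hA : ContDiff ℝ k A) {B : V} (h : BddAbove (Set.range fun t =>
      ∑ j ∈ Finset.range (k + 1), ‖iteratedDeriv j (fun s => A s - B) t‖)) : BoundedDiff k A := by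
  obtain ⟨M, hM⟩ := h
  refine boundedDiff_of_iteratedDeriv k 0 (by rwa [zero_add]) (fun i _ hi => ?_) A
    (fun t => by rw [iteratedDeriv_zero])
  rw [zero_add] at hi
  rcases Nat.eq_zero_or_pos i with rfl | hi0
  · exact ⟨‖A‖, fun t => by rw [iteratedDeriv_zero]; exact A.norm_coe_le_norm t⟩
  · refine ⟨M, fun t => ?_⟩
    rw [← iteratedDeriv_sub_const_of_pos A B hi0]
    refine le_trans ?_ (hM ⟨t, rfl⟩)
    exact Finset.single_le_sum (f := fun j => ‖iteratedDeriv j (fun s => A s - B) t‖)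
      (fun j _ => norm_nonneg _) (Finset.mem_range.2 (by omega))

theorem boundedDiff_of_bddAbove_clm {W H : Type*} [NormedAddCommGroup W] [InnerProductSpace ℝ W]
    [NormedAddCommGroup H] [InnerProductSpace ℝ H] {k : ℕ} {A : ℝ →ᵇ (W →L[ℝ] H)}
    (hA : ContDiff ℝ k A) {B : W →L[ℝ] H} (h : BddAbove (Set.range fun t =>
      ∑ j ∈ Finset.range (k + 1), ‖iteratedDeriv j (fun s => A s - B) t‖)) :
    BoundedDiff (V := W →L[ℝ] H) k A := boundedDiff_of_bddAbove hA h

section PathDomain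

variable {T : ReferenceOperator.{u}} {k : ℕ}

/-- The component in `L²_k(ℝ, W)`. -/
def toWL (T : ReferenceOperator.{u}) (k : ℕ) : PathDomain T k →L[ℝ] Sobolev T.W k :=
  (WithLp.fstL 2 ℝ (Sobolev T.W k) (Sobolev T.H (k + 1))).comp (pathPairs T k).subtypeL

/-- The component in `L²_{k + 1}(ℝ, H)`. -/
def toHL (T : ReferenceOperator.{u}) (k : ℕ) : PathDomain T k →L[ℝ] Sobolev T.H (k + 1) :=
  (WithLp.sndL 2 ℝ (Sobolev T.W k) (Sobolev T.H (k + 1))).comp (pathPairs T k).subtypeL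

instance : CompleteSpace (PathDomain T k) := by
  have h : IsClosed (pathPairs T k : Set (WithLp 2 (Sobolev T.W k × Sobolev T.H (k + 1)))) := by
    have h1 : Continuous fun ξ : WithLp 2 (Sobolev T.W k × Sobolev T.H (k + 1)) =>
        T.incl.compLpL 2 (volume : Measure ℝ) (sobolevDeriv k 0 ξ.fst) :=
      (T.incl.compLpL 2 (volume : Measure ℝ)).continuous.comp ((sobolevDeriv k 0).continuous.comp
        (WithLp.fstL 2 ℝ (Sobolev T.W k) (Sobolev T.H (k + 1))).continuous)
    have h2 : Continuous fun ξ : WithLp 2 (Sobolev T.W k × Sobolev T.H (k + 1)) =>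
        sobolevDeriv (k + 1) 0 ξ.snd :=
      (sobolevDeriv (k + 1) 0).continuous.comp
        (WithLp.sndL 2 ℝ (Sobolev T.W k) (Sobolev T.H (k + 1))).continuous
    exact isClosed_eq h1 h2
  exact h.completeSpace_coe

/-- The element of the path space given by an element of `𝒲_k`. -/
def toPathSpace (T : ReferenceOperator.{u}) (k : ℕ) : PathDomain T k →L[ℝ] PathSpace T.incl :=
  (((sobolevDeriv k 0).comp (toWL T k)).prod
    ((sobolevDeriv (k + 1) 1).comp (toHL T k))).codRestrict (pathSpace T.incl) fun ξ => by
      change IsWeakDeriv (T.incl.compLpL 2 volume (ξ.1.fst.deriv 0)) (ξ.1.snd.deriv 1)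
      have h1 : T.incl.compLpL 2 volume (ξ.1.fst.deriv 0) = ξ.1.snd.deriv 0 := ξ.2
      rw [h1]
      exact ξ.1.snd.2 0

theorem injective_toPathSpace : Function.Injective (toPathSpace T k) := by
  intro ξ ζ h
  have h1 : ξ.toW = ζ.toW := injective_sobolevDeriv k (congrArg (pathFst T.incl) h)
  have hξ : T.incl.compLpL 2 volume (ξ.toW.deriv 0) = ξ.toH.deriv 0 := ξ.2
  have hζ : T.incl.compLpL 2 volume (ζ.toW.deriv 0) = ζ.toH.deriv 0 := ζ.2
  have h2 : ξ.toH = ζ.toH := injective_sobolevDeriv (k + 1) (by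
    rw [sobolevDeriv_apply, sobolevDeriv_apply, ← hξ, ← hζ, h1])
  exact Subtype.ext (WithLp.ofLp_injective 2 (Prod.ext h1 h2))

/-- For the converse, k weak derivatives of h = (ιw)' make ιw differentiable of order k + 1. The
element of 𝒲_k is assembled from w and ιw. -/
theorem mem_range_toPathSpace_iff (p : PathSpace T.incl) :
    (∃ ξ, toPathSpace T k ξ = p) ↔ WeakDiff k (pathFst T.incl p) ∧ WeakDiff k (pathSnd T.incl p) := by
  constructor
  · rintro ⟨ξ, rfl⟩
    refine ⟨weakDiff_iff.2 ⟨ξ.toW, rfl⟩, ?_⟩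
    exact weakDiff_iff.2 ⟨⟨WithLp.toLp 2 fun j => ξ.toH.deriv j.succ, fun j => ξ.toH.2 j.succ⟩, rfl⟩
  · rintro ⟨h1, h2⟩
    obtain ⟨w, hw⟩ := weakDiff_iff.1 h1
    have h3 : WeakDiff (k + 1) (T.incl.compLpL 2 volume (pathFst T.incl p)) :=
      ⟨_, isWeakDeriv_path p, h2⟩
    obtain ⟨h, hh⟩ := weakDiff_iff.1 h3
    refine ⟨⟨WithLp.toLp 2 (w, h), ?_⟩, PathSpace.ext hw ?_⟩
    · change T.incl.compLpL 2 volume (w.deriv 0) = h.deriv 0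
      rw [hw, hh]
    · have h4 : IsWeakDeriv (h.deriv 0) (h.deriv 1) := h.2 0
      rw [hh] at h4
      exact h4.unique (isWeakDeriv_path p)

theorem boundedDiff_of_isCkPath {A : ℝ →ᵇ (T.W →L[ℝ] T.H)} (hA : IsCkPath T k A) :
    BoundedDiff (V := T.W →L[ℝ] T.H) k A := by
  obtain ⟨h1, B, -, h2⟩ := hA
  exact boundedDiff_of_bddAbove_clm h1 h2

/-- The operator is the restriction of the lowest-order one. Regularity identifies the kernels and
makes the map of cokernels injective, and density of the smoother target makes it surjective. Hence
the index does not depend on k. -/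
theorem exists_isPathOperator {A : T.admissiblePaths} (hA : BoundedDiff (V := T.W →L[ℝ] T.H) k A.1) :
    ∃ D : PathDomain T k →L[ℝ] Sobolev T.H k,
      IsPathOperator A.1 D ∧ D.IsFredholm ∧ fredholmIndex D = pathIndex T A := by
  have hD := hasFiniteIndex_of_mem_admissiblePaths A.2
  -- The product rule places the image in L²_k(ℝ, H), and the closed graph theorem supplies
  -- boundedness there without estimates.
  obtain ⟨D, hDD⟩ := exists_lift_of_injective ((pathOp T.incl A.1).comp (toPathSpace T k))
    (sobolevDeriv (E := T.H) k 0) (injective_sobolevDeriv k) fun ξ => by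
      obtain ⟨h1, h2⟩ := (mem_range_toPathSpace_iff _).1 ⟨ξ, rfl⟩
      exact weakDiff_iff.1 (h2.add (h1.mulOp hA))
  have hdense : DenseRange (sobolevDeriv (E := T.H) k 0).toLinearMap := denseRange_sobolev_deriv k
  obtain ⟨h1, h2⟩ := linearIndex_of_regularity hD (toPathSpace T k).toLinearMap
    (sobolevDeriv (E := T.H) k 0).toLinearMap injective_toPathSpace (injective_sobolevDeriv k)
    (f' := (D : PathDomain T k →ₗ[ℝ] Sobolev T.H k)) (fun ξ => (hDD ξ).symm)
    (fun p η hη => (mem_range_toPathSpace_iff p).2 (weakDiff_of_pathOp T.incl_injective hD hA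
      (weakDiff_iff.2 ⟨η, hη.symm⟩)))
    (hD.sup_range_eq_top hdense)
  refine ⟨D, fun ξ => ?_, h1.isFredholm, h2⟩
  have h3 : (D ξ).deriv 0 = ξ.toH.deriv 1 + mulOp A.1 (ξ.toW.deriv 0) := hDD ξ
  rw [h3]
  filter_upwards [Lp.coeFn_add (ξ.toH.deriv 1) (mulOp A.1 (ξ.toW.deriv 0)),
    coeFn_mulOp A.1 (ξ.toW.deriv 0)] with t e1 e2
  rw [e1, Pi.add_apply, e2]

end PathDomain

end SpectralFlow

end

theorem theorem16p2 :
    ∃ μ : ∀ T : ReferenceOperator.{u}, T.admissiblePaths → ℤ,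
      IsSpectralFlow μ ∧ (∀ ν, IsSpectralFlow ν → ν = μ) ∧
      ∀ (T : ReferenceOperator.{u}) (k : ℕ) (A : T.admissiblePaths) (Am Ap : T.W →L[ℝ] T.H),
        IsCkPath T k A.1 → TendstoCkLoc k A.1 atBot Am → TendstoCkLoc k A.1 atTop Ap →
        ∃ D : PathDomain T k →L[ℝ] Sobolev T.H k,
          IsPathOperator A.1 D ∧ D.IsFredholm ∧ fredholmIndex D = μ T A :=
  ⟨pathIndex, isSpectralFlow_pathIndex, fun _ hν => hν.unique isSpectralFlow_pathIndex,
    fun _ _ _ _ _ hA _ _ => exists_isPathOperator (boundedDiff_of_isCkPath hA)⟩
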